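/- Let $\mathbb{T}=\mathbb{R}/2\pi\mathbb{Z}$, let $\omega\subset\mathbb{T}$ be a nonempty open set, and let $\mathbb{S}^1\subset\mathbb{R}^2$ be the unit circle. A state is a pair $u=(g_0,g_1)\in H^1\times L^2(\mathbb{T};T\mathbb{S}^1)$, that is, $g_0\in H^1(\mathbb{T};\mathbb{R}^2)$ with $|g_0|=1$ everywhere and $g_1\in L^2(\mathbb{T};\mathbb{R}^2)$ with $g_0\cdot g_1=0$ a.e. For $T>0$, a control in time $T$ is a function $f\in L^2([0,T]\times\mathbb{T};\mathbb{R}^2)$ whose (closed) support is contained in $[0,T]\times\omega$. A solution on $[0,T]$ of the controlled wave maps equation $$-\phi_{tt}+\phi_{xx}=\left(|\phi_t|^2-|\phi_x|^2\right)\phi+f-\langle f,\phi\rangle\phi,\qquad(\phi,\phi_t)(0)=(g_0,g_1),$$ is a function $(\phi,\phi_t)\in C([0,T];H^1\times L^2(\mathbb{T};T\mathbb{S}^1))$, with $\phi_t$ the time derivative of $\phi$ and with the given initial state, such that for every $\tau\in(0,T]$ and every $\varphi\in C^1([0,\tau]\times\mathbb{T};\mathbb{R}^2)$ $$\int_0^\tau\!\!\int_{\mathbb{T}}\Big(\phi_x\cdot\varphi_x-\phi_t\cdot\varphi_t+(|\phi_t|^2-|\phi_x|^2)\,\phi\cdot\varphi+(f-\langle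 f,\phi\rangle\phi)\cdot\varphi\Big)\,dx\,dt=\int_{\mathbb{T}}(\phi_t\cdot\varphi)(0,x)\,dx-\int_{\mathbb{T}}(\phi_t\cdot\varphi)(\tau,x)\,dx.$$ Say that $u^0$ can be steered to $u^1$ in time $T$ if there is a control $f$ in time $T$ such that the equation with control $f$ and initial state $u^0$ has a unique solution on $[0,T]$, and this solution satisfies $(\phi,\phi_t)(T)=u^1$. (a) The controlled wave maps equation with target $\mathbb{S}^1$ is globally exactly controllable in homotopy class: for any two states $u^0=(g_0^0,g_1^0)$ and $u^1=(g_0^1,g_1^1)$ such that $g_0^0$ and $g_0^1$ are homotopic as maps $\mathbb{T}\to\mathbb{S}^1$, there is $T>0$ such that $u^0$ can be steered to $u^1$ in time $T$. (b) Let $$T_0:=\max_{x\in\mathbb{T}}\,\inf\{\alpha\ge 0:\ x+\alpha\in\omega\}.$$ This maximum is attained, and $T_0\le 2\pi$. For every $T>T_0$ and any two states $u^0,u^1$ with homotopic positions, $u^0$ can be steered to $u^1$ in time $T$. (c) The time $T_0$ is optimal, in every homotopy (degree) class: for every $0<T<T_0$ and every continuous map $g:\mathbb{T}\to\mathbb{S}^1$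 there are states $u^0,u^1$, both with position homotopic to $g$, such that for no control $f$ in time $T$ does a solution with control $f$ and initial state $u^0$ satisfy $(\phi,\phi_t)(T)=u^1$. -/

import Mathlib

open MeasureTheory Set

noncomputable section

namespace WaveMaps

/-- The length of the domain circle is positive; this gives the Haar measure on it. -/
instance fact_two_pi_pos : Fact (0 < 2 * Real.pi) := ⟨Real.two_pi_pos⟩

/-- The domain circle `ℝ / 2πℤ`; its `volume` is arc length, of total mass `2π`. -/
abbrev Torus : Type := AddCircle (2 * Real.pi)

/-- The Euclidean plane. -/
abbrev Plane : Type := EuclideanSpace ℝ (Fin 2)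

/-- The target: the unit circle of the Euclidean plane. -/
abbrev Target : Type := Metric.sphere (0 : Plane) 1

/-- The space `L²(ℝ / 2πℤ; ℝ²)`. -/
abbrev L2 : Type := Lp Plane 2 (volume : Measure Torus)

/-- `ψ` is a `C¹` function on the circle with derivative `ψ'`. -/
def IsC1OnTorus (ψ ψ' : Torus → ℝ) : Prop :=
  Continuous ψ' ∧
    ∀ s : ℝ, HasDerivAt (fun r : ℝ => ψ (r : Torus)) (ψ' (s : Torus)) s

/-- `g'` is the weak derivative of `g` on the circle. -/
def IsWeakDeriv (g g' : Torus → Plane) : Prop :=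
  ∀ ψ ψ' : Torus → ℝ, IsC1OnTorus ψ ψ' →
    ∫ x : Torus, ψ' x • g x = - ∫ x : Torus, ψ x • g' x

/-- A state of finite energy: an element of `H¹ × L²(ℝ / 2πℤ; T𝕊¹)`. The position is given by its
continuous representative. The weak derivative of the position is determined by the position. -/
@[ext]
structure State where
  pos : C(Torus, Target)
  posDeriv : L2
  vel : L2
  isWeakDeriv : IsWeakDeriv (fun x => (pos x : Plane)) posDeriv
  tangent : ∀ᵐ x : Torus, inner ℝ (vel x) (pos x : Plane) = 0

/-- The position of a state as an element of `L²`. -/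
def State.posL2 (u : State) : L2 :=
  ContinuousMap.toLp 2 (volume : Measure Torus) ℝ
    ⟨fun x => (u.pos x : Plane), continuous_subtype_val.comp u.pos.continuous⟩

/-- The orthogonal projection of `v` onto the line tangent to the unit circle at `p`. -/
def tangentProj (p v : Plane) : Plane := v - inner ℝ v p • p

/-- `φ` is a `C¹` function of time and space with partial derivatives `φt` and `φx`. -/
structure IsC1OnSpaceTime (φ φt φx : ℝ × Torus → Plane) : Prop where
  continuous : Continuous φ
  continuous_time : Continuous φt
  continuous_space : Continuous φx
  hasDerivAt_time : ∀ (t : ℝ) (x : Torus), HasDerivAt (fun s : ℝ => φ (s, x)) (φt (t, x)) t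
  hasDerivAt_space : ∀ t r : ℝ,
    HasDerivAt (fun s : ℝ => φ (t, (s : Torus))) (φx (t, (r : Torus))) r

/-- `f` is a square integrable control on `[0, T] × ℝ / 2πℤ`, extended by zero to all times, whose
(closed) support is contained in `[0, T] × ω`. -/
structure IsControl (ω : Set Torus) (T : ℝ) (f : ℝ × Torus → Plane) : Prop where
  memLp : MemLp f 2 (volume : Measure (ℝ × Torus))
  support_subset : tsupport f ⊆ Icc 0 T ×ˢ ω

/-- `t ↦ u t = (φ(t), φ_t(t))` is, on `[0, T]`, a solution with initial state `u₀` of the wave maps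
equation `-φ_tt + φ_xx = (|φ_t|² - |φ_x|²) φ + f^{φ^⊥}`: it is continuous in time with values in
`H¹ × L²`, its second component is the time derivative of the first, and the equation holds in the
weak sense. The values of `u` outside `[0, T]` are irrelevant. -/
structure IsSolution (T : ℝ) (f : ℝ × Torus → Plane) (u₀ : State) (u : ℝ → State) : Prop where
  initial : u 0 = u₀
  hasDerivWithinAt : ∀ t ∈ Icc 0 T,
    HasDerivWithinAt (fun s => (u s).posL2) (u t).vel (Icc 0 T) t
  continuousOn_posDeriv : ContinuousOn (fun t => (u t).posDeriv) (Icc 0 T)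
  continuousOn_vel : ContinuousOn (fun t => (u t).vel) (Icc 0 T)
  weak_eq : ∀ τ ∈ Ioc 0 T, ∀ φ φt φx : ℝ × Torus → Plane, IsC1OnSpaceTime φ φt φx →
    ∫ t in (0 : ℝ)..τ, ∫ x : Torus,
        (inner ℝ ((u t).posDeriv x) (φx (t, x)) - inner ℝ ((u t).vel x) (φt (t, x))
          + (‖(u t).vel x‖ ^ 2 - ‖(u t).posDeriv x‖ ^ 2)
              * inner ℝ ((u t).pos x : Plane) (φ (t, x))
          + inner ℝ (tangentProj ((u t).pos x : Plane) (f (t, x))) (φ (t, x)))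
      = (∫ x : Torus, inner ℝ ((u 0).vel x) (φ (0, x)))
        - ∫ x : Torus, inner ℝ ((u τ).vel x) (φ (τ, x))

/-- Some control supported in `[0, T] × ω` is such that the unique solution starting from `u₀` is at
`u₁` at time `T`. -/
def Steerable (ω : Set Torus) (T : ℝ) (u₀ u₁ : State) : Prop :=
  ∃ f : ℝ × Torus → Plane, IsControl ω T f ∧
    ∃ u : ℝ → State, IsSolution T f u₀ u ∧ u T = u₁ ∧
      ∀ v : ℝ → State, IsSolution T f u₀ v → EqOn v u (Icc 0 T)

/-- Global exact controllability in homotopy class; the time may depend on the two states. -/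
def GloballyExactlyControllable (ω : Set Torus) : Prop :=
  ∀ u₀ u₁ : State, ContinuousMap.Homotopic u₀.pos u₁.pos → ∃ T > 0, Steerable ω T u₀ u₁

/-- Global exact controllability in homotopy class in the time `T`. -/
def GloballyExactlyControllableInTime (ω : Set Torus) (T : ℝ) : Prop :=
  ∀ u₀ u₁ : State, ContinuousMap.Homotopic u₀.pos u₁.pos → Steerable ω T u₀ u₁

/-- The time which a point starting at `x` and moving with unit speed needs to reach `ω`. -/
def hittingTime (ω : Set Torus) (x : Torus) : ℝ :=
  sInf {α : ℝ | 0 ≤ α ∧ x + (α : Torus) ∈ ω}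

/-- The critical time: the largest of the times needed to reach `ω`. -/
def criticalTime (ω : Set Torus) : ℝ := ⨆ x : Torus, hittingTime ω x

end WaveMaps

end

noncomputable section

namespace WaveMaps

open Filter Topology
open scoped ENNReal

section

/-! ### Square integrable and continuous functions on the circle -/

/-! The target is one-dimensional, so the nonlinearity only reflects the embedding in the plane.
Write a map of degree d as the standard map `windC d` rotated by a real function θ on the torus, and
let J be the quarter turn. Velocity and space derivative are then θ_t Jφ and (θ_x + d) Jφ, the
quadratic term cancels against the derivatives of the frame Jφ, and a control h Jφ makes θ solve the
linear equation -θ_tt + θ_xx = h (`weak_integrand`, `IsLinSol.isSolution`). Homotopic positions have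
lifts with the same d (`exists_lifts_of_homotopic`), so steering becomes a linear problem.

Steering (`exists_isLinSol_transport`, `Controls.exists_isLinSol`). By d'Alembert, the data split
into two travelling parts. In characteristic coordinates the profile of each is prescribed as F₀ +
N(t)q, where N(t) integrates s(T - s)ρ along the characteristics up to time t. After the critical
time ρ can be chosen with closed support in ω and N(T) > 0 everywhere, so dividing by N(T) gives q.
The required source lives on the support of ρ. The means of the velocities, which travelling parts
cannot produce, are supplied by a separated term z(t)ρ.

Uniqueness (`IsSolution.eqOn`). Testing the weak equation with the frame of the solution itself
shows that angular velocity plus or minus angular strain is transported along characteristics, with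
the control as source. For two solutions this bounds the angular differences by the time integral of
the uniform distance of the positions. A Sobolev estimate bounds that distance back, and Gronwall's
inequality concludes. This uses that the constructed control is continuous in time with values in
L².

Optimality (`exists_not_reachable`). Before the critical time a short arc moving at unit speed
avoids ω, so the invariant it carries is conserved, whatever the control; states of equal position
and different velocity violate this conservation.

Space derivatives are L² derivatives of orbits of the translation group. Time and space derivatives
thus share one calculus of paths (`PathDeriv`), with continuity in the uniform norm and
differentiability in L². -/

/-- Square integrable functions on the circle with values in `E`. -/
abbrev SqInt (E : Type*) [NormedAddCommGroup E] : Type _ := Lp E 2 (volume : Measure Torus)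

variable {E F G : Type*} [NormedAddCommGroup E] [NormedSpace ℝ E] [NormedAddCommGroup F]
  [NormedSpace ℝ F] [NormedAddCommGroup G] [NormedSpace ℝ G]

/-- The inclusion of the continuous functions into the square integrable ones. -/
def toL2 : C(Torus, E) →L[ℝ] SqInt E := ContinuousMap.toLp 2 (volume : Measure Torus) ℝ

lemma coeFn_toL2 (y : C(Torus, E)) : toL2 y =ᵐ[volume] y := ContinuousMap.coeFn_toLp _ _

lemma toL2_injective : Function.Injective (toL2 : C(Torus, E) → SqInt E) :=
  ContinuousMap.toLp_injective _

/-- The pointwise product of a continuous and a square integrable function. -/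
def mulL2 (B : E →L[ℝ] F →L[ℝ] G) : C(Torus, E) →L[ℝ] SqInt F →L[ℝ] SqInt G :=
  (B.holderL (volume : Measure Torus) ∞ 2 2).comp
    (ContinuousMap.toLp ∞ (volume : Measure Torus) ℝ)

lemma coeFn_mulL2 (B : E →L[ℝ] F →L[ℝ] G) (y : C(Torus, E)) (v : SqInt F) :
    mulL2 B y v =ᵐ[volume] fun x => B (y x) (v x) := by
  have h := B.coeFn_holder (μ := (volume : Measure Torus)) (p := ∞) (q := 2) (r := 2)
    (ContinuousMap.toLp ∞ (volume : Measure Torus) ℝ y) v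
  filter_upwards [h, ContinuousMap.coeFn_toLp (p := ∞) (𝕜 := ℝ) (volume : Measure Torus) y]
    with x hx hy
  rw [← hy, ← hx]
  rfl

/-- The pointwise product of two continuous functions. -/
def mulC (B : E →L[ℝ] F →L[ℝ] G) (y : C(Torus, E)) (z : C(Torus, F)) : C(Torus, G) :=
  ⟨fun x => B (y x) (z x), by fun_prop⟩

@[simp] lemma mulC_apply (B : E →L[ℝ] F →L[ℝ] G) (y : C(Torus, E)) (z : C(Torus, F)) (x : Torus) :
    mulC B y z x = B (y x) (z x) := rfl

lemma toL2_mulC (B : E →L[ℝ] F →L[ℝ] G) (y : C(Torus, E)) (z : C(Torus, F)) :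
    toL2 (mulC B y z) = mulL2 B y (toL2 z) := by
  apply Lp.ext
  filter_upwards [coeFn_toL2 (mulC B y z), coeFn_toL2 z, coeFn_mulL2 B y (toL2 z)] with x h1 h2 h3
  rw [h1, h3, h2, mulC_apply]

lemma toL2_mulC_flip (B : E →L[ℝ] F →L[ℝ] G) (y : C(Torus, E)) (z : C(Torus, F)) :
    toL2 (mulC B y z) = mulL2 B.flip z (toL2 y) := by
  rw [← toL2_mulC]; rfl

lemma continuous_mulC (B : E →L[ℝ] F →L[ℝ] G) :
    Continuous fun p : C(Torus, E) × C(Torus, F) => mulC B p.1 p.2 := by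
  refine ContinuousMap.continuous_of_continuous_uncurry _ ?_
  have h1 : Continuous fun p : (C(Torus, E) × C(Torus, F)) × Torus => p.1.1 p.2 := by fun_prop
  have h2 : Continuous fun p : (C(Torus, E) × C(Torus, F)) × Torus => p.1.2 p.2 := by fun_prop
  exact (B.continuous.comp h1).clm_apply h2

/-- Translation of a continuous function by `s`. -/
def shiftC (s : ℝ) : C(Torus, E) →L[ℝ] C(Torus, E) where
  toFun y := ⟨fun x => y (x + (s : Torus)), by fun_prop⟩
  map_add' _ _ := rfl
  map_smul' _ _ := rfl
  cont := ContinuousMap.continuous_precomp ⟨fun x => x + (s : Torus), by fun_prop⟩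

@[simp] lemma shiftC_apply (s : ℝ) (y : C(Torus, E)) (x : Torus) :
    shiftC s y x = y (x + (s : Torus)) := rfl

lemma measurePreserving_shift (s : ℝ) :
    MeasurePreserving (fun x : Torus => x + (s : Torus)) volume volume :=
  measurePreserving_add_right volume (s : Torus)

/-- Translation of a square integrable function by `s`. -/
def shiftL (s : ℝ) : SqInt E →ₗᵢ[ℝ] SqInt E :=
  Lp.compMeasurePreservingₗᵢ ℝ (fun x : Torus => x + (s : Torus)) (measurePreserving_shift s)

lemma coeFn_shiftL (s : ℝ) (v : SqInt E) :
    shiftL s v =ᵐ[volume] fun x => v (x + (s : Torus)) :=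
  Lp.coeFn_compMeasurePreserving v (measurePreserving_shift s)

lemma shiftL_toL2 (s : ℝ) (y : C(Torus, E)) : shiftL s (toL2 y) = toL2 (shiftC s y) := by
  apply Lp.ext
  filter_upwards [coeFn_shiftL s (toL2 y), coeFn_toL2 (shiftC s y),
    (measurePreserving_shift s).quasiMeasurePreserving.ae (coeFn_toL2 y)] with x h1 h2 h3
  rw [h1, h2, h3, shiftC_apply]

@[simp] lemma shiftC_zero (y : C(Torus, E)) : shiftC 0 y = y := by
  ext x; simp

@[simp] lemma shiftL_zero (v : SqInt E) : shiftL 0 v = v := by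
  apply Lp.ext
  filter_upwards [coeFn_shiftL 0 v] with x h1
  rw [h1]; simp

lemma shiftC_shiftC (s t : ℝ) (y : C(Torus, E)) : shiftC s (shiftC t y) = shiftC (s + t) y := by
  ext x; simp [add_assoc]

lemma shiftL_shiftL (s t : ℝ) (v : SqInt E) : shiftL s (shiftL t v) = shiftL (s + t) v := by
  apply Lp.ext
  filter_upwards [coeFn_shiftL s (shiftL t v), coeFn_shiftL (s + t) v,
    (measurePreserving_shift s).quasiMeasurePreserving.ae (coeFn_shiftL t v)] with x h1 h2 h3
  rw [h1, h2, h3]; simp [add_assoc]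

lemma shiftC_mulC (B : E →L[ℝ] F →L[ℝ] G) (s : ℝ) (y : C(Torus, E)) (z : C(Torus, F)) :
    shiftC s (mulC B y z) = mulC B (shiftC s y) (shiftC s z) := rfl

lemma continuous_shiftC_uncurry : Continuous fun p : ℝ × C(Torus, E) => shiftC p.1 p.2 := by
  refine ContinuousMap.continuous_of_continuous_uncurry _ ?_
  have h1 : Continuous fun p : (ℝ × C(Torus, E)) × Torus => p.1.2 (p.2 + (p.1.1 : Torus)) := by
    fun_prop
  exact h1

/-- Translations of L² are strongly continuous but not continuous in operator norm, hence joint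
continuity in the shift and the function. -/
lemma continuous_shiftL_uncurry : Continuous fun p : ℝ × SqInt E => shiftL p.1 p.2 := by
  let g : ℝ × SqInt E → C(Torus, Torus) := fun p => ⟨fun x => x + (p.1 : Torus), by fun_prop⟩
  have hg : Continuous g := by
    refine ContinuousMap.continuous_of_continuous_uncurry _ ?_
    have h1 : Continuous fun p : (ℝ × SqInt E) × Torus => p.2 + (p.1.1 : Torus) := by
      fun_prop
    exact h1
  exact Continuous.compMeasurePreservingLp (p := 2) (f := fun p : ℝ × SqInt E => p.2)
    continuous_snd hg (fun p => measurePreserving_shift p.1) (by simp)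

lemma continuous_shiftL {s : ℝ → ℝ} {v : ℝ → SqInt E} (hs : Continuous s) (hv : Continuous v) :
    Continuous fun t => shiftL (s t) (v t) :=
  continuous_shiftL_uncurry.comp (hs.prodMk hv)

lemma continuous_shiftC {s : ℝ → ℝ} {v : ℝ → C(Torus, E)} (hs : Continuous s) (hv : Continuous v) :
    Continuous fun t => shiftC (s t) (v t) :=
  continuous_shiftC_uncurry.comp (hs.prodMk hv)

/-! ### Derivatives of paths of functions -/

/-- If the operators `L s` converge jointly, then `s ↦ L s (f s - f t)` is differentiable at `t`. -/
lemma hasDerivWithinAt_family {X Y : Type*} [NormedAddCommGroup X] [NormedSpace ℝ X]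
    [NormedAddCommGroup Y] [NormedSpace ℝ Y] {L : ℝ → X →L[ℝ] Y} {f : ℝ → X} {f' : X} {S : Set ℝ}
    {t : ℝ} (hL : Tendsto (fun p : ℝ × X => L p.1 p.2) (𝓝[S] t ×ˢ 𝓝 f') (𝓝 (L t f')))
    (hf : HasDerivWithinAt f f' S t) :
    HasDerivWithinAt (fun s => L s (f s - f t)) (L t f') S t := by
  rw [hasDerivWithinAt_iff_tendsto_slope] at hf ⊢
  have h1 : Tendsto (fun s => ((s, slope f t s) : ℝ × X)) (𝓝[S \ {t}] t) (𝓝[S] t ×ˢ 𝓝 f') :=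
    (tendsto_id.mono_right (nhdsWithin_mono t sdiff_subset)).prodMk hf
  refine (hL.comp h1).congr fun s => ?_
  simp [slope_def_module]

/-- The path `y` of continuous functions is continuous at `t`, and has derivative `y'` there as a
path of square integrable functions. -/
def PathDeriv (y : ℝ → C(Torus, E)) (y' : SqInt E) (S : Set ℝ) (t : ℝ) : Prop :=
  ContinuousWithinAt y S t ∧ HasDerivWithinAt (fun s => toL2 (y s)) y' S t

lemma PathDeriv.mono {y : ℝ → C(Torus, E)} {y' : SqInt E} {S S' : Set ℝ} {t : ℝ}
    (h : PathDeriv y y' S t) (hS : S' ⊆ S) : PathDeriv y y' S' t :=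
  ⟨h.1.mono hS, h.2.mono hS⟩

lemma PathDeriv.add {y z : ℝ → C(Torus, E)} {y' z' : SqInt E} {S : Set ℝ} {t : ℝ}
    (hy : PathDeriv y y' S t) (hz : PathDeriv z z' S t) :
    PathDeriv (fun s => y s + z s) (y' + z') S t := by
  refine ⟨hy.1.add hz.1, ?_⟩
  simp only [map_add]
  exact hy.2.fun_add hz.2

lemma tendsto_mulL2 (B : E →L[ℝ] F →L[ℝ] G) {y : ℝ → C(Torus, E)} {S : Set ℝ} {t : ℝ}
    (hy : ContinuousWithinAt y S t) (v : SqInt F) :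
    Tendsto (fun p : ℝ × SqInt F => mulL2 B (y p.1) p.2) (𝓝[S] t ×ˢ 𝓝 v)
      (𝓝 (mulL2 B (y t) v)) := by
  have h1 : Tendsto (fun p : ℝ × SqInt F => (mulL2 B (y p.1), p.2)) (𝓝[S] t ×ˢ 𝓝 v)
      (𝓝 (mulL2 B (y t), v)) :=
    ((((mulL2 B).continuous.tendsto _).comp hy).comp tendsto_fst).prodMk_nhds tendsto_snd
  exact (isBoundedBilinearMap_apply.continuous.tendsto _).comp h1

/-- Split the increment as y(s)(z(s) - z(t)) + (y(s) - y(t))z(t). In the first term uniform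
convergence of y meets L² convergence of the quotients of z, which is why `PathDeriv` involves both
topologies. -/
lemma PathDeriv.mulC (B : E →L[ℝ] F →L[ℝ] G) {y : ℝ → C(Torus, E)} {z : ℝ → C(Torus, F)}
    {y' : SqInt E} {z' : SqInt F} {S : Set ℝ} {t : ℝ}
    (hy : PathDeriv y y' S t) (hz : PathDeriv z z' S t) :
    PathDeriv (fun s => mulC B (y s) (z s)) (mulL2 B (y t) z' + mulL2 B.flip (z t) y') S t := by
  refine ⟨(continuous_mulC B).continuousAt.comp_continuousWithinAt
    (f := fun s => (y s, z s)) (hy.1.prodMk hz.1), ?_⟩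
  have h1 := hasDerivWithinAt_family (L := fun s => mulL2 B (y s)) (tendsto_mulL2 B hy.1 z') hz.2
  have h2 := (mulL2 B.flip (z t)).hasFDerivAt.comp_hasDerivWithinAt t hy.2
  refine (h1.add h2).congr_deriv rfl |>.congr_of_eventuallyEq ?_ ?_ |>.congr_deriv rfl
  · refine Eventually.of_forall fun s => ?_
    simp only [Pi.add_apply, Function.comp, map_sub, ← toL2_mulC]
    exact (sub_add_cancel _ _).symm
  · simp [← toL2_mulC_flip]

/-- The continuous function `v` has the square integrable derivative `v'` on the circle. -/
def SpDeriv (v : C(Torus, E)) (v' : SqInt E) : Prop :=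
  HasDerivAt (fun s => toL2 (shiftC s v)) v' 0

/-- By the group law, differentiability of the orbit at 0 propagates to all times; `e` is a speed,
later 1 or -1. -/
lemma SpDeriv.pathDeriv_shift {v : C(Torus, E)} {v' : SqInt E} (h : SpDeriv v v') (e t : ℝ) :
    PathDeriv (fun s => shiftC (e * s) v) (e • shiftL (e * t) v') univ t := by
  refine ⟨(continuous_shiftC (by fun_prop) continuous_const).continuousWithinAt, ?_⟩
  rw [hasDerivWithinAt_univ]
  have h0 : HasDerivAt (fun s => e * s - e * t) e t := by
    simpa using ((hasDerivAt_id t).const_mul e).sub_const (e * t)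
  have h1 : HasDerivAt (fun s => toL2 (shiftC (e * s - e * t) v)) (e • v') t := by
    have h' : HasDerivAt (fun s => toL2 (shiftC s v)) v' (e * t - e * t) := by
      rw [sub_self]; exact h
    exact h'.scomp t h0
  have h2 := (shiftL (E := E) (e * t)).toContinuousLinearMap.hasFDerivAt.comp_hasDerivAt t h1
  refine (h2.congr_of_eventuallyEq (Eventually.of_forall fun s => ?_)).congr_deriv ?_
  · simp [shiftL_toL2, shiftC_shiftC]
  · simp

lemma SpDeriv.pathDeriv {v : C(Torus, E)} {v' : SqInt E} (h : SpDeriv v v') :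
    PathDeriv (fun s => shiftC s v) v' univ 0 := by
  simpa using h.pathDeriv_shift 1 0

lemma PathDeriv.spDeriv {v : C(Torus, E)} {v' : SqInt E}
    (h : PathDeriv (fun s => shiftC s v) v' univ 0) : SpDeriv v v' := by
  exact hasDerivWithinAt_univ.1 h.2

lemma SpDeriv.hasDerivAt_shift {v : C(Torus, E)} {v' : SqInt E} (h : SpDeriv v v') (t : ℝ) :
    HasDerivAt (fun s => toL2 (shiftC s v)) (shiftL t v') t := by
  simpa [PathDeriv, hasDerivWithinAt_univ] using (h.pathDeriv_shift 1 t).2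

lemma SpDeriv.shift {v : C(Torus, E)} {v' : SqInt E} (h : SpDeriv v v') (r : ℝ) :
    SpDeriv (shiftC r v) (shiftL r v') := by
  have h2 := (shiftL (E := E) r).toContinuousLinearMap.hasFDerivAt.comp_hasDerivAt 0 h
  refine (h2.congr_of_eventuallyEq (Eventually.of_forall fun s => ?_))
  simp [shiftL_toL2, shiftC_shiftC, add_comm]

lemma SpDeriv.unique {v : C(Torus, E)} {v' v'' : SqInt E} (h : SpDeriv v v') (h' : SpDeriv v v'') :
    v' = v'' := HasDerivAt.unique h h'

/-- Translation commutes with products, so this is the product rule for paths applied to translation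
orbits. -/
lemma SpDeriv.mulC (B : E →L[ℝ] F →L[ℝ] G) {y : C(Torus, E)} {z : C(Torus, F)} {y' : SqInt E}
    {z' : SqInt F} (hy : SpDeriv y y') (hz : SpDeriv z z') :
    SpDeriv (mulC B y z) (mulL2 B y z' + mulL2 B.flip z y') := by
  have := hy.pathDeriv.mulC B hz.pathDeriv
  simp only [← shiftC_mulC, shiftC_zero] at this
  exact this.spDeriv

lemma SpDeriv.add {v w : C(Torus, E)} {v' w' : SqInt E} (hv : SpDeriv v v') (hw : SpDeriv w w') :
    SpDeriv (v + w) (v' + w') := by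
  simp only [SpDeriv, map_add]
  exact HasDerivAt.fun_add hv hw

lemma SpDeriv.sub {v w : C(Torus, E)} {v' w' : SqInt E} (hv : SpDeriv v v') (hw : SpDeriv w w') :
    SpDeriv (v - w) (v' - w') := by
  simp only [SpDeriv, map_sub]
  exact HasDerivAt.fun_sub hv hw

lemma SpDeriv.const_smul {v : C(Torus, E)} {v' : SqInt E} (hv : SpDeriv v v') (c : ℝ) :
    SpDeriv (c • v) (c • v') := by
  simp only [SpDeriv, map_smul]
  exact HasDerivAt.fun_const_smul c hv

lemma spDeriv_const (c : E) : SpDeriv (ContinuousMap.const Torus c) 0 := by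
  have : (fun s : ℝ => toL2 (shiftC s (ContinuousMap.const Torus c)))
      = fun _ => toL2 (ContinuousMap.const Torus c) := rfl
  rw [SpDeriv, this]
  exact hasDerivAt_const _ _

/-- Differentiation along a characteristic. -/
lemma PathDeriv.shift {W : ℝ → C(Torus, E)} {W' Wx : SqInt E} {S : Set ℝ} {t : ℝ} (e : ℝ)
    (hW : PathDeriv W W' S t) (hx : SpDeriv (W t) Wx) :
    PathDeriv (fun s => shiftC (e * s) (W s)) (shiftL (e * t) (W' + e • Wx)) S t := by
  refine ⟨continuous_shiftC_uncurry.continuousAt.comp_continuousWithinAt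
    (f := fun s : ℝ => (e * s, W s)) (ContinuousWithinAt.prodMk
      (by fun_prop : Continuous fun s : ℝ => e * s).continuousWithinAt hW.1), ?_⟩
  have h1 := hasDerivWithinAt_family
    (L := fun s => (shiftL (E := E) (e * s)).toContinuousLinearMap) (f' := W') (S := S) (t := t)
    (by
      have hc : Continuous fun p : ℝ × SqInt E => shiftL (e * p.1) p.2 :=
        continuous_shiftL_uncurry.comp (f := fun p : ℝ × SqInt E => (e * p.1, p.2)) (by fun_prop)
      refine (hc.tendsto (t, W')).mono_left ?_
      rw [nhds_prod_eq]
      exact Filter.prod_mono nhdsWithin_le_nhds le_rfl) hW.2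
  have h2 := ((hx.pathDeriv_shift e t).mono (subset_univ S)).2
  refine ((h1.add h2).congr_of_eventuallyEq (Eventually.of_forall fun s => ?_) ?_).congr_deriv ?_
  · simp [shiftL_toL2]
  · simp
  · simp

/-! ### Inner products and integration by parts -/

section Inner

variable {H : Type*} [NormedAddCommGroup H] [InnerProductSpace ℝ H]

lemma inner_shiftL (s : ℝ) (v w : SqInt H) :
    inner ℝ (shiftL s v) w = inner ℝ v (shiftL (-s) w) := by
  rw [← (shiftL (E := H) (-s)).inner_map_map, shiftL_shiftL]; simp

/-- Integration by parts: translating both factors leaves the inner product unchanged, so its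
derivative in the shift vanishes. -/
lemma SpDeriv.inner_eq_neg {v w : C(Torus, H)} {v' w' : SqInt H} (hv : SpDeriv v v')
    (hw : SpDeriv w w') : inner ℝ v' (toL2 w) = - inner ℝ (toL2 v) w' := by
  have h1 := HasDerivAt.inner ℝ hv hw
  have h2 : (fun s : ℝ => inner ℝ (toL2 (shiftC s v)) (toL2 (shiftC s w)))
      = fun _ => inner ℝ (toL2 v) (toL2 w) := by
    funext s
    rw [← shiftL_toL2, ← shiftL_toL2, (shiftL (E := H) s).inner_map_map]
  rw [h2] at h1
  have h3 := h1.unique (hasDerivAt_const _ _)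
  simp only [shiftC_zero] at h3
  linarith

lemma inner_toL2 (v w : C(Torus, H)) :
    inner ℝ (toL2 v) (toL2 w) = ∫ x, inner ℝ (v x) (w x) := by
  rw [L2.inner_def]
  refine integral_congr_ae ?_
  filter_upwards [coeFn_toL2 v, coeFn_toL2 w] with x h1 h2
  rw [h1, h2]

lemma inner_toL2_right (v : SqInt H) (w : C(Torus, H)) :
    inner ℝ v (toL2 w) = ∫ x, inner ℝ (v x) (w x) := by
  rw [L2.inner_def]
  refine integral_congr_ae ?_
  filter_upwards [coeFn_toL2 w] with x h2
  rw [h2]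

end Inner

/-! ### Continuously differentiable functions -/

/-- A pointwise derivative that is continuous in the uniform norm is a derivative in this norm. -/
lemma hasDerivAt_of_pointwise {y y' : ℝ → C(Torus, E)}
    (h : ∀ x s, HasDerivAt (fun s => y s x) (y' s x) s) (hy' : Continuous y') (t : ℝ) :
    HasDerivAt y (y' t) t := by
  rw [hasDerivAt_iff_isLittleO, Asymptotics.isLittleO_iff]
  intro c hc
  obtain ⟨δ, hδ, hδ'⟩ := Metric.continuousAt_iff.1 (hy'.continuousAt (x := t)) c hc
  filter_upwards [Metric.ball_mem_nhds t hδ] with s hs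
  rw [ContinuousMap.norm_le _ (by positivity)]
  intro x
  have h1 : ∀ r ∈ Metric.ball t δ, HasDerivWithinAt (fun r => y r x - (r - t) • y' t x)
      (y' r x - y' t x) (Metric.ball t δ) r := by
    intro r _
    have h2 := (h x r).fun_sub (((hasDerivAt_id r).sub_const t).smul_const (y' t x))
    simpa using h2.hasDerivWithinAt
  have h3 : ∀ r ∈ Metric.ball t δ, ‖y' r x - y' t x‖ ≤ c := by
    intro r hr
    have h4 := (hδ' hr).le
    rw [dist_eq_norm] at h4
    exact ((y' r - y' t).norm_coe_le_norm x).trans h4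
  have := (convex_ball t δ).norm_image_sub_le_of_norm_hasDerivWithin_le h1 h3
    (Metric.mem_ball_self hδ) hs
  simpa [sub_right_comm] using this

lemma pathDeriv_of_hasDerivAt {y : ℝ → C(Torus, E)} {y' : C(Torus, E)} {t : ℝ} (S : Set ℝ)
    (h : HasDerivAt y y' t) : PathDeriv y (toL2 y') S t :=
  ⟨h.continuousAt.continuousWithinAt,
    ((toL2 (E := E)).hasFDerivAt.comp_hasDerivAt t h).hasDerivWithinAt⟩

/-- `v` is continuously differentiable on the circle with derivative `v'`. -/
def C1Deriv (v v' : C(Torus, E)) : Prop :=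
  ∀ s : ℝ, HasDerivAt (fun r : ℝ => v (r : Torus)) (v' (s : Torus)) s

lemma C1Deriv.hasDerivAt_shiftC {v v' : C(Torus, E)} (h : C1Deriv v v') (t : ℝ) :
    HasDerivAt (fun s => shiftC s v) (shiftC t v') t := by
  refine hasDerivAt_of_pointwise (y := fun s => shiftC s v) (y' := fun s => shiftC s v')
    (fun x s => ?_) (continuous_shiftC continuous_id continuous_const) t
  induction x using QuotientAddGroup.induction_on with
  | H x =>
    have := (h (x + s)).comp_const_add x s
    simpa using this

lemma C1Deriv.spDeriv {v v' : C(Torus, E)} (h : C1Deriv v v') : SpDeriv v (toL2 v') := by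
  have h1 := h.hasDerivAt_shiftC 0
  rw [shiftC_zero] at h1
  exact (pathDeriv_of_hasDerivAt univ h1).spDeriv

lemma c1Deriv_of_hasDerivAt_shiftC {v v' : C(Torus, E)}
    (h : ∀ t, HasDerivAt (fun s => shiftC s v) (shiftC t v') t) : C1Deriv v v' := by
  intro s
  have h1 := (ContinuousMap.evalCLM ℝ (M := E) (0 : Torus)).hasFDerivAt.comp_hasDerivAt s (h s)
  simpa [Function.comp_def] using h1

lemma C1Deriv.mulC (B : E →L[ℝ] F →L[ℝ] G) {y y' : C(Torus, E)} {z z' : C(Torus, F)}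
    (hy : C1Deriv y y') (hz : C1Deriv z z') :
    C1Deriv (mulC B y z) (mulC B y z' + WaveMaps.mulC B y' z) := fun s =>
  ContinuousLinearMap.hasDerivAt_of_bilinear (B := B) (fun _ => hy s) (fun _ => hz s)

/-- The mean of `v` over a segment of length `h`. -/
def steklov (h : ℝ) (v : C(Torus, E)) : C(Torus, E) := h⁻¹ • ∫ s in (0 : ℝ)..h, shiftC s v

/-- The difference quotient of `v`. -/
def diffQuot (h : ℝ) (v : C(Torus, E)) : C(Torus, E) := h⁻¹ • (shiftC h v - v)

lemma SpDeriv.tendsto_diffQuot {v : C(Torus, E)} {v' : SqInt E} (hv : SpDeriv v v') :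
    Tendsto (fun h => toL2 (diffQuot h v)) (𝓝[≠] 0) (𝓝 v') := by
  rw [SpDeriv, hasDerivAt_iff_tendsto_slope] at hv
  refine hv.congr fun h => ?_
  simp [slope_def_module, diffQuot]

variable [CompleteSpace E]

/-- Steklov averages serve as mollifiers: they converge uniformly to `v`, and their derivatives, the
difference quotients, converge in L² as soon as `v` has an L² derivative. -/
lemma c1Deriv_steklov (h : ℝ) (v : C(Torus, E)) : C1Deriv (steklov h v) (diffQuot h v) := by
  apply c1Deriv_of_hasDerivAt_shiftC
  intro t
  have hc : Continuous fun s => shiftC s v := continuous_shiftC continuous_id continuous_const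
  have h1 : (fun s => shiftC s (steklov h v)) = fun s => h⁻¹ • ((∫ r in (0 : ℝ)..(s + h), shiftC r v)
      - ∫ r in (0 : ℝ)..s, shiftC r v) := by
    funext s
    rw [steklov, map_smul, ← ContinuousLinearMap.intervalIntegral_comp_comm _
      (hc.intervalIntegrable _ _)]
    simp only [shiftC_shiftC]
    rw [intervalIntegral.integral_comp_add_left (fun r => shiftC r v), add_zero,
      intervalIntegral.integral_interval_sub_left (hc.intervalIntegrable _ _)
        (hc.intervalIntegrable _ _)]
  rw [h1]
  have h2 : ∀ s, HasDerivAt (fun s => ∫ r in (0 : ℝ)..s, shiftC r v) (shiftC s v) s := fun s =>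
    hc.integral_hasStrictDerivAt 0 s |>.hasDerivAt
  have h3 := (((h2 (t + h)).comp_add_const t h).sub (h2 t)).const_smul h⁻¹
  refine h3.congr_deriv ?_
  simp [diffQuot, shiftC_shiftC]

lemma tendsto_steklov (v : C(Torus, E)) : Tendsto (fun h => steklov h v) (𝓝[≠] 0) (𝓝 v) := by
  have hc : Continuous fun s => shiftC s v := continuous_shiftC continuous_id continuous_const
  have h2 : HasDerivAt (fun s => ∫ r in (0 : ℝ)..s, shiftC r v) (shiftC 0 v) 0 :=
    hc.integral_hasStrictDerivAt 0 0 |>.hasDerivAt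
  rw [hasDerivAt_iff_tendsto_slope, shiftC_zero] at h2
  refine h2.congr fun h => ?_
  simp [slope_def_module, steklov]

end

section

/-! ### Weak derivatives -/

section Weak

variable {H : Type*} [NormedAddCommGroup H] [InnerProductSpace ℝ H] [CompleteSpace H]

/-- Steklov averages approximate continuous functions uniformly, and these are dense in L². -/
lemma eq_zero_of_forall_inner_c1 {w : SqInt H}
    (h : ∀ V V' : C(Torus, H), C1Deriv V V' → inner ℝ w (toL2 V) = 0) : w = 0 := by
  have h1 : ∀ V : C(Torus, H), inner ℝ w (toL2 V) = 0 := by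
    intro V
    have h2 : Tendsto (fun r => inner ℝ w (toL2 (steklov r V))) (𝓝[≠] 0)
        (𝓝 (inner ℝ w (toL2 V))) :=
      tendsto_const_nhds.inner (((toL2 (E := H)).continuous.tendsto _).comp (tendsto_steklov V))
    refine tendsto_nhds_unique h2 (tendsto_const_nhds.congr fun r => ?_)
    exact (h _ _ (c1Deriv_steklov r V)).symm
  have hd : DenseRange (toL2 : C(Torus, H) → SqInt H) :=
    ContinuousMap.toLp_denseRange H (volume : Measure Torus) ℝ (by simp)
  have h3 : ∀ v : SqInt H, inner ℝ w v = 0 := fun v =>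
    hd.induction_on v (isClosed_eq (by fun_prop) continuous_const) h1
  exact inner_self_eq_zero.1 (h3 w)

lemma SpDeriv.sub_eq_integral {v : C(Torus, H)} {v' : SqInt H} (h : SpDeriv v v') (r : ℝ) :
    toL2 (shiftC r v) - toL2 v = ∫ s in (0 : ℝ)..r, shiftL s v' := by
  have hc : Continuous fun s => shiftL s v' := continuous_shiftL continuous_id continuous_const
  rw [intervalIntegral.integral_eq_sub_of_hasDerivAt (fun s _ => h.hasDerivAt_shift s)
    (hc.intervalIntegrable _ _), shiftC_zero]

/-- The integrated form of differentiability can be tested weakly and survives limits; strong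
continuity of translations gives the derivative back. -/
lemma spDeriv_of_sub_eq_integral {v : C(Torus, H)} {v' : SqInt H}
    (h : ∀ r, toL2 (shiftC r v) - toL2 v = ∫ s in (0 : ℝ)..r, shiftL s v') : SpDeriv v v' := by
  have hc : Continuous fun s => shiftL s v' := continuous_shiftL continuous_id continuous_const
  have h1 : HasDerivAt (fun r => ∫ s in (0 : ℝ)..r, shiftL s v') (shiftL 0 v') 0 :=
    (hc.integral_hasStrictDerivAt 0 0).hasDerivAt
  rw [shiftL_zero] at h1
  refine (h1.add_const (toL2 v)).congr_of_eventuallyEq (Eventually.of_forall fun r => ?_)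
  simp [← h r]

/-- A weak derivative is a derivative for the group of translations. -/
lemma spDeriv_of_forall_c1 {v : C(Torus, H)} {v' : SqInt H}
    (h : ∀ V V' : C(Torus, H), C1Deriv V V' →
      inner ℝ (toL2 v) (toL2 V') = - inner ℝ v' (toL2 V)) : SpDeriv v v' := by
  apply spDeriv_of_sub_eq_integral
  intro r
  have hc : Continuous fun s => shiftL s v' := continuous_shiftL continuous_id continuous_const
  rw [← sub_eq_zero]
  apply eq_zero_of_forall_inner_c1
  intro V V' hV
  have hV' : ∀ s : ℝ, C1Deriv (shiftC s V) (shiftC s V') := by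
    intro s
    apply c1Deriv_of_hasDerivAt_shiftC
    intro t
    have h1 := (shiftC (E := H) s).hasFDerivAt.comp_hasDerivAt t (hV.hasDerivAt_shiftC t)
    simpa [Function.comp_def, shiftC_shiftC, add_comm] using h1
  -- Moving the translation onto `V` makes the pairing differentiable although `v` is not yet known
  -- to be.
  have h1 : ∀ s : ℝ, HasDerivAt (fun s => inner ℝ (toL2 (shiftC s v) - toL2 v) (toL2 V))
      (inner ℝ (shiftL s v') (toL2 V)) s := by
    intro s
    have e1 : (fun s => inner ℝ (toL2 (shiftC s v) - toL2 v) (toL2 V))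
        = fun s => inner ℝ (toL2 v) (toL2 (shiftC (-s) V)) - inner ℝ (toL2 v) (toL2 V) := by
      funext s
      rw [inner_sub_left, ← shiftL_toL2, inner_shiftL, shiftL_toL2]
    have e2 : HasDerivAt (fun s => toL2 (shiftC (-s) V)) (-toL2 (shiftC (-s) V')) s := by
      have := (hV.hasDerivAt_shiftC (-s)).scomp s (hasDerivAt_neg s)
      have := (toL2 (E := H)).hasFDerivAt.comp_hasDerivAt s this
      simpa [Function.comp_def] using this
    have e3 : HasDerivAt (fun s => inner ℝ (toL2 v) (toL2 (shiftC (-s) V)))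
        (inner ℝ (toL2 v) (-toL2 (shiftC (-s) V'))) s := by
      simpa using (hasDerivAt_const s (toL2 v)).inner ℝ e2
    rw [e1]
    refine (e3.sub_const _).congr_deriv ?_
    rw [inner_neg_right, h _ _ (hV' (-s)), neg_neg, inner_shiftL, shiftL_toL2]
  have h2 : ∀ s : ℝ, HasDerivAt (fun r => inner ℝ (∫ s in (0 : ℝ)..r, shiftL s v') (toL2 V))
      (inner ℝ (shiftL s v') (toL2 V)) s := by
    intro s
    have := (hc.integral_hasStrictDerivAt 0 s).hasDerivAt
    simpa using this.inner ℝ (hasDerivAt_const s (toL2 V))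
  have h3 := is_const_of_deriv_eq_zero
    (f := fun r => inner ℝ (toL2 (shiftC r v) - toL2 v) (toL2 V)
      - inner ℝ (∫ s in (0 : ℝ)..r, shiftL s v') (toL2 V))
    (fun s => ((h1 s).sub (h2 s)).differentiableAt)
    (fun s => by simpa using ((h1 s).fun_sub (h2 s)).deriv) r 0
  simp only [shiftC_zero, sub_self, inner_zero_left, intervalIntegral.integral_same] at h3
  rw [inner_sub_left, h3]

end Weak

lemma isC1OnTorus_iff {ψ ψ' : C(Torus, ℝ)} : IsC1OnTorus ψ ψ' ↔ C1Deriv ψ ψ' :=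
  ⟨fun h => h.2, fun h => ⟨ψ'.continuous, h⟩⟩

lemma IsC1OnTorus.continuous {ψ ψ' : Torus → ℝ} (h : IsC1OnTorus ψ ψ') : Continuous ψ := by
  have h1 : Continuous fun r : ℝ => ψ (r : Torus) :=
    continuous_iff_continuousAt.2 fun r => (h.2 r).continuousAt
  exact continuous_coinduced_dom.2 h1

lemma integrable_continuous_smul {E : Type*} [NormedAddCommGroup E] [NormedSpace ℝ E]
    (ψ : C(Torus, ℝ)) (g : SqInt E) : Integrable (fun x => ψ x • g x) volume := by
  have h1 : Integrable (mulL2 (ContinuousLinearMap.lsmul ℝ ℝ) ψ g) volume :=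
    (Lp.memLp _).integrable (by norm_num)
  refine h1.congr ?_
  filter_upwards [coeFn_mulL2 (ContinuousLinearMap.lsmul ℝ ℝ) ψ g] with x hx
  rw [hx]; rfl

lemma integral_smul_apply (ψ : C(Torus, ℝ)) (g : SqInt Plane) (i : Fin 2) :
    (∫ x, ψ x • g x) i = ∫ x, ψ x * g x i := by
  have := (EuclideanSpace.proj (𝕜 := ℝ) i).integral_comp_comm (integrable_continuous_smul ψ g)
  simpa using this.symm

/-- The coordinates of a continuously differentiable function. -/
def coordC (i : Fin 2) (V : C(Torus, Plane)) : C(Torus, ℝ) :=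
  ⟨fun x => V x i, by fun_prop⟩

lemma C1Deriv.coordC {V V' : C(Torus, Plane)} (h : C1Deriv V V') (i : Fin 2) :
    C1Deriv (coordC i V) (coordC i V') := fun s =>
  (EuclideanSpace.proj (𝕜 := ℝ) i).hasFDerivAt.comp_hasDerivAt s (h s)

lemma inner_toL2_eq_sum (g : SqInt Plane) (V : C(Torus, Plane)) :
    inner ℝ g (toL2 V) = ∑ i, ∫ x, coordC i V x * g x i := by
  rw [inner_toL2_right, ← integral_finsetSum]
  · refine integral_congr_ae (Eventually.of_forall fun x => ?_)
    simp [PiLp.inner_apply, coordC]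
  · intro i _
    have := (EuclideanSpace.proj (𝕜 := ℝ) i).integrable_comp
      (integrable_continuous_smul (WaveMaps.coordC i V) g)
    simpa using this

lemma isWeakDeriv_congr {g : Torus → Plane} {g₁ : SqInt Plane} {g' : Torus → Plane}
    (h : g₁ =ᵐ[volume] g) (hw : IsWeakDeriv g g') : IsWeakDeriv g₁ g' := by
  intro ψ ψ' hψ
  rw [← hw ψ ψ' hψ]
  refine integral_congr_ae ?_
  filter_upwards [h] with x hx
  rw [hx]

/-- Coordinates reduce vector test functions to the scalar ones of `IsWeakDeriv`. With the converse
below, this ties the definition of a state to the translation derivative. -/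
lemma IsWeakDeriv.spDeriv {v : C(Torus, Plane)} {v' : SqInt Plane} (h : IsWeakDeriv v v') :
    SpDeriv v v' := by
  have h := isWeakDeriv_congr (coeFn_toL2 v) h
  apply spDeriv_of_forall_c1
  intro V V' hV
  rw [inner_toL2_eq_sum, inner_toL2_eq_sum, ← Finset.sum_neg_distrib]
  refine Finset.sum_congr rfl fun i _ => ?_
  have h1 := h _ _ (isC1OnTorus_iff.2 (hV.coordC i))
  have h2 := congrArg (fun p : Plane => p i) h1
  simpa only [PiLp.neg_apply, integral_smul_apply] using h2

lemma SpDeriv.isWeakDeriv {v : C(Torus, Plane)} {v' : SqInt Plane} (h : SpDeriv v v') :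
    IsWeakDeriv v v' := by
  have hv : (toL2 v : Torus → Plane) =ᵐ[volume] v := coeFn_toL2 v
  intro ψ ψ' hψ
  let Ψ : C(Torus, ℝ) := ⟨ψ, hψ.continuous⟩
  let Ψ' : C(Torus, ℝ) := ⟨ψ', hψ.1⟩
  have hΨ : C1Deriv Ψ Ψ' := hψ.2
  have e0 : ∫ x, ψ' x • v x = ∫ x, Ψ' x • toL2 v x := by
    refine integral_congr_ae ?_
    filter_upwards [hv] with x hx
    rw [hx]; rfl
  have e1 : ∫ x, ψ x • v' x = ∫ x, Ψ x • v' x := rfl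
  rw [e0, e1]
  ext i
  rw [PiLp.neg_apply, integral_smul_apply, integral_smul_apply]
  have hc : C1Deriv (ContinuousMap.const Torus (EuclideanSpace.single i (1 : ℝ))) 0 :=
    fun s => hasDerivAt_const _ _
  have hw := (hΨ.mulC (ContinuousLinearMap.lsmul ℝ ℝ) hc).spDeriv
  have h3 := h.inner_eq_neg hw
  rw [inner_toL2_right, inner_toL2_right] at h3
  have h4 : ∫ x, inner ℝ (v' x) (WaveMaps.mulC (ContinuousLinearMap.lsmul ℝ ℝ) Ψ
      (ContinuousMap.const Torus (EuclideanSpace.single i (1 : ℝ))) x) = ∫ x, Ψ x * v' x i := by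
    congr 1; funext x
    simp [inner_smul_right, EuclideanSpace.inner_single_right]
  rw [h4] at h3
  rw [h3, neg_neg]
  congr 1; funext x
  simp [inner_smul_right, EuclideanSpace.inner_single_right]

/-! ### Sobolev inequality and primitives -/

section Sobolev

variable {E : Type*} [NormedAddCommGroup E] [NormedSpace ℝ E]

/-- The norm of the constant function one. -/
def oneNorm : ℝ := ‖toL2 (1 : C(Torus, ℝ))‖

lemma integral_norm_le (f : C(Torus, E)) : ∫ x, ‖f x‖ ≤ oneNorm * ‖toL2 f‖ := by
  let g : C(Torus, ℝ) := ⟨fun x => ‖f x‖, by fun_prop⟩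
  have h1 : ∫ x, ‖f x‖ = inner ℝ (toL2 (1 : C(Torus, ℝ))) (toL2 g) := by
    rw [inner_toL2]; congr 1; funext x; simp [g]
  have h2 : ‖toL2 g‖ ≤ ‖toL2 f‖ := by
    refine Lp.norm_le_norm_of_ae_le ?_
    filter_upwards [coeFn_toL2 g, coeFn_toL2 f] with x h1 h2
    rw [h1, h2]; simp [g]
  rw [h1]
  refine (real_inner_le_norm _ _).trans ?_
  exact mul_le_mul_of_nonneg_left h2 (norm_nonneg _)

variable [CompleteSpace E]

/-- The increment v(b) - v(a) is the limit of the integrals over [a, b] of the difference quotients.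
Cauchy-Schwarz bounds them by `oneNorm` times L² norms, which converge. -/
lemma SpDeriv.norm_sub_le {v : C(Torus, E)} {v' : SqInt E} (h : SpDeriv v v') (x y : Torus) :
    ‖v y - v x‖ ≤ oneNorm * ‖v'‖ := by
  obtain ⟨a, rfl⟩ := QuotientAddGroup.mk_surjective x
  -- The second point is lifted within one period of the first, so that the integral over [a, b] is
  -- dominated by one over the torus.
  obtain ⟨b, ⟨hab, hb⟩, rfl⟩ : ∃ b, b ∈ Ico a (a + 2 * Real.pi) ∧ (b : Torus) = y := by
    have := AddCircle.coe_image_Ico_eq (2 * Real.pi) a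
    have hy : y ∈ ((↑) : ℝ → Torus) '' Ico a (a + 2 * Real.pi) := by rw [this]; trivial
    exact hy
  have hc : Continuous fun r : ℝ => v (r : Torus) := by fun_prop
  have h1 : HasDerivAt (fun s : ℝ => ∫ r in a..b, v ((r + s : ℝ) : Torus))
      (v (b : Torus) - v (a : Torus)) 0 := by
    have e : (fun s : ℝ => ∫ r in a..b, v ((r + s : ℝ) : Torus))
        = fun s => (∫ r in (0 : ℝ)..(b + s), v (r : Torus)) - ∫ r in (0 : ℝ)..(a + s), v (r : Torus) := by
      funext s
      rw [intervalIntegral.integral_comp_add_right (fun r : ℝ => v (r : Torus)),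
        intervalIntegral.integral_interval_sub_left (hc.intervalIntegrable _ _)
        (hc.intervalIntegrable _ _)]
    rw [e]
    have h2 : ∀ s : ℝ, HasDerivAt (fun s => ∫ r in (0 : ℝ)..s, v (r : Torus)) (v (s : Torus)) s :=
      fun s => (hc.integral_hasStrictDerivAt 0 s).hasDerivAt
    simpa using ((h2 (b + 0)).comp_const_add b 0).fun_sub ((h2 (a + 0)).comp_const_add a 0)
  rw [hasDerivAt_iff_tendsto_slope] at h1
  refine le_of_tendsto_of_tendsto h1.norm (h.tendsto_diffQuot.norm.const_mul oneNorm) ?_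
  refine Eventually.of_forall fun s => ?_
  refine le_trans ?_ (integral_norm_le (diffQuot s v))
  have e1 : slope (fun s : ℝ => ∫ r in a..b, v ((r + s : ℝ) : Torus)) 0 s
      = ∫ r in a..b, diffQuot s v (r : Torus) := by
    have i1 : ∀ s : ℝ, IntervalIntegrable (fun r : ℝ => v ((r + s : ℝ) : Torus)) volume a b :=
      fun s => (by fun_prop : Continuous fun r : ℝ => v ((r + s : ℝ) : Torus)).intervalIntegrable _ _
    rw [slope_def_module, ← intervalIntegral.integral_sub (i1 s) (i1 0),
      ← intervalIntegral.integral_smul]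
    simp [diffQuot]
  have hn : Continuous fun r : ℝ => ‖diffQuot s v (r : Torus)‖ := by fun_prop
  change ‖slope (fun s : ℝ => ∫ r in a..b, v ((r + s : ℝ) : Torus)) 0 s‖ ≤ _
  rw [e1, ← AddCircle.intervalIntegral_preimage (2 * Real.pi) a (fun x => ‖diffQuot s v x‖)]
  refine (intervalIntegral.norm_integral_le_integral_norm hab).trans ?_
  exact intervalIntegral.integral_mono_interval le_rfl hab hb.le
    (Eventually.of_forall fun _ => norm_nonneg _) (hn.intervalIntegrable _ _)

lemma volume_real_univ : (volume : Measure Torus).real univ = 2 * Real.pi := by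
  rw [Measure.real, AddCircle.measure_univ, ENNReal.toReal_ofReal Real.two_pi_pos.le]

/-- Average the oscillation bound over the torus; since its mass 2π is at least 1, that factor can
be dropped. -/
lemma SpDeriv.norm_le {v : C(Torus, E)} {v' : SqInt E} (h : SpDeriv v v') :
    ‖v‖ ≤ oneNorm * (‖toL2 v‖ + ‖v'‖) := by
  have h0 : 0 ≤ oneNorm := norm_nonneg _
  rw [ContinuousMap.norm_le _ (by positivity)]
  intro x
  have h1 : ∫ _ : Torus, (‖v x‖ - oneNorm * ‖v'‖) ≤ ∫ y, ‖v y‖ := by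
    refine integral_mono (integrable_const _)
      ((by fun_prop : Continuous fun y => ‖v y‖).integrable_of_hasCompactSupport
        (HasCompactSupport.of_compactSpace _)) fun y => ?_
    have := h.norm_sub_le y x
    have := norm_sub_norm_le (v x) (v y)
    linarith
  have h2 := h1.trans (integral_norm_le v)
  rw [integral_const, volume_real_univ, smul_eq_mul] at h2
  have hpi : 1 ≤ 2 * Real.pi := by linarith [Real.two_le_pi]
  by_cases hs : ‖v x‖ - oneNorm * ‖v'‖ ≤ 0
  · have : 0 ≤ oneNorm * ‖toL2 v‖ := by positivity
    linarith
  · push Not at hs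
    nlinarith

end Sobolev

/-- Vanishing of the mean is what makes the primitive periodic. -/
lemma exists_c1Deriv_eq (w : C(Torus, ℝ)) (h : ∫ x, w x = 0) : ∃ β : C(Torus, ℝ), C1Deriv β w := by
  have hc : Continuous fun r : ℝ => w (r : Torus) := by fun_prop
  let g : ℝ → ℝ := fun x => ∫ r in (0 : ℝ)..x, w (r : Torus)
  have hg : ∀ s : ℝ, HasDerivAt g (w (s : Torus)) s := fun s =>
    (hc.integral_hasStrictDerivAt 0 s).hasDerivAt
  have hp : Function.Periodic g (2 * Real.pi) := by
    intro x
    simp only [g]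
    rw [← intervalIntegral.integral_add_adjacent_intervals (hc.intervalIntegrable 0 x)
      (hc.intervalIntegrable x _), AddCircle.intervalIntegral_preimage (2 * Real.pi) x w, h, add_zero]
  refine ⟨⟨hp.lift, continuous_coinduced_dom.2 ?_⟩, fun s => ?_⟩
  · exact continuous_iff_continuousAt.2 fun s => (hg s).continuousAt
  · exact hg s

/-- Approximate `w` by continuous functions of mean zero. Their primitives are uniformly Cauchy by
the oscillation bound, and the integrated formula passes to the limit. -/
lemma exists_spDeriv_eq (w : SqInt ℝ) (h : inner ℝ w (toL2 1) = 0) :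
    ∃ β : C(Torus, ℝ), SpDeriv β w := by
  have hd : DenseRange (toL2 : C(Torus, ℝ) → SqInt ℝ) :=
    ContinuousMap.toLp_denseRange ℝ (volume : Measure Torus) ℝ (by simp)
  obtain ⟨u, hu, hlim⟩ := mem_closure_iff_seq_limit.1 (hd w)
  choose v hv using hu
  -- The mean of the approximant; it tends to the mean of `w`, which is zero.
  let c : ℕ → ℝ := fun n => (2 * Real.pi)⁻¹ * inner ℝ (u n) (toL2 1)
  have hcl : Tendsto c atTop (𝓝 0) := by
    have := (hlim.inner (tendsto_const_nhds (x := toL2 (1 : C(Torus, ℝ))))).const_mul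
      (2 * Real.pi)⁻¹
    rwa [h, mul_zero] at this
  let W : ℕ → C(Torus, ℝ) := fun n => v n - c n • 1
  have hW : ∀ n, ∫ x, W n x = 0 := by
    intro n
    have e : ∫ x, W n x = inner ℝ (toL2 (W n)) (toL2 (1 : C(Torus, ℝ))) := by
      rw [inner_toL2]; simp
    have e1 : inner ℝ (toL2 (1 : C(Torus, ℝ))) (toL2 (1 : C(Torus, ℝ))) = 2 * Real.pi := by
      rw [inner_toL2]
      simp [volume_real_univ]
    rw [e, map_sub, map_smul, inner_sub_left, inner_smul_left, e1, hv n]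
    simp only [c, conj_trivial]
    field_simp
    ring
  choose β₀ hβ₀ using fun n => exists_c1Deriv_eq (W n) (hW n)
  -- Normalized to vanish at 0, so that the oscillation bound controls the uniform norm.
  let β : ℕ → C(Torus, ℝ) := fun n => β₀ n - ContinuousMap.const Torus (β₀ n 0)
  have hβ : ∀ n, SpDeriv (β n) (toL2 (W n)) := fun n => by
    simpa using (hβ₀ n).spDeriv.sub (spDeriv_const (β₀ n 0))
  have hβ0 : ∀ n, β n 0 = 0 := fun n => by simp [β]
  have hWl : Tendsto (fun n => toL2 (W n)) atTop (𝓝 w) := by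
    have := hlim.sub (hcl.smul_const (toL2 (1 : C(Torus, ℝ))))
    simp only [zero_smul, sub_zero] at this
    refine this.congr fun n => ?_
    simp [W, hv n]
  have hcauchy : CauchySeq β := by
    have h1 : CauchySeq fun n => toL2 (W n) := hWl.cauchySeq
    rw [Metric.cauchySeq_iff] at h1 ⊢
    intro ε hε
    have h0 : 0 ≤ oneNorm := norm_nonneg _
    obtain ⟨N, hN⟩ := h1 (ε / (oneNorm + 1)) (by positivity)
    refine ⟨N, fun m hm n hn => ?_⟩
    have h2 := hN m hm n hn
    rw [dist_eq_norm] at h2 ⊢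
    have h3 : ‖β m - β n‖ ≤ oneNorm * ‖toL2 (W m) - toL2 (W n)‖ := by
      rw [ContinuousMap.norm_le _ (by positivity)]
      intro x
      have := ((hβ m).sub (hβ n)).norm_sub_le 0 x
      simpa [hβ0] using this
    rw [lt_div_iff₀ (by positivity)] at h2
    nlinarith [norm_nonneg (toL2 (W m) - toL2 (W n))]
  obtain ⟨b, hb⟩ := cauchySeq_tendsto_of_complete hcauchy
  refine ⟨b, spDeriv_of_sub_eq_integral fun r => ?_⟩
  have l1 : Tendsto (fun n => toL2 (shiftC r (β n)) - toL2 (β n)) atTop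
      (𝓝 (toL2 (shiftC r b) - toL2 b)) :=
    (((toL2 (E := ℝ)).continuous.tendsto _).comp (((shiftC r).continuous.tendsto _).comp hb)).sub
      (((toL2 (E := ℝ)).continuous.tendsto _).comp hb)
  have l2 : Tendsto (fun n => ∫ s in (0 : ℝ)..r, shiftL s (toL2 (W n))) atTop
      (𝓝 (∫ s in (0 : ℝ)..r, shiftL s w)) := by
    rw [tendsto_iff_norm_sub_tendsto_zero]
    have l3 : Tendsto (fun n => ‖toL2 (W n) - w‖ * |r - 0|) atTop (𝓝 0) := by
      simpa using (tendsto_iff_norm_sub_tendsto_zero.1 hWl).mul_const |r - 0|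
    refine squeeze_zero (fun _ => norm_nonneg _) (fun n => ?_) l3
    have hc : ∀ v : SqInt ℝ, IntervalIntegrable (fun s => shiftL s v) volume 0 r := fun v =>
      (continuous_shiftL continuous_id continuous_const).intervalIntegrable _ _
    rw [← intervalIntegral.integral_sub (hc _) (hc _)]
    refine intervalIntegral.norm_integral_le_of_norm_le_const fun s _ => ?_
    rw [← map_sub, LinearIsometry.norm_map]
  refine tendsto_nhds_unique l1 (l2.congr fun n => ?_)
  exact ((hβ n).sub_eq_integral r).symm

end

section

/-! ### The rotation of the plane by a right angle -/

/-- The rotation of the plane by a right angle. -/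
def J : Plane →L[ℝ] Plane :=
  LinearMap.toContinuousLinearMap
    { toFun := fun p => !₂[-p 1, p 0]
      map_add' := fun p q => by ext i; fin_cases i <;> simp; ring
      map_smul' := fun c p => by ext i; fin_cases i <;> simp }

@[simp] lemma J_apply_zero (p : Plane) : J p 0 = -p 1 := rfl

@[simp] lemma J_apply_one (p : Plane) : J p 1 = p 0 := rfl

lemma plane_inner (p q : Plane) : inner ℝ p q = p 0 * q 0 + p 1 * q 1 := by
  simp [PiLp.inner_apply, Fin.sum_univ_two, mul_comm]

@[simp] lemma J_J (p : Plane) : J (J p) = -p := by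
  ext i; fin_cases i <;> simp

lemma inner_J_self (p : Plane) : inner ℝ (J p) p = 0 := by
  rw [plane_inner]; simp; ring

lemma inner_J_J (p q : Plane) : inner ℝ (J p) (J q) = inner ℝ p q := by
  simp only [plane_inner, J_apply_zero, J_apply_one]; ring

@[simp] lemma norm_J (p : Plane) : ‖J p‖ = ‖p‖ := by
  rw [norm_eq_sqrt_real_inner, inner_J_J, ← norm_eq_sqrt_real_inner]

lemma plane_norm_sq (p : Plane) : ‖p‖ ^ 2 = p 0 ^ 2 + p 1 ^ 2 := by
  rw [← real_inner_self_eq_norm_sq, plane_inner]; ring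

lemma inner_smul_add_inner_smul_J {p : Plane} (hp : ‖p‖ = 1) (v : Plane) :
    inner ℝ p v • p + inner ℝ (J p) v • J p = v := by
  have h : p 0 ^ 2 + p 1 ^ 2 = 1 := by rw [← plane_norm_sq, hp]; norm_num
  have h0 : inner ℝ p v = p 0 * v 0 + p 1 * v 1 := plane_inner p v
  have h1 : inner ℝ (J p) v = -p 1 * v 0 + p 0 * v 1 := by
    rw [plane_inner, J_apply_zero, J_apply_one]
  rw [h0, h1]
  ext i
  fin_cases i
  · simp; linear_combination v 0 * h
  · simp; linear_combination v 1 * h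

lemma eq_inner_smul_J {p v : Plane} (hp : ‖p‖ = 1) (hv : inner ℝ p v = 0) :
    v = inner ℝ (J p) v • J p := by
  have := inner_smul_add_inner_smul_J hp v
  rw [hv, zero_smul, zero_add] at this
  exact this.symm

lemma tangentProj_eq {p : Plane} (hp : ‖p‖ = 1) (v : Plane) :
    tangentProj p v = inner ℝ (J p) v • J p := by
  have := inner_smul_add_inner_smul_J hp v
  rw [tangentProj, sub_eq_iff_eq_add, real_inner_comm p v, add_comm, this]

/-- The rotation of the plane by an angle. -/
def rot (α : ℝ) (p : Plane) : Plane := Real.cos α • p + Real.sin α • J p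

lemma rot_add (α β : ℝ) (p : Plane) : rot (α + β) p = rot α (rot β p) := by
  simp only [rot, map_add, map_smul, J_J, Real.cos_add, Real.sin_add]
  module

@[simp] lemma rot_zero (p : Plane) : rot 0 p = p := by simp [rot]

lemma norm_rot (α : ℝ) (p : Plane) : ‖rot α p‖ = ‖p‖ := by
  rw [← sq_eq_sq₀ (norm_nonneg _) (norm_nonneg _), plane_norm_sq, plane_norm_sq]
  simp only [rot, PiLp.add_apply, PiLp.smul_apply, J_apply_zero, J_apply_one, smul_eq_mul]
  linear_combination (p 0 ^ 2 + p 1 ^ 2) * Real.sin_sq_add_cos_sq α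

lemma inner_J_rot {p : Plane} (hp : ‖p‖ = 1) (α : ℝ) : inner ℝ (J p) (rot α p) = Real.sin α := by
  simp [rot, inner_add_right, inner_smul_right, inner_J_self, hp]

/-- The pairing `(p, c) ↦ c • J p`. -/
def smulJ : Plane →L[ℝ] ℝ →L[ℝ] Plane := (ContinuousLinearMap.lsmul ℝ ℝ).flip.comp J

@[simp] lemma smulJ_apply (p : Plane) (c : ℝ) : smulJ p c = c • J p := rfl

/-- The inner product of the plane. -/
def innerB : Plane →L[ℝ] Plane →L[ℝ] ℝ := innerSL ℝ

@[simp] lemma innerB_apply (p v : Plane) : innerB p v = inner ℝ p v := rfl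

/-- The pairing `(p, v) ↦ ⟨J p, v⟩`. -/
def innerJ : Plane →L[ℝ] Plane →L[ℝ] ℝ := (innerSL ℝ).comp J

@[simp] lemma innerJ_apply (p v : Plane) : innerJ p v = inner ℝ (J p) v := rfl

/-- The pointwise rotation of a map by a function. -/
def rotC (y : C(Torus, ℝ)) (g : C(Torus, Plane)) : C(Torus, Plane) :=
  ⟨fun x => rot (y x) (g x), by unfold rot; fun_prop⟩

@[simp] lemma rotC_apply (y : C(Torus, ℝ)) (g : C(Torus, Plane)) (x : Torus) :
    rotC y g x = rot (y x) (g x) := rfl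

lemma abs_sin_sub_self_le {x : ℝ} (hx : |x| ≤ 1) : |Real.sin x - x| ≤ |x| ^ 3 / 4 := by
  have key : ∀ x : ℝ, 0 < x → x ≤ 1 → |Real.sin x - x| ≤ x ^ 3 / 4 := by
    intro x h0 h1
    have h2 := Real.sin_gt_sub_cube h0
    have h3 := Real.sin_lt h0
    rw [abs_le]; constructor <;> nlinarith [pow_pos h0 3]
  rcases lt_trichotomy x 0 with h | h | h
  · have := key (-x) (by linarith) (by rwa [abs_of_neg h] at hx)
    rw [abs_of_neg h]
    rw [Real.sin_neg, ← abs_neg] at this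
    convert this using 2; ring
  · simp [h]
  · rw [abs_of_pos h] at hx ⊢
    exact key x h hx

lemma norm_rot_sub_le {x : ℝ} (hx : |x| ≤ 1) {p : Plane} (hp : ‖p‖ = 1) :
    ‖rot x p - p - x • J p‖ ≤ |x| * |x| := by
  have e : rot x p - p - x • J p = (Real.cos x - 1) • p + (Real.sin x - x) • J p := by
    rw [rot]; module
  have h1 := abs_sin_sub_self_le hx
  have h2 : |Real.cos x - 1| ≤ x ^ 2 / 2 := by
    rw [abs_le]; constructor
    · linarith [Real.one_sub_sq_div_two_le_cos (x := x)]
    · nlinarith [Real.cos_le_one x]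
  rw [e]
  refine (norm_add_le _ _).trans ?_
  rw [norm_smul, norm_smul, norm_J, hp, mul_one, mul_one, Real.norm_eq_abs, Real.norm_eq_abs]
  rw [← sq_abs] at h2
  nlinarith [abs_nonneg x, sq_nonneg |x|]

/-- One factor is the sine because in `pathDeriv_of_rotC` only the sine of the angle increment is
read off from the rotated map, whose differentiability is given. -/
lemma abs_sin_sub_self_le_mul {x : ℝ} (hx : |x| ≤ 1) :
    |x - Real.sin x| ≤ |x| * |Real.sin x| := by
  have h1 := abs_sin_sub_self_le hx
  have h2 : |x| ≤ |Real.sin x| + |Real.sin x - x| := by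
    have := abs_sub_abs_le_abs_sub x (Real.sin x)
    rw [abs_sub_comm x] at this; linarith
  rw [abs_sub_comm]
  have h3 : |x| ^ 3 ≤ |x| := by
    have := mul_le_mul_of_nonneg_left (pow_le_one₀ (n := 2) (abs_nonneg x) hx) (abs_nonneg x)
    nlinarith
  have h5 : |x| * |x| ^ 2 ≤ |x| * |x| := by
    apply mul_le_mul_of_nonneg_left _ (abs_nonneg x); nlinarith [abs_nonneg x]
  nlinarith [abs_nonneg x, abs_nonneg (Real.sin x)]

/-! ### Chain rules -/

/-- The bound is o(1) times O(s - t). In both chain rules the small factor is a uniform norm and the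
other an L² norm, which absorbs the quadratic remainders. -/
lemma hasDerivWithinAt_zero_of_norm_le {X Z : Type*} [NormedAddCommGroup X] [NormedSpace ℝ X]
    [NormedAddCommGroup Z] [NormedSpace ℝ Z] {f : ℝ → X} {z : ℝ → Z} {z' : Z} {d : ℝ → ℝ}
    {S : Set ℝ} {t : ℝ} (hd : Tendsto d (𝓝[S] t) (𝓝 0)) (hz : HasDerivWithinAt z z' S t)
    (h : ∀ᶠ s in 𝓝[S] t, ‖f s‖ ≤ d s * ‖z s - z t‖) (ht : f t = 0) :
    HasDerivWithinAt f 0 S t := by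
  rw [hasDerivWithinAt_iff_isLittleO]
  have h1 : (fun s => d s * ‖z s - z t‖) =o[𝓝[S] t] fun s => s - t := by
    have := ((Asymptotics.isLittleO_one_iff ℝ).2 hd).mul_isBigO hz.hasFDerivWithinAt.isBigO_sub.norm_left
    simpa using this
  refine (Asymptotics.IsBigO.of_bound 1 ?_).trans_isLittleO h1
  filter_upwards [h] with s hs
  simp only [ht, sub_zero, smul_zero, one_mul]
  exact hs.trans (le_abs_self _)

lemma norm_toL2_le {E F : Type*} [NormedAddCommGroup E] [NormedSpace ℝ E] [NormedAddCommGroup F]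
    [NormedSpace ℝ F] {f : C(Torus, E)} {g : C(Torus, F)} {c : ℝ}
    (h : ∀ x, ‖f x‖ ≤ c * ‖g x‖) : ‖toL2 f‖ ≤ c * ‖toL2 g‖ := by
  refine Lp.norm_le_mul_norm_of_ae_le_mul ?_
  filter_upwards [coeFn_toL2 f, coeFn_toL2 g] with x h1 h2
  rw [h1, h2]; exact h x

lemma tendsto_norm_sub {E : Type*} [NormedAddCommGroup E] {y : ℝ → C(Torus, E)} {S : Set ℝ} {t : ℝ}
    (h : ContinuousWithinAt y S t) : Tendsto (fun s => ‖y s - y t‖) (𝓝[S] t) (𝓝 0) :=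
  tendsto_iff_norm_sub_tendsto_zero.1 h

lemma continuous_rotC (g : C(Torus, Plane)) : Continuous fun y : C(Torus, ℝ) => rotC y g := by
  refine ContinuousMap.continuous_of_continuous_uncurry _ ?_
  have h1 : Continuous fun p : C(Torus, ℝ) × Torus => p.1 p.2 := by fun_prop
  show Continuous fun p : C(Torus, ℝ) × Torus => rot (p.1 p.2) (g p.2)
  unfold rot; fun_prop

/-- With P the rotated map at time t, the map at time s is P rotated by the small angle y(s) - y(t);
expand the rotation to first order. -/
lemma PathDeriv.rotC {y : ℝ → C(Torus, ℝ)} {y' : SqInt ℝ} {S : Set ℝ} {t : ℝ}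
    (hy : PathDeriv y y' S t) {g : C(Torus, Plane)} (hg : ∀ x, ‖g x‖ = 1) :
    PathDeriv (fun s => rotC (y s) g) (mulL2 smulJ (WaveMaps.rotC (y t) g) y') S t := by
  refine ⟨(continuous_rotC g).continuousAt.comp_continuousWithinAt hy.1, ?_⟩
  let P := WaveMaps.rotC (y t) g
  have hP : ∀ x, ‖P x‖ = 1 := fun x => by simp [P, norm_rot, hg]
  have h1 : HasDerivWithinAt
      (fun s => toL2 (WaveMaps.rotC (y s) g - P - WaveMaps.mulC smulJ P (y s - y t))) 0 S t := by
    refine hasDerivWithinAt_zero_of_norm_le (tendsto_norm_sub hy.1) hy.2 ?_ ?_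
    · have h1 : ∀ᶠ s in 𝓝[S] t, ‖y s - y t‖ < 1 :=
        (tendsto_norm_sub hy.1).eventually (gt_mem_nhds one_pos)
      filter_upwards [h1] with s hs
      rw [← map_sub]
      refine norm_toL2_le fun x => ?_
      have h2 : |y s x - y t x| ≤ ‖y s - y t‖ := (y s - y t).norm_coe_le_norm x
      have e : WaveMaps.rotC (y s) g x = rot (y s x - y t x) (P x) := by
        simp only [P, rotC_apply, ← rot_add, sub_add_cancel]
      simp only [ContinuousMap.sub_apply, mulC_apply, smulJ_apply, e]
      refine (norm_rot_sub_le (h2.trans hs.le) (hP x)).trans ?_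
      exact mul_le_mul_of_nonneg_right h2 (abs_nonneg _)
    · have : WaveMaps.mulC smulJ P (y t - y t) = 0 := by ext x i; simp
      rw [this]; simp [P]
  have h2 := (mulL2 smulJ P).hasFDerivAt.comp_hasDerivWithinAt t hy.2
  refine ((h1.add h2).add_const (toL2 P - mulL2 smulJ P (toL2 (y t)))).congr_of_eventuallyEq
    (Eventually.of_forall fun s => ?_) ?_ |>.congr_deriv (by simp [P])
  · simp [toL2_mulC, P]; abel
  · simp [toL2_mulC, P]

/-- If the rotations of `g` by `y` are differentiable, then so is `y`. -/
lemma pathDeriv_of_rotC {y : ℝ → C(Torus, ℝ)} {v : SqInt Plane} {S : Set ℝ} {t : ℝ}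
    (hy : ContinuousWithinAt y S t) {g : C(Torus, Plane)} (hg : ∀ x, ‖g x‖ = 1)
    (h : PathDeriv (fun s => rotC (y s) g) v S t) :
    PathDeriv y (mulL2 innerJ (rotC (y t) g) v) S t := by
  refine ⟨hy, ?_⟩
  let P := rotC (y t) g
  have hP : ∀ x, ‖P x‖ = 1 := fun x => by simp [P, norm_rot, hg]
  -- The sine of the angle increment is linear in the increment of the rotated map, hence
  -- differentiable; angle minus sine is a negligible remainder.
  have hsin : ∀ s x, Real.sin (y s x - y t x) = inner ℝ (J (P x)) (rotC (y s) g x - P x) := by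
    intro s x
    have e : rotC (y s) g x = rot (y s x - y t x) (P x) := by
      simp only [P, rotC_apply, ← rot_add, sub_add_cancel]
    rw [e, inner_sub_right, inner_J_rot (hP x), inner_J_self, sub_zero]
  have h1 : HasDerivWithinAt
      (fun s => toL2 (y s - y t - mulC innerJ P (rotC (y s) g - P))) 0 S t := by
    refine hasDerivWithinAt_zero_of_norm_le (tendsto_norm_sub hy) h.2 ?_ ?_
    · have h1 : ∀ᶠ s in 𝓝[S] t, ‖y s - y t‖ < 1 :=
        (tendsto_norm_sub hy).eventually (gt_mem_nhds one_pos)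
      filter_upwards [h1] with s hs
      rw [← map_sub]
      refine norm_toL2_le fun x => ?_
      have h2 : |y s x - y t x| ≤ ‖y s - y t‖ := (y s - y t).norm_coe_le_norm x
      have h3 : |Real.sin (y s x - y t x)| ≤ ‖rotC (y s) g x - P x‖ := by
        rw [hsin]
        refine (abs_real_inner_le_norm _ _).trans ?_
        rw [norm_J, hP, one_mul]
      have e : (y s - y t - mulC innerJ P (rotC (y s) g - P)) x
          = (y s x - y t x) - Real.sin (y s x - y t x) := by
        rw [hsin]; simp
      rw [e]
      exact (abs_sin_sub_self_le_mul (h2.trans hs.le)).trans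
        (mul_le_mul h2 h3 (abs_nonneg _) (norm_nonneg _))
    · have : mulC innerJ P (rotC (y t) g - P) = 0 := by ext x; simp [P]
      rw [this]; simp
  have h2 := (mulL2 innerJ P).hasFDerivAt.comp_hasDerivWithinAt t h.2
  refine ((h1.add h2).add_const (toL2 (y t) - mulL2 innerJ P (toL2 P))).congr_of_eventuallyEq
    (Eventually.of_forall fun s => ?_) ?_ |>.congr_deriv (by simp [P])
  · simp [toL2_mulC]; abel
  · simp [toL2_mulC, P]

/-! ### States and solutions as paths -/

/-- The position of a state as a continuous function with values in the plane. -/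
def State.posC (u : State) : C(Torus, Plane) :=
  ⟨fun x => (u.pos x : Plane), continuous_subtype_val.comp u.pos.continuous⟩

lemma State.norm_posC (u : State) (x : Torus) : ‖u.posC x‖ = 1 :=
  mem_sphere_zero_iff_norm.1 (u.pos x).2

lemma State.spDeriv (u : State) : SpDeriv u.posC u.posDeriv :=
  IsWeakDeriv.spDeriv u.isWeakDeriv

lemma State.eq_of {u v : State} (h : u.posC = v.posC) (hv : u.vel = v.vel) : u = v := by
  have hp : u.pos = v.pos := by
    ext1 x
    exact Subtype.ext (DFunLike.congr_fun h x)
  refine State.ext hp ?_ hv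
  have h1 := u.spDeriv
  rw [h] at h1
  exact h1.unique v.spDeriv

/-- The angular velocity of a state. -/
def State.angVel (u : State) : SqInt ℝ := mulL2 innerJ u.posC u.vel

/-- The angular strain of a state. -/
def State.angStrain (u : State) : SqInt ℝ := mulL2 innerJ u.posC u.posDeriv

lemma eq_mulL2_smulJ {p : C(Torus, Plane)} (hp : ∀ x, ‖p x‖ = 1) {v : SqInt Plane}
    (hv : ∀ᵐ x, inner ℝ (p x) (v x) = 0) : v = mulL2 smulJ p (mulL2 innerJ p v) := by
  apply Lp.ext
  filter_upwards [hv, coeFn_mulL2 smulJ p (mulL2 innerJ p v), coeFn_mulL2 innerJ p v]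
    with x h1 h2 h3
  rw [h2, h3]
  exact eq_inner_smul_J (hp x) h1

lemma mulL2_innerJ_smulJ {p : C(Torus, Plane)} (hp : ∀ x, ‖p x‖ = 1) (v : SqInt ℝ) :
    mulL2 innerJ p (mulL2 smulJ p v) = v := by
  apply Lp.ext
  filter_upwards [coeFn_mulL2 innerJ p (mulL2 smulJ p v), coeFn_mulL2 smulJ p v] with x h1 h2
  rw [h1, h2]
  simp [hp x]

lemma State.vel_eq (u : State) : u.vel = mulL2 smulJ u.posC u.angVel :=
  eq_mulL2_smulJ u.norm_posC (by
    filter_upwards [u.tangent] with x hx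
    rw [real_inner_comm]; exact hx)

/-- Differentiate the constant |p|² = 1. -/
lemma ae_inner_eq_zero_of_spDeriv {p : C(Torus, Plane)} {p' : SqInt Plane}
    (hp : ∀ x, ‖p x‖ = 1) (h : SpDeriv p p') : ∀ᵐ x, inner ℝ (p x) (p' x) = 0 := by
  have h1 := h.mulC innerB h
  have h2 : mulC innerB p p = ContinuousMap.const Torus 1 := by
    ext x; simp [hp]
  rw [h2] at h1
  have h3 := h1.unique (spDeriv_const 1)
  have h4 := coeFn_mulL2 innerB p p'
  have h5 := coeFn_mulL2 innerB.flip p p'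
  have h6 := Lp.coeFn_add (mulL2 innerB p p') (mulL2 innerB.flip p p')
  rw [h3] at h6
  filter_upwards [h4, h5, h6, Lp.coeFn_zero ℝ 2 (volume : Measure Torus)] with x h4 h5 h6 h7
  rw [Pi.add_apply, h4, h5, h7] at h6
  simp only [Pi.zero_apply, ContinuousLinearMap.flip_apply, innerB_apply] at h6
  rw [real_inner_comm (p x)] at h6
  linarith

lemma State.posDeriv_eq (u : State) : u.posDeriv = mulL2 smulJ u.posC u.angStrain :=
  eq_mulL2_smulJ u.norm_posC (ae_inner_eq_zero_of_spDeriv u.norm_posC u.spDeriv)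

/-- Continuity in H¹ becomes uniform continuity of the positions in time through the Sobolev
inequality. -/
lemma IsSolution.continuousOn_posC {T : ℝ} {f : ℝ × Torus → Plane} {u₀ : State} {u : ℝ → State}
    (h : IsSolution T f u₀ u) : ContinuousOn (fun t => (u t).posC) (Icc 0 T) := by
  intro t ht
  rw [ContinuousWithinAt, tendsto_iff_norm_sub_tendsto_zero]
  have h1 : Tendsto (fun s => oneNorm * (‖toL2 (u s).posC - toL2 (u t).posC‖
      + ‖(u s).posDeriv - (u t).posDeriv‖)) (𝓝[Icc 0 T] t) (𝓝 0) := by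
    have a1 := tendsto_iff_norm_sub_tendsto_zero.1 (h.hasDerivWithinAt t ht).continuousWithinAt
    have a2 := tendsto_iff_norm_sub_tendsto_zero.1 (h.continuousOn_posDeriv t ht)
    have := (a1.add a2).const_mul oneNorm
    rwa [add_zero, mul_zero] at this
  refine squeeze_zero (fun _ => norm_nonneg _) (fun s => ?_) h1
  rw [← map_sub]
  exact ((u s).spDeriv.sub (u t).spDeriv).norm_le

lemma IsSolution.pathDeriv {T : ℝ} {f : ℝ × Torus → Plane} {u₀ : State} {u : ℝ → State}
    (h : IsSolution T f u₀ u) {t : ℝ} (ht : t ∈ Icc 0 T) :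
    PathDeriv (fun s => (u s).posC) (u t).vel (Icc 0 T) t :=
  ⟨h.continuousOn_posC t ht, h.hasDerivWithinAt t ht⟩

end

section

/-! ### The angular form of the equation -/

/-- The velocity of a weak solution is differentiable only against fixed vectors. Freezing w at time
t and treating w(s) - w(t) separately needs mere continuity of r. -/
lemma hasDerivWithinAt_inner_of_continuous {X : Type*} [NormedAddCommGroup X]
    [InnerProductSpace ℝ X] {r w : ℝ → X} {w' : X} {d : ℝ} {S : Set ℝ} {t : ℝ}
    (hr : ContinuousWithinAt r S t) (hw : HasDerivWithinAt w w' S t)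
    (hd : HasDerivWithinAt (fun s => inner ℝ (r s) (w t)) d S t) :
    HasDerivWithinAt (fun s => inner ℝ (r s) (w s)) (d + inner ℝ (r t) w') S t := by
  have h1 := hasDerivWithinAt_family (L := fun s => innerSL ℝ (r s)) (f' := w') (by
    have h1 : Tendsto (fun p : ℝ × X => (r p.1, p.2)) (𝓝[S] t ×ˢ 𝓝 w') (𝓝 (r t, w')) :=
      (hr.tendsto.comp tendsto_fst).prodMk_nhds tendsto_snd
    exact (continuous_inner.tendsto (r t, w')).comp h1) hw
  refine (hd.add h1).congr_of_eventuallyEq (Eventually.of_forall fun s => ?_) ?_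
  · simp [inner_sub_right]
  · simp

/-- With velocity a Jp and space derivative b Jp, differentiating ⟨Jp, Ψ⟩ produces the extra terms
-a⟨p, Ψ⟩ and -b⟨p, Ψ⟩, since J² = -1. Multiplied by a and b they account exactly for the quadratic
term, so the equation becomes linear in a and b when tested with ⟨Jp, Ψ⟩. -/
lemma weak_integrand (u : State) (Ψ Ψt Ψx : C(Torus, Plane)) {k : Torus → ℝ}
    (hk : Integrable k volume) :
    ∫ x, (inner ℝ (u.posDeriv x) (Ψx x) - inner ℝ (u.vel x) (Ψt x)
        + (‖u.vel x‖ ^ 2 - ‖u.posDeriv x‖ ^ 2) * inner ℝ (u.pos x : Plane) (Ψ x) + k x)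
      = inner ℝ u.angStrain (mulL2 innerJ u.posC (toL2 Ψx) + mulL2 innerJ.flip Ψ u.posDeriv)
        - inner ℝ u.angVel (mulL2 innerJ u.posC (toL2 Ψt) + mulL2 innerJ.flip Ψ u.vel)
        + ∫ x, k x := by
  set a := mulL2 innerJ u.posC (toL2 Ψx) + mulL2 innerJ.flip Ψ u.posDeriv with ha
  set b := mulL2 innerJ u.posC (toL2 Ψt) + mulL2 innerJ.flip Ψ u.vel with hb
  have hi : Integrable (fun x => inner ℝ (u.angStrain x) (a x) - inner ℝ (u.angVel x) (b x)) volume :=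
    (L2.integrable_inner _ _).sub (L2.integrable_inner _ _)
  rw [L2.inner_def, L2.inner_def, ← integral_sub (L2.integrable_inner _ _) (L2.integrable_inner _ _),
    ← integral_add hi hk]
  refine integral_congr_ae ?_
  have hv := u.vel_eq
  have hp := u.posDeriv_eq
  have hv' : u.vel =ᵐ[volume] fun x => smulJ (u.posC x) (u.angVel x) := by
    conv_lhs => rw [hv]
    exact coeFn_mulL2 _ _ _
  have hp' : u.posDeriv =ᵐ[volume] fun x => smulJ (u.posC x) (u.angStrain x) := by
    conv_lhs => rw [hp]
    exact coeFn_mulL2 _ _ _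
  filter_upwards [hv', hp', Lp.coeFn_add (mulL2 innerJ u.posC (toL2 Ψx))
    (mulL2 innerJ.flip Ψ u.posDeriv), Lp.coeFn_add (mulL2 innerJ u.posC (toL2 Ψt))
    (mulL2 innerJ.flip Ψ u.vel), coeFn_mulL2 innerJ u.posC (toL2 Ψx), coeFn_toL2 Ψx,
    coeFn_mulL2 innerJ u.posC (toL2 Ψt), coeFn_toL2 Ψt, coeFn_mulL2 innerJ.flip Ψ u.posDeriv,
    coeFn_mulL2 innerJ.flip Ψ u.vel] with x h1 h2 h3 h4 h5 h6 h7 h8 h9 h10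
  rw [h3, h4, Pi.add_apply, Pi.add_apply, h5, h6, h7, h8, h9, h10, h1, h2]
  have hn : ‖u.posC x‖ = 1 := u.norm_posC x
  have e : (u.pos x : Plane) = u.posC x := rfl
  rw [e]
  simp only [smulJ_apply, innerJ_apply, ContinuousLinearMap.flip_apply, norm_smul, norm_J, hn,
    Real.norm_eq_abs, mul_one, sq_abs, map_smul, J_J, inner_smul_left, inner_neg_left,
    RCLike.inner_apply, conj_trivial]
  ring

/-- The pairing `(c, v) ↦ c • v`. -/
def smulB : ℝ →L[ℝ] Plane →L[ℝ] Plane := ContinuousLinearMap.lsmul ℝ ℝ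

@[simp] lemma smulB_apply (c : ℝ) (v : Plane) : smulB c v = c • v := rfl

/-- The pointwise rotation by a right angle. -/
def jC (p : C(Torus, Plane)) : C(Torus, Plane) := mulC smulJ p 1

@[simp] lemma jC_apply (p : C(Torus, Plane)) (x : Torus) : jC p x = J (p x) := by simp [jC]

/-- The right hand side of the weak equation for a test function `m • V`. -/
def weakForm (m : C(Torus, ℝ)) (m' : SqInt ℝ) (p : C(Torus, Plane)) (v p' F : SqInt Plane)
    (V : C(Torus, Plane)) (V' : SqInt Plane) : ℝ :=
  inner ℝ (mulL2 innerJ p p')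
      (mulL2 innerJ p (mulL2 smulB m V' + mulL2 smulB.flip V m')
        + mulL2 innerJ.flip (mulC smulB m V) p')
    - inner ℝ (mulL2 innerJ p v) (mulL2 innerJ.flip (mulC smulB m V) v)
    + inner ℝ F (toL2 (mulC smulJ p (mulC innerJ p V)))

section Continuity

variable {E F G X : Type*} [NormedAddCommGroup E] [NormedSpace ℝ E] [NormedAddCommGroup F]
  [NormedSpace ℝ F] [NormedAddCommGroup G] [NormedSpace ℝ G] [TopologicalSpace X]

lemma _root_.ContinuousOn.mulL2 (B : E →L[ℝ] F →L[ℝ] G) {y : X → C(Torus, E)} {v : X → SqInt F}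
    {S : Set X} (hy : ContinuousOn y S) (hv : ContinuousOn v S) :
    ContinuousOn (fun s => mulL2 B (y s) (v s)) S :=
  ((WaveMaps.mulL2 B).continuous.comp_continuousOn hy).clm_apply hv

lemma _root_.ContinuousOn.mulC (B : E →L[ℝ] F →L[ℝ] G) {y : X → C(Torus, E)} {v : X → C(Torus, F)}
    {S : Set X} (hy : ContinuousOn y S) (hv : ContinuousOn v S) :
    ContinuousOn (fun s => mulC B (y s) (v s)) S :=
  (continuous_mulC B).comp_continuousOn (hy.prodMk hv)

lemma _root_.ContinuousOn.toL2 {y : X → C(Torus, E)} {S : Set X} (hy : ContinuousOn y S) :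
    ContinuousOn (fun s => WaveMaps.toL2 (y s)) S :=
  (WaveMaps.toL2 (E := E)).continuous.comp_continuousOn hy

end Continuity

lemma continuousOn_weakForm {X : Type*} [TopologicalSpace X] {S : Set X} (m : C(Torus, ℝ))
    (m' : SqInt ℝ) {p V : X → C(Torus, Plane)} {v p' F V' : X → SqInt Plane}
    (hp : ContinuousOn p S) (hV : ContinuousOn V S) (hv : ContinuousOn v S)
    (hp' : ContinuousOn p' S) (hF : ContinuousOn F S) (hV' : ContinuousOn V' S) :
    ContinuousOn (fun s => weakForm m m' (p s) (v s) (p' s) (F s) (V s) (V' s)) S := by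
  have hm : ContinuousOn (fun _ : X => m) S := continuousOn_const
  have hm' : ContinuousOn (fun _ : X => m') S := continuousOn_const
  unfold weakForm
  refine ((ContinuousOn.inner (hp.mulL2 _ hp') ?_).sub (ContinuousOn.inner (hp.mulL2 _ hv) ?_)).add
    (hF.inner (ContinuousOn.toL2 (hp.mulC _ (hp.mulC _ hV))))
  · exact (hp.mulL2 _ ((hm.mulL2 _ hV').add (hV.mulL2 _ hm'))).add ((hm.mulC _ hV).mulL2 _ hp')
  · exact (hm.mulC _ hV).mulL2 _ hv

/-- A convergent sequence together with its limit is compact, which provides a constant dominating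
the integrands. -/
lemma tendsto_integral_of_continuousOn {X : Type*} [TopologicalSpace X] {I : ℝ × X → ℝ} {T τ : ℝ}
    (hτ : τ ∈ Icc 0 T) (hI : ContinuousOn I (Icc 0 T ×ˢ univ)) {x : ℕ → X} {x₀ : X}
    (hx : Tendsto x atTop (𝓝 x₀)) :
    Tendsto (fun n => ∫ t in (0 : ℝ)..τ, I (t, x n)) atTop (𝓝 (∫ t in (0 : ℝ)..τ, I (t, x₀))) := by
  have hK : IsCompact (Icc 0 T ×ˢ insert x₀ (range x)) := isCompact_Icc.prod hx.isCompact_insert_range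
  obtain ⟨C, hC⟩ := hK.exists_bound_of_continuousOn (hI.mono (prod_mono_right (subset_univ _)))
  have hmem : ∀ t ∈ uIoc 0 τ, t ∈ Icc 0 T := by
    intro t ht
    rw [uIoc_of_le hτ.1] at ht
    exact ⟨ht.1.le, ht.2.trans hτ.2⟩
  have hslice : ∀ y : X, ContinuousOn (fun t => I (t, y)) (Icc 0 T) := fun y =>
    hI.comp (by fun_prop) fun t ht => ⟨ht, mem_univ _⟩
  refine intervalIntegral.tendsto_integral_filter_of_dominated_convergence (fun _ => C) ?_ ?_ ?_ ?_
  · refine Eventually.of_forall fun n => ?_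
    rw [uIoc_of_le hτ.1]
    exact ((hslice (x n)).mono fun t ht => ⟨ht.1.le, ht.2.trans hτ.2⟩).aestronglyMeasurable
      measurableSet_Ioc
  · refine Eventually.of_forall fun n => Eventually.of_forall fun t ht => ?_
    exact hC _ ⟨hmem t ht, mem_insert_of_mem _ (mem_range_self n)⟩
  · exact intervalIntegrable_const
  · refine Eventually.of_forall fun t ht => ?_
    have h1 : ContinuousWithinAt I (Icc 0 T ×ˢ univ) (t, x₀) := hI _ ⟨hmem t ht, mem_univ _⟩
    refine h1.tendsto.comp (tendsto_nhdsWithin_iff.2 ⟨tendsto_const_nhds.prodMk_nhds hx, ?_⟩)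
    exact Eventually.of_forall fun n => ⟨hmem t ht, mem_univ _⟩

lemma hasDerivWithinAt_integral_Icc {g : ℝ → ℝ} {T t : ℝ} (hg : ContinuousOn g (Icc 0 T))
    (ht : t ∈ Icc 0 T) : HasDerivWithinAt (fun s => ∫ r in (0 : ℝ)..s, g r) (g t) (Icc 0 T) t := by
  have : Fact (t ∈ Icc 0 T) := ⟨ht⟩
  refine intervalIntegral.integral_hasDerivWithinAt_right ?_ ?_ (hg t ht)
  · refine (hg.mono ?_).intervalIntegrable
    rw [uIcc_of_le ht.1]
    exact Icc_subset_Icc_right ht.2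
  · exact hg.stronglyMeasurableAtFilter_nhdsWithin measurableSet_Icc t

/-! ### Angular velocity and angular strain of a weak solution -/

section Solution

variable {T : ℝ} {f : ℝ × Torus → Plane} {u₀ : State} {u : ℝ → State}

/-- The test function is constant in time. Only the localized control m f enters, so continuity in
time is asked of `F` alone; in the optimality proof this `F` is zero although f is merely square
integrable. -/
lemma IsSolution.integral_weakForm_c1 (h : IsSolution T f u₀ u) {m m' : C(Torus, ℝ)}
    (hm : C1Deriv m m') {F : ℝ → SqInt Plane}
    (hf : ∀ t ∈ Icc 0 T, ∀ᵐ x, F t x = m x • f (t, x)) {V V' : C(Torus, Plane)}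
    (hV : C1Deriv V V') {τ : ℝ} (hτ : τ ∈ Ioc 0 T) :
    ∫ t in (0 : ℝ)..τ, weakForm m (toL2 m') (u t).posC (u t).vel (u t).posDeriv (F t) V (toL2 V')
      = inner ℝ (u 0).vel (toL2 (mulC smulB m V)) - inner ℝ (u τ).vel (toL2 (mulC smulB m V)) := by
  have hΨ := hm.mulC smulB hV
  set Ψ := mulC smulB m V with hΨd
  set Ψx := mulC smulB m V' + mulC smulB m' V with hΨx
  have hC1 : IsC1OnSpaceTime (fun p => Ψ p.2) (fun _ => 0) (fun p => Ψx p.2) :=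
    ⟨by fun_prop, by fun_prop, by fun_prop, fun t x => hasDerivAt_const t (Ψ x), fun t r => hΨ r⟩
  have h1 := h.weak_eq τ hτ _ _ _ hC1
  rw [inner_toL2_right, inner_toL2_right, ← h1]
  refine intervalIntegral.integral_congr fun t ht => ?_
  rw [uIcc_of_le hτ.1.le] at ht
  have ht' : t ∈ Icc 0 T := ⟨ht.1, ht.2.trans hτ.2⟩
  have hk : (fun x => inner ℝ (tangentProj ((u t).pos x : Plane) (f (t, x))) (Ψ x)) =ᵐ[volume]
      fun x => inner ℝ (F t x) (toL2 (mulC smulJ (u t).posC (mulC innerJ (u t).posC V)) x) := by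
    filter_upwards [hf t ht', coeFn_toL2 (mulC smulJ (u t).posC (mulC innerJ (u t).posC V))]
      with x h1 h2
    have e : tangentProj ((u t).pos x : Plane) (f (t, x)) = _ :=
      tangentProj_eq ((u t).norm_posC x) (f (t, x))
    rw [h1, h2, e]
    change inner ℝ (inner ℝ (J ((u t).posC x)) (f (t, x)) • J ((u t).posC x)) (m x • V x)
      = inner ℝ (m x • f (t, x)) (inner ℝ (J ((u t).posC x)) (V x) • J ((u t).posC x))
    simp only [inner_smul_left, inner_smul_right, conj_trivial, real_inner_comm (f (t, x))]
    ring
  have h2 := weak_integrand (u t) Ψ 0 Ψx ((L2.integrable_inner (𝕜 := ℝ) _ _).congr hk.symm)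
  have e2 : toL2 Ψx = mulL2 smulB m (toL2 V') + mulL2 smulB.flip V (toL2 m') := by
    rw [hΨx, map_add, toL2_mulC, toL2_mulC_flip smulB m' V]
  refine Eq.trans ?_ h2.symm
  rw [integral_congr_ae hk, ← L2.inner_def, weakForm, map_zero, map_zero, zero_add, e2]
  rfl

lemma tendsto_inner_mulC {V : ℕ → C(Torus, Plane)} {V₀ : C(Torus, Plane)}
    (hV : Tendsto V atTop (𝓝 V₀)) (m : C(Torus, ℝ)) (w : SqInt Plane) :
    Tendsto (fun n => inner ℝ w (toL2 (mulC smulB m (V n)))) atTop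
      (𝓝 (inner ℝ w (toL2 (mulC smulB m V₀)))) := by
  have h0 : Tendsto (fun n => (m, V n)) atTop (𝓝 (m, V₀)) := tendsto_const_nhds.prodMk_nhds hV
  have h1 : Tendsto (fun n => mulC smulB m (V n)) atTop (𝓝 (mulC smulB m V₀)) :=
    Tendsto.comp (f := fun n => (m, V n)) ((continuous_mulC smulB).tendsto (m, V₀)) h0
  have h2 : Tendsto (fun n => toL2 (mulC smulB m (V n))) atTop (𝓝 (toL2 (mulC smulB m V₀))) :=
    ((toL2 (E := Plane)).continuous.tendsto (mulC smulB m V₀)).comp h1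
  exact tendsto_const_nhds.inner h2

/-- The test field needed below is Jp at a frozen time, which is only of class H¹; Steklov averages
extend the identity to it. -/
lemma IsSolution.integral_weakForm (h : IsSolution T f u₀ u) {m m' : C(Torus, ℝ)}
    (hm : C1Deriv m m') {F : ℝ → SqInt Plane} (hF : ContinuousOn F (Icc 0 T))
    (hf : ∀ t ∈ Icc 0 T, ∀ᵐ x, F t x = m x • f (t, x)) {V : C(Torus, Plane)} {V' : SqInt Plane}
    (hV : SpDeriv V V') {τ : ℝ} (hτ : τ ∈ Icc 0 T) :
    ∫ t in (0 : ℝ)..τ, weakForm m (toL2 m') (u t).posC (u t).vel (u t).posDeriv (F t) V V'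
      = inner ℝ (u 0).vel (toL2 (mulC smulB m V)) - inner ℝ (u τ).vel (toL2 (mulC smulB m V)) := by
  rcases hτ.1.eq_or_lt with rfl | h0
  · simp
  let r : ℕ → ℝ := fun n => 1 / ((n : ℝ) + 1)
  have hr : Tendsto r atTop (𝓝[≠] 0) :=
    tendsto_nhdsWithin_iff.2 ⟨tendsto_one_div_add_atTop_nhds_zero_nat,
      Eventually.of_forall fun n => (by positivity : (1 : ℝ) / ((n : ℝ) + 1) ≠ 0)⟩
  have hfst : MapsTo Prod.fst (Icc 0 T ×ˢ (univ : Set (C(Torus, Plane) × SqInt Plane))) (Icc 0 T) :=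
    fun q hq => hq.1
  have hI := continuousOn_weakForm m (toL2 m')
    (p := fun q : ℝ × (C(Torus, Plane) × SqInt Plane) => (u q.1).posC) (V := fun q => q.2.1)
    (v := fun q => (u q.1).vel) (p' := fun q => (u q.1).posDeriv) (F := fun q => F q.1)
    (V' := fun q => q.2.2) (S := Icc 0 T ×ˢ univ)
    (h.continuousOn_posC.comp continuousOn_fst hfst)
    (continuous_fst.comp continuous_snd).continuousOn
    (h.continuousOn_vel.comp continuousOn_fst hfst)
    (h.continuousOn_posDeriv.comp continuousOn_fst hfst) (hF.comp continuousOn_fst hfst)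
    (continuous_snd.comp continuous_snd).continuousOn
  have hVr : Tendsto (fun n => steklov (r n) V) atTop (𝓝 V) := (tendsto_steklov V).comp hr
  have hx : Tendsto (fun n => (steklov (r n) V, toL2 (diffQuot (r n) V))) atTop (𝓝 (V, V')) :=
    hVr.prodMk_nhds (hV.tendsto_diffQuot.comp hr)
  have h1 := tendsto_integral_of_continuousOn hτ hI hx
  simp only at h1
  have h2 : ∀ n, ∫ t in (0 : ℝ)..τ, weakForm m (toL2 m') (u t).posC (u t).vel (u t).posDeriv (F t)
      (steklov (r n) V) (toL2 (diffQuot (r n) V)) = _ := fun n =>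
    h.integral_weakForm_c1 hm hf (c1Deriv_steklov (r n) V) ⟨h0, hτ.2⟩
  simp only [h2] at h1
  refine tendsto_nhds_unique h1 ?_
  exact (tendsto_inner_mulC hVr m _).sub (tendsto_inner_mulC hVr m _)

lemma mulC_innerJ_smulJ {p : C(Torus, Plane)} (hp : ∀ x, ‖p x‖ = 1) (m : C(Torus, ℝ)) :
    mulC innerJ p (mulC smulJ p m) = m := by
  ext x; simp [hp x]

lemma inner_angVel (u : State) (m : C(Torus, ℝ)) (v : SqInt Plane) :
    inner ℝ (mulL2 innerJ u.posC v) (toL2 m) = inner ℝ v (toL2 (mulC smulJ u.posC m)) := by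
  rw [inner_toL2_right, inner_toL2_right]
  refine integral_congr_ae ?_
  filter_upwards [coeFn_mulL2 innerJ u.posC v] with x h1
  rw [h1]
  simp [inner_smul_right, real_inner_comm]

/-- The tangent line is one-dimensional, so J maps tangent vectors to normal ones. This removes the
contribution of the moving frame. -/
lemma inner_mulL2_J_of_tangent (u : State) {v w : SqInt Plane} {a b : SqInt ℝ}
    (hv : v = mulL2 smulJ u.posC a) (hw : w = mulL2 smulJ u.posC b) (m : C(Torus, ℝ)) :
    inner ℝ v (mulL2 smulJ.flip m w) = 0 := by
  rw [L2.inner_def]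
  refine integral_eq_zero_of_ae ?_
  have hv' : v =ᵐ[volume] fun x => smulJ (u.posC x) (a x) := by
    rw [hv]; exact coeFn_mulL2 _ _ _
  have hw' : w =ᵐ[volume] fun x => smulJ (u.posC x) (b x) := by
    rw [hw]; exact coeFn_mulL2 _ _ _
  filter_upwards [hv', hw', coeFn_mulL2 smulJ.flip m w] with x h1 h2 h3
  rw [h3, h2, h1]
  simp [inner_smul_left, inner_smul_right, inner_J_self]

lemma IsSolution.pathDeriv_smulJ (h : IsSolution T f u₀ u) (m : C(Torus, ℝ)) {t : ℝ}
    (ht : t ∈ Icc 0 T) : PathDeriv (fun s => mulC smulJ (u s).posC m)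
      (mulL2 smulJ.flip m (u t).vel) (Icc 0 T) t := by
  have h1 : PathDeriv (fun _ : ℝ => m) 0 (Icc 0 T) t :=
    ⟨continuousWithinAt_const, hasDerivWithinAt_const _ _ _⟩
  simpa using (h.pathDeriv ht).mulC smulJ h1

/-- Test with m Jp, the frame being frozen at the time t of differentiation. The motion of the frame
adds ⟨v, m Jv⟩, which is zero. -/
lemma IsSolution.hasDerivWithinAt_angVel (h : IsSolution T f u₀ u) {m m' : C(Torus, ℝ)}
    (hm : C1Deriv m m') {F : ℝ → SqInt Plane} (hF : ContinuousOn F (Icc 0 T))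
    (hf : ∀ t ∈ Icc 0 T, ∀ᵐ x, F t x = m x • f (t, x)) {t : ℝ} (ht : t ∈ Icc 0 T) :
    HasDerivWithinAt (fun s => inner ℝ (u s).angVel (toL2 m))
      (-inner ℝ (u t).angStrain (toL2 m') - inner ℝ (F t) (toL2 (jC (u t).posC))) (Icc 0 T) t := by
  set p := (u t).posC with hp
  have hn := (u t).norm_posC
  have hw := (h.pathDeriv_smulJ m ht).2
  have hV : SpDeriv (jC p) (mulL2 smulJ.flip 1 (u t).posDeriv) := by
    have := (u t).spDeriv.mulC smulJ (spDeriv_const (1 : ℝ))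
    rw [map_zero, zero_add] at this
    exact this
  have hmV : mulC smulB m (jC p) = mulC smulJ p m := by ext x; simp
  have e1 : ∀ τ ∈ Icc 0 T, inner ℝ (u τ).vel (toL2 (mulC smulJ p m))
      = inner ℝ (u 0).vel (toL2 (mulC smulJ p m)) - ∫ s in (0 : ℝ)..τ, weakForm m (toL2 m')
        (u s).posC (u s).vel (u s).posDeriv (F s) (jC p) (mulL2 smulJ.flip 1 (u t).posDeriv) := by
    intro τ hτ
    rw [h.integral_weakForm hm hF hf hV hτ, hmV]; ring
  have hI := continuousOn_weakForm m (toL2 m') h.continuousOn_posC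
    (continuousOn_const (c := jC p)) h.continuousOn_vel h.continuousOn_posDeriv hF
    (continuousOn_const (c := mulL2 smulJ.flip 1 (u t).posDeriv))
  have hd := (hasDerivWithinAt_integral_Icc hI ht).const_sub
    (inner ℝ (u 0).vel (toL2 (mulC smulJ p m)))
  have hd' := hd.congr e1 (e1 t ht)
  have h2 := hasDerivWithinAt_inner_of_continuous (h.continuousOn_vel t ht) hw hd'
  have h3 : HasDerivWithinAt (fun s => inner ℝ (u s).angVel (toL2 m)) _ (Icc 0 T) t :=
    h2.congr (fun s _ => inner_angVel (u s) m (u s).vel) (inner_angVel (u t) m (u t).vel)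
  refine h3.congr_deriv ?_
  rw [inner_mulL2_J_of_tangent (u t) (u t).vel_eq (u t).vel_eq, add_zero, weakForm]
  -- Both sides are the space derivative of ⟨Jp, m Jp⟩ = m.
  have s1 : mulL2 innerJ p (mulL2 smulB m (mulL2 smulJ.flip 1 (u t).posDeriv)
      + mulL2 smulB.flip (jC p) (toL2 m')) + mulL2 innerJ.flip (mulC smulB m (jC p)) (u t).posDeriv
      = toL2 m' := by
    have a1 := (u t).spDeriv.mulC innerJ (hm.spDeriv.mulC smulB hV)
    rw [hmV] at a1 ⊢
    rw [mulC_innerJ_smulJ hn] at a1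
    exact a1.unique hm.spDeriv
  have s2 : mulL2 innerJ.flip (mulC smulB m (jC p)) (u t).vel = 0 := by
    apply Lp.ext
    filter_upwards [coeFn_mulL2 innerJ.flip (mulC smulB m (jC p)) (u t).vel, (u t).tangent,
      Lp.coeFn_zero ℝ 2 (volume : Measure Torus)] with x h1 h2 h3
    rw [h1, h3]
    have h4 : inner ℝ ((u t).vel x) (p x) = 0 := h2
    simp [inner_J_J, h4]
  have s3 : mulC smulJ p (mulC innerJ p (jC p)) = jC p := by
    ext1 x; simp [hn x, hp]
  rw [s1, s2, s3, inner_zero_right]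
  simp only [State.angStrain]
  ring

/-- The compatibility of mixed derivatives; the wave equation itself plays no part. -/
lemma IsSolution.hasDerivWithinAt_angStrain (h : IsSolution T f u₀ u) {m : C(Torus, ℝ)}
    {m' : SqInt ℝ} (hm : SpDeriv m m') {t : ℝ} (ht : t ∈ Icc 0 T) :
    HasDerivWithinAt (fun s => inner ℝ (u s).angStrain (toL2 m))
      (-inner ℝ (u t).angVel m') (Icc 0 T) t := by
  set p := (u t).posC with hp
  have hw := (h.pathDeriv_smulJ m ht).2
  have hΨ := (u t).spDeriv.mulC smulJ hm
  -- Integrating by parts in space leaves only positions to differentiate in time, and these are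
  -- differentiable in L².
  have hd : HasDerivWithinAt (fun s => inner ℝ (u s).posDeriv (toL2 (mulC smulJ p m)))
      (-inner ℝ (u t).vel (mulL2 smulJ p m' + mulL2 smulJ.flip m (u t).posDeriv)) (Icc 0 T) t := by
    have h1 := (((h.pathDeriv ht).2).inner ℝ (hasDerivWithinAt_const t (Icc 0 T)
      (mulL2 smulJ p m' + mulL2 smulJ.flip m (u t).posDeriv))).neg
    refine (h1.congr_of_eventuallyEq (Eventually.of_forall fun s => ?_) ?_).congr_deriv (by simp)
    · exact (u s).spDeriv.inner_eq_neg hΨ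
    · exact (u t).spDeriv.inner_eq_neg hΨ
  have h2 := hasDerivWithinAt_inner_of_continuous (h.continuousOn_posDeriv t ht) hw hd
  have h3 : HasDerivWithinAt (fun s => inner ℝ (u s).angStrain (toL2 m)) _ (Icc 0 T) t :=
    h2.congr (fun s _ => inner_angVel (u s) m (u s).posDeriv) (inner_angVel (u t) m (u t).posDeriv)
  refine h3.congr_deriv ?_
  rw [inner_mulL2_J_of_tangent (u t) (u t).posDeriv_eq (u t).vel_eq, inner_add_right,
    inner_mulL2_J_of_tangent (u t) (u t).vel_eq (u t).posDeriv_eq, add_zero, add_zero, neg_inj,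
    L2.inner_def, L2.inner_def]
  refine integral_congr_ae ?_
  filter_upwards [coeFn_mulL2 smulJ p m', coeFn_mulL2 innerJ p (u t).vel] with x h1 h2
  rw [h1, State.angVel, h2]
  simp [inner_smul_right, real_inner_comm]

lemma IsSolution.continuousOn_angVel (h : IsSolution T f u₀ u) :
    ContinuousOn (fun t => (u t).angVel) (Icc 0 T) :=
  h.continuousOn_posC.mulL2 _ h.continuousOn_vel

lemma IsSolution.continuousOn_angStrain (h : IsSolution T f u₀ u) :
    ContinuousOn (fun t => (u t).angStrain) (Icc 0 T) :=
  h.continuousOn_posC.mulL2 _ h.continuousOn_posDeriv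

/-- The Riemann invariants of a solution are transported along the characteristics. -/
lemma IsSolution.hasDerivWithinAt_invariant (h : IsSolution T f u₀ u) {m m' : C(Torus, ℝ)}
    (hm : C1Deriv m m') {e : ℝ} (he : e * e = 1) {t : ℝ} (ht : t ∈ Icc 0 T) {F : ℝ → SqInt Plane}
    (hF : ContinuousOn F (Icc 0 T))
    (hf : ∀ s ∈ Icc 0 T, ∀ᵐ x, F s x = shiftC (e * t) m x • f (s, x)) :
    HasDerivWithinAt
      (fun s => inner ℝ ((u s).angVel + e • (u s).angStrain) (toL2 (shiftC (e * s) m)))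
      (-inner ℝ (F t) (toL2 (jC (u t).posC))) (Icc 0 T) t := by
  have hmt : C1Deriv (shiftC (e * t) m) (shiftC (e * t) m') := by
    apply c1Deriv_of_hasDerivAt_shiftC
    intro r
    have h1 := (shiftC (E := ℝ) (e * t)).hasFDerivAt.comp_hasDerivAt r (hm.hasDerivAt_shiftC r)
    simpa [Function.comp_def, shiftC_shiftC, add_comm] using h1
  have h1 := h.hasDerivWithinAt_angVel hmt hF hf ht
  have h2 := (h.hasDerivWithinAt_angStrain hmt.spDeriv ht).const_mul e
  -- The derivative of the travelling weight cancels the terms with m' in the two angular equations,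
  -- because e² = 1.
  have hw := ((hm.spDeriv.pathDeriv_shift e t).mono (subset_univ (Icc 0 T))).2
  have h3 : HasDerivWithinAt (fun s => inner ℝ ((u s).angVel + e • (u s).angStrain)
      (toL2 (shiftC (e * t) m))) _ (Icc 0 T) t :=
    (h1.add h2).congr_of_eventuallyEq
      (Eventually.of_forall fun s => by simp [inner_add_left, inner_smul_left])
      (by simp [inner_add_left, inner_smul_left])
  have hr : ContinuousWithinAt (fun s => (u s).angVel + e • (u s).angStrain) (Icc 0 T) t :=
    (h.continuousOn_angVel t ht).add ((h.continuousOn_angStrain t ht).const_smul e)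
  have h4 := hasDerivWithinAt_inner_of_continuous hr hw h3
  refine h4.congr_deriv ?_
  simp only [inner_add_left, inner_smul_left, inner_smul_right, shiftL_toL2, conj_trivial]
  linear_combination (inner ℝ (u t).angStrain (toL2 (shiftC (e * t) m'))) * he

end Solution

end

section

/-! ### Uniqueness of solutions -/

/-- Since J(p - q) is orthogonal to p - q, the term b J(p - q) drops out and only a - b remains. -/
lemma abs_inner_sub_le {p q : Plane} (hp : ‖p‖ = 1) (a b : ℝ) :
    |inner ℝ (p - q) (a • J p - b • J q)| ≤ |a - b| * ‖p - q‖ := by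
  have e : inner ℝ (p - q) (a • J p - b • J q) = (a - b) * inner ℝ (p - q) (J p) := by
    simp only [plane_inner, PiLp.sub_apply, PiLp.smul_apply, J_apply_zero, J_apply_one, smul_eq_mul]
    ring
  rw [e, abs_mul]
  refine mul_le_mul_of_nonneg_left ?_ (abs_nonneg _)
  refine (abs_real_inner_le_norm _ _).trans ?_
  rw [norm_J, hp, mul_one]

/-! ### Estimates for the difference of two states -/

section Difference

variable (u v : State)

lemma coeFn_smulJ_sub {w z : SqInt Plane} {a b : SqInt ℝ} (hw : w = mulL2 smulJ u.posC a)
    (hz : z = mulL2 smulJ v.posC b) :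
    ∀ᵐ x, |inner ℝ ((u.posC - v.posC) x) ((w - z) x)| ≤ |(a - b) x| * ‖(u.posC - v.posC) x‖ := by
  have hw' : w =ᵐ[volume] fun x => smulJ (u.posC x) (a x) := by
    rw [hw]; exact coeFn_mulL2 _ _ _
  have hz' : z =ᵐ[volume] fun x => smulJ (v.posC x) (b x) := by
    rw [hz]; exact coeFn_mulL2 _ _ _
  filter_upwards [hw', hz', Lp.coeFn_sub w z, Lp.coeFn_sub a b] with x h1 h2 h3 h4
  rw [h3, h4, Pi.sub_apply, Pi.sub_apply, h1, h2]
  exact abs_inner_sub_le (u.norm_posC x) _ _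

lemma abs_inner_toL2_sub_le {w z : SqInt Plane} {a b : SqInt ℝ} (hw : w = mulL2 smulJ u.posC a)
    (hz : z = mulL2 smulJ v.posC b) :
    |inner ℝ (toL2 (u.posC - v.posC)) (w - z)| ≤ ‖toL2 (u.posC - v.posC)‖ * ‖a - b‖ := by
  let n : C(Torus, ℝ) := ⟨fun x => ‖(u.posC - v.posC) x‖, by fun_prop⟩
  have hn : ‖toL2 n‖ ≤ 1 * ‖toL2 (u.posC - v.posC)‖ := norm_toL2_le fun x => by simp [n]
  have h1 : |inner ℝ (toL2 (u.posC - v.posC)) (w - z)| ≤ inner ℝ |a - b| (toL2 n) := by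
    rw [L2.inner_def, L2.inner_def, ← Real.norm_eq_abs]
    refine (norm_integral_le_integral_norm _).trans ?_
    refine integral_mono_ae (L2.integrable_inner _ _).norm (L2.integrable_inner _ _) ?_
    filter_upwards [coeFn_smulJ_sub u v hw hz, coeFn_toL2 (u.posC - v.posC), coeFn_toL2 n,
      Lp.coeFn_abs (a - b)] with x h1 h2 h3 h4
    simp only [h2, h3, h4, RCLike.inner_apply, conj_trivial, Real.norm_eq_abs]
    exact h1.trans_eq (mul_comm _ _)
  have h2 := real_inner_le_norm |a - b| (toL2 n)
  rw [norm_abs_eq_norm] at h2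
  nlinarith [norm_nonneg (a - b)]

lemma norm_mulL2_innerB_sub_le {w z : SqInt Plane} {a b : SqInt ℝ}
    (hw : w = mulL2 smulJ u.posC a) (hz : z = mulL2 smulJ v.posC b) :
    ‖mulL2 innerB (u.posC - v.posC) (w - z)‖ ≤ ‖u.posC - v.posC‖ * ‖a - b‖ := by
  refine Lp.norm_le_mul_norm_of_ae_le_mul ?_
  filter_upwards [coeFn_smulJ_sub u v hw hz, coeFn_mulL2 innerB (u.posC - v.posC) (w - z)]
    with x h1 h2
  rw [h2]
  refine h1.trans ?_
  have h3 := mul_le_mul_of_nonneg_left ((u.posC - v.posC).norm_coe_le_norm x)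
    (abs_nonneg ((a - b) x))
  rwa [mul_comm _ ‖u.posC - v.posC‖] at h3

/-- Apply the Sobolev inequality to |y|², not to y: its derivative 2⟨y, y_x⟩ involves only the
difference of the strains, by `abs_inner_sub_le`. Then divide by the uniform norm of y. -/
lemma norm_posC_sub_le : ‖u.posC - v.posC‖
    ≤ oneNorm * (‖toL2 (u.posC - v.posC)‖ + 2 * ‖u.angStrain - v.angStrain‖) := by
  set y := u.posC - v.posC with hy
  have h0 : 0 ≤ oneNorm := norm_nonneg _
  have hd : SpDeriv y (u.posDeriv - v.posDeriv) := u.spDeriv.sub v.spDeriv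
  have hn := (hd.mulC innerB hd).norm_le
  have e1 : mulL2 innerB.flip y (u.posDeriv - v.posDeriv)
      = mulL2 innerB y (u.posDeriv - v.posDeriv) := by
    apply Lp.ext
    filter_upwards [coeFn_mulL2 innerB y (u.posDeriv - v.posDeriv),
      coeFn_mulL2 innerB.flip y (u.posDeriv - v.posDeriv)] with x h1 h2
    rw [h1, h2]
    simp [real_inner_comm]
  have h1 : ‖mulL2 innerB y (u.posDeriv - v.posDeriv)‖ ≤ ‖y‖ * ‖u.angStrain - v.angStrain‖ :=
    norm_mulL2_innerB_sub_le u v u.posDeriv_eq v.posDeriv_eq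
  have h2 : ‖toL2 (mulC innerB y y)‖ ≤ ‖y‖ * ‖toL2 y‖ := by
    refine norm_toL2_le fun x => ?_
    rw [mulC_apply, innerB_apply]
    exact (norm_inner_le_norm _ _).trans
      (mul_le_mul_of_nonneg_right (y.norm_coe_le_norm x) (norm_nonneg _))
  have h3 : ‖y‖ * ‖y‖ ≤ ‖mulC innerB y y‖ := by
    have h4 : ‖y‖ ≤ Real.sqrt ‖mulC innerB y y‖ := by
      rw [ContinuousMap.norm_le _ (Real.sqrt_nonneg _)]
      intro x
      apply Real.le_sqrt_of_sq_le
      have := (mulC innerB y y).norm_coe_le_norm x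
      rwa [mulC_apply, innerB_apply, real_inner_self_eq_norm_sq, Real.norm_eq_abs,
        abs_of_nonneg (sq_nonneg _)] at this
    have h5 := mul_self_le_mul_self (norm_nonneg _) h4
    rwa [Real.mul_self_sqrt (norm_nonneg _)] at h5
  rw [e1] at hn
  have h6 : ‖y‖ * ‖y‖ ≤ ‖y‖ * (oneNorm * (‖toL2 y‖ + 2 * ‖u.angStrain - v.angStrain‖)) := by
    refine h3.trans (hn.trans ?_)
    have h7 := norm_add_le (mulL2 innerB y (u.posDeriv - v.posDeriv))
      (mulL2 innerB y (u.posDeriv - v.posDeriv))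
    have h8 : ‖toL2 (mulC innerB y y)‖ + ‖mulL2 innerB y (u.posDeriv - v.posDeriv)
        + mulL2 innerB y (u.posDeriv - v.posDeriv)‖
        ≤ ‖y‖ * (‖toL2 y‖ + 2 * ‖u.angStrain - v.angStrain‖) := by linarith
    calc _ ≤ oneNorm * (‖y‖ * (‖toL2 y‖ + 2 * ‖u.angStrain - v.angStrain‖)) :=
          mul_le_mul_of_nonneg_left h8 h0
      _ = _ := by ring
  rcases (norm_nonneg y).eq_or_lt with hz | hz
  · rw [← hz]; positivity
  · exact le_of_mul_le_mul_left h6 hz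

end Difference

/-! ### Duhamel formula and Gronwall argument -/

section Uniqueness

variable {T : ℝ} {f : ℝ × Torus → Plane} {u₀ : State} {u v : ℝ → State}

/-- Duhamel's formula along characteristics, proved by duality: the two invariants are tested with
the same travelling weight, and their sources differ by the difference of the frames paired with f.
-/
lemma IsSolution.invariant_sub_eq (hu : IsSolution T f u₀ u) (hv : IsSolution T f u₀ v)
    {F : ℝ → SqInt Plane} (hF : ContinuousOn F (Icc 0 T))
    (hf : ∀ t ∈ Icc 0 T, ∀ᵐ x, F t x = f (t, x)) {e : ℝ} (he : e * e = 1) {t : ℝ}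
    (ht : t ∈ Icc 0 T) :
    shiftL (-(e * t)) (((u t).angVel - (v t).angVel) + e • ((u t).angStrain - (v t).angStrain))
      = - ∫ s in (0 : ℝ)..t, shiftL (-(e * s)) (mulL2 innerJ ((u s).posC - (v s).posC) (F s)) := by
  have hk : ContinuousOn (fun s => shiftL (-(e * s))
      (mulL2 innerJ ((u s).posC - (v s).posC) (F s))) (Icc 0 T) := by
    have h1 := (hu.continuousOn_posC.sub hv.continuousOn_posC).mulL2 innerJ hF
    exact continuous_shiftL_uncurry.comp_continuousOn
      (f := fun s : ℝ => (-(e * s), mulL2 innerJ ((u s).posC - (v s).posC) (F s)))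
      ((by fun_prop : Continuous fun s : ℝ => -(e * s)).continuousOn.prodMk h1)
  have hki : ∀ s ∈ Icc 0 T, IntervalIntegrable (fun s => shiftL (-(e * s))
      (mulL2 innerJ ((u s).posC - (v s).posC) (F s))) volume 0 s := fun s hs =>
    (hk.mono (by rw [uIcc_of_le hs.1]; exact Icc_subset_Icc_right hs.2)).intervalIntegrable
  rw [← sub_eq_zero]
  apply eq_zero_of_forall_inner_c1
  intro m m' hm
  let g : ℝ → ℝ := fun s =>
    inner ℝ ((u s).angVel + e • (u s).angStrain) (toL2 (shiftC (e * s) m))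
      - inner ℝ ((v s).angVel + e • (v s).angStrain) (toL2 (shiftC (e * s) m))
  have hg : ∀ s ∈ Icc 0 T, HasDerivWithinAt g (- inner ℝ (shiftL (-(e * s))
      (mulL2 innerJ ((u s).posC - (v s).posC) (F s))) (toL2 m)) (Icc 0 T) s := by
    intro s hs
    have hF' : ContinuousOn (fun r => mulL2 smulB (shiftC (e * s) m) (F r)) (Icc 0 T) :=
      (continuousOn_const (c := shiftC (e * s) m)).mulL2 smulB hF
    have hf' : ∀ r ∈ Icc 0 T, ∀ᵐ x, mulL2 smulB (shiftC (e * s) m) (F r) x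
        = shiftC (e * s) m x • f (r, x) := by
      intro r hr
      filter_upwards [hf r hr, coeFn_mulL2 smulB (shiftC (e * s) m) (F r)] with x h1 h2
      rw [h2, h1, smulB_apply]
    refine ((hu.hasDerivWithinAt_invariant hm he hs hF' hf').sub
      (hv.hasDerivWithinAt_invariant hm he hs hF' hf')).congr_deriv ?_
    rw [inner_shiftL, neg_neg, shiftL_toL2, neg_sub_neg, ← inner_sub_right, ← map_sub,
      ← inner_neg_right, ← map_neg, inner_toL2_right, inner_toL2_right]
    refine integral_congr_ae ?_
    filter_upwards [coeFn_mulL2 smulB (shiftC (e * s) m) (F s),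
      coeFn_mulL2 innerJ ((u s).posC - (v s).posC) (F s)] with x h1 h2
    rw [h1, h2]
    simp only [smulB_apply, innerJ_apply, ContinuousMap.sub_apply, ContinuousMap.neg_apply,
      jC_apply, inner_smul_left, RCLike.inner_apply, conj_trivial, ← map_sub]
    rw [real_inner_comm, map_sub, map_sub, inner_sub_left, inner_sub_left]
    ring
  have hgc : ContinuousOn (fun s => - inner ℝ (shiftL (-(e * s))
      (mulL2 innerJ ((u s).posC - (v s).posC) (F s))) (toL2 m)) (Icc 0 T) :=
    (hk.inner continuousOn_const).neg
  have hsub : Icc 0 t ⊆ Icc 0 T := Icc_subset_Icc_right ht.2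
  have h1 : g t - g 0 = ∫ s in (0 : ℝ)..t, - inner ℝ (shiftL (-(e * s))
      (mulL2 innerJ ((u s).posC - (v s).posC) (F s))) (toL2 m) := by
    symm
    refine intervalIntegral.integral_eq_sub_of_hasDerivAt_of_le ht.1
      (fun s hs => (hg s (hsub hs)).continuousWithinAt.mono hsub) (fun s hs => ?_) ?_
    · exact (hg s (hsub (Ioo_subset_Icc_self hs))).hasDerivAt
        (Icc_mem_nhds hs.1 (hs.2.trans_le ht.2))
    · exact (hgc.mono (by rw [uIcc_of_le ht.1]; exact hsub)).intervalIntegrable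
  have h2 : g 0 = 0 := by simp only [g, hu.initial, hv.initial, sub_self]
  have h3 : inner ℝ (∫ s in (0 : ℝ)..t, shiftL (-(e * s))
      (mulL2 innerJ ((u s).posC - (v s).posC) (F s))) (toL2 m)
      = ∫ s in (0 : ℝ)..t, inner ℝ (shiftL (-(e * s))
      (mulL2 innerJ ((u s).posC - (v s).posC) (F s))) (toL2 m) := by
    have := ((innerSL ℝ).flip (toL2 m)).intervalIntegral_comp_comm (hki t ht)
    exact this.symm
  rw [h2, sub_zero, intervalIntegral.integral_neg, ← h3] at h1
  rw [inner_sub_left, inner_neg_left, ← h1, inner_shiftL, neg_neg, shiftL_toL2]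
  simp only [g, inner_add_left, inner_sub_left, smul_sub]
  ring

/-- Velocity and strain are the half sum and half difference of the invariants for e = 1 and e = -1.
-/
lemma IsSolution.norm_ang_sub_le (hu : IsSolution T f u₀ u) (hv : IsSolution T f u₀ v)
    {F : ℝ → SqInt Plane} (hF : ContinuousOn F (Icc 0 T))
    (hf : ∀ t ∈ Icc 0 T, ∀ᵐ x, F t x = f (t, x)) :
    ∃ C, 0 ≤ C ∧ ∀ t ∈ Icc 0 T,
      ‖(u t).angVel - (v t).angVel‖ ≤ C * ∫ s in (0 : ℝ)..t, ‖(u s).posC - (v s).posC‖ ∧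
      ‖(u t).angStrain - (v t).angStrain‖ ≤ C * ∫ s in (0 : ℝ)..t, ‖(u s).posC - (v s).posC‖ := by
  obtain ⟨M, hM⟩ := isCompact_Icc.exists_bound_of_continuousOn hF
  set C := ‖mulL2 (innerJ : Plane →L[ℝ] Plane →L[ℝ] ℝ)‖ * max M 0 with hC
  have hC0 : 0 ≤ C := by positivity
  have key : ∀ e : ℝ, e * e = 1 → ∀ t ∈ Icc 0 T,
      ‖((u t).angVel - (v t).angVel) + e • ((u t).angStrain - (v t).angStrain)‖
        ≤ C * ∫ s in (0 : ℝ)..t, ‖(u s).posC - (v s).posC‖ := by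
    intro e he t ht
    rw [← (shiftL (E := ℝ) (-(e * t))).norm_map, hu.invariant_sub_eq hv hF hf he ht, norm_neg,
      ← intervalIntegral.integral_const_mul]
    refine intervalIntegral.norm_integral_le_of_norm_le ht.1 ?_ ?_
    · refine Eventually.of_forall fun s hs => ?_
      rw [LinearIsometry.norm_map]
      have h1 := (mulL2 innerJ).le_opNorm₂ ((u s).posC - (v s).posC) (F s)
      have h2 := (hM s ⟨hs.1.le, hs.2.trans ht.2⟩).trans (le_max_left M 0)
      refine h1.trans ?_
      calc _ ≤ ‖mulL2 (innerJ : Plane →L[ℝ] Plane →L[ℝ] ℝ)‖ * ‖(u s).posC - (v s).posC‖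
            * max M 0 := mul_le_mul_of_nonneg_left h2 (by positivity)
        _ = _ := by rw [hC]; ring
    · refine ContinuousOn.intervalIntegrable ?_
      rw [uIcc_of_le ht.1]
      exact continuousOn_const.mul ((hu.continuousOn_posC.sub hv.continuousOn_posC).norm.mono
        (Icc_subset_Icc_right ht.2))
  refine ⟨C, hC0, fun t ht => ?_⟩
  have h1 := key 1 (by norm_num) t ht
  have h2 := key (-1) (by norm_num) t ht
  set a := (u t).angVel - (v t).angVel
  set b := (u t).angStrain - (v t).angStrain
  have ha : a = (1 / 2 : ℝ) • ((a + (1 : ℝ) • b) + (a + (-1 : ℝ) • b)) := by module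
  have hb : b = (1 / 2 : ℝ) • ((a + (1 : ℝ) • b) - (a + (-1 : ℝ) • b)) := by module
  have h3 := norm_add_le (a + (1 : ℝ) • b) (a + (-1 : ℝ) • b)
  have h4 := norm_sub_le (a + (1 : ℝ) • b) (a + (-1 : ℝ) • b)
  have h5 : ‖(1 / 2 : ℝ)‖ = 1 / 2 := by norm_num
  constructor
  · rw [ha, norm_smul, h5]; linarith
  · rw [hb, norm_smul, h5]; linarith

/-- Solutions are unique when the control is continuous in time with values in `L²`. -/
lemma IsSolution.eqOn (hu : IsSolution T f u₀ u) (hv : IsSolution T f u₀ v)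
    {F : ℝ → SqInt Plane} (hF : ContinuousOn F (Icc 0 T))
    (hf : ∀ t ∈ Icc 0 T, ∀ᵐ x, F t x = f (t, x)) : EqOn v u (Icc 0 T) := by
  obtain ⟨C, hC0, hC⟩ := hu.norm_ang_sub_le hv hF hf
  have h0 : 0 ≤ oneNorm := norm_nonneg _
  let y : ℝ → C(Torus, Plane) := fun t => (u t).posC - (v t).posC
  let L : ℝ → ℝ := fun t => ∫ s in (0 : ℝ)..t, ‖y s‖
  have hyc : ContinuousOn y (Icc 0 T) := hu.continuousOn_posC.sub hv.continuousOn_posC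
  have hyn : ContinuousOn (fun t => ‖y t‖) (Icc 0 T) := hyc.norm
  have hL : ∀ t ∈ Icc 0 T, HasDerivWithinAt L ‖y t‖ (Icc 0 T) t := fun t ht =>
    hasDerivWithinAt_integral_Icc hyn ht
  have hint : ∀ t ∈ Icc 0 T, ∀ s ∈ Icc 0 T, IntervalIntegrable (fun s => ‖y s‖) volume s t :=
    fun t ht s hs => (hyn.mono (uIcc_subset_Icc hs ht)).intervalIntegrable
  have hmono : ∀ t ∈ Icc 0 T, ∀ s ∈ Icc 0 t, L s ≤ L t := by
    intro t ht s hs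
    have hs' : s ∈ Icc 0 T := ⟨hs.1, hs.2.trans ht.2⟩
    have h00 : (0 : ℝ) ∈ Icc 0 T := ⟨le_rfl, ht.1.trans ht.2⟩
    have := intervalIntegral.integral_add_adjacent_intervals (hint s hs' 0 h00) (hint t ht s hs')
    have h2 : 0 ≤ ∫ r in s..t, ‖y r‖ :=
      intervalIntegral.integral_nonneg hs.2 fun _ _ => norm_nonneg _
    simp only [L]; linarith
  have hL0 : L 0 = 0 := by simp [L]
  have hLnn : ∀ t ∈ Icc 0 T, 0 ≤ L t := fun t ht => by
    have := hmono t ht 0 ⟨le_rfl, ht.1⟩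
    rwa [hL0] at this
  -- The derivative of the squared L² distance is 2⟨y, y_t⟩, again bounded through the difference of
  -- angular velocities alone; `L` is monotone, so its value at t bounds the earlier ones.
  have hN : ∀ t ∈ Icc 0 T, ‖toL2 (y t)‖ ^ 2 ≤ 2 * (C * oneNorm) * L t ^ 2 := by
    intro t ht
    have hsub : Icc 0 t ⊆ Icc 0 T := Icc_subset_Icc_right ht.2
    have hd : ∀ s ∈ Icc 0 T, HasDerivWithinAt (fun s => ‖toL2 (y s)‖ ^ 2)
        (2 * inner ℝ (toL2 (y s)) ((u s).vel - (v s).vel)) (Icc 0 T) s := by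
      intro s hs
      have h1 := (hu.hasDerivWithinAt s hs).sub (hv.hasDerivWithinAt s hs)
      refine HasDerivWithinAt.norm_sq (f := fun s => toL2 (y s)) ?_
      refine h1.congr_of_eventuallyEq (Eventually.of_forall fun r => ?_) ?_
      · exact map_sub toL2 (u r).posC (v r).posC
      · exact map_sub toL2 (u s).posC (v s).posC
    have hdc : ContinuousOn (fun s => 2 * inner ℝ (toL2 (y s)) ((u s).vel - (v s).vel))
        (Icc 0 T) :=
      continuousOn_const.mul (hyc.toL2.inner (hu.continuousOn_vel.sub hv.continuousOn_vel))
    have h1 : ‖toL2 (y t)‖ ^ 2 - ‖toL2 (y 0)‖ ^ 2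
        = ∫ s in (0 : ℝ)..t, 2 * inner ℝ (toL2 (y s)) ((u s).vel - (v s).vel) := by
      symm
      refine intervalIntegral.integral_eq_sub_of_hasDerivAt_of_le ht.1
        (fun s hs => (hd s (hsub hs)).continuousWithinAt.mono hsub) (fun s hs => ?_) ?_
      · exact (hd s (hsub (Ioo_subset_Icc_self hs))).hasDerivAt
          (Icc_mem_nhds hs.1 (hs.2.trans_le ht.2))
      · exact (hdc.mono (by rw [uIcc_of_le ht.1]; exact hsub)).intervalIntegrable
    have h2 : y 0 = 0 := by simp only [y, hu.initial, hv.initial, sub_self]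
    rw [h2, map_zero, norm_zero, zero_pow two_ne_zero, sub_zero] at h1
    rw [h1]
    have h3 : ∫ s in (0 : ℝ)..t, 2 * inner ℝ (toL2 (y s)) ((u s).vel - (v s).vel)
        ≤ ∫ s in (0 : ℝ)..t, 2 * (C * oneNorm) * L t * ‖y s‖ := by
      refine intervalIntegral.integral_mono_on ht.1
        ((hdc.mono (by rw [uIcc_of_le ht.1]; exact hsub)).intervalIntegrable)
        ((hint t ht 0 ⟨le_rfl, ht.1.trans ht.2⟩).const_mul _) fun s hs => ?_
      have h4 := (le_abs_self _).trans
        (abs_inner_toL2_sub_le (u s) (v s) (u s).vel_eq (v s).vel_eq)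
      have h5 : ‖(u s).angVel - (v s).angVel‖ ≤ C * L t :=
        (hC s (hsub hs)).1.trans (mul_le_mul_of_nonneg_left (hmono t ht s hs) hC0)
      have h6 : ‖toL2 (y s)‖ ≤ ‖y s‖ * oneNorm := norm_toL2_le fun x => by
        simpa using (y s).norm_coe_le_norm x
      have h7 : ‖toL2 (y s)‖ * ‖(u s).angVel - (v s).angVel‖ ≤ (‖y s‖ * oneNorm) * (C * L t) :=
        mul_le_mul h6 h5 (norm_nonneg _) (by positivity)
      have h8 : inner ℝ (toL2 (y s)) ((u s).vel - (v s).vel)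
        ≤ ‖toL2 (y s)‖ * ‖(u s).angVel - (v s).angVel‖ := h4
      linarith
    refine h3.trans_eq ?_
    rw [intervalIntegral.integral_const_mul]
    simp only [L]; ring
  set K := oneNorm * (Real.sqrt (2 * (C * oneNorm)) + 2 * C) with hK
  have hyL : ∀ t ∈ Icc 0 T, ‖y t‖ ≤ K * L t := by
    intro t ht
    have h1 := norm_posC_sub_le (u t) (v t)
    have h2 := (hC t ht).2
    have h3 : ‖toL2 (y t)‖ ≤ Real.sqrt (2 * (C * oneNorm)) * L t := by
      have := Real.sqrt_le_sqrt (hN t ht)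
      rwa [Real.sqrt_sq (norm_nonneg _), Real.sqrt_mul (by positivity),
        Real.sqrt_sq (hLnn t ht)] at this
    refine h1.trans ?_
    rw [hK, mul_assoc]
    refine mul_le_mul_of_nonneg_left ?_ h0
    have h4 : ‖toL2 ((u t).posC - (v t).posC)‖ ≤ Real.sqrt (2 * (C * oneNorm)) * L t := h3
    have h5 : ‖(u t).angStrain - (v t).angStrain‖ ≤ C * L t := h2
    linarith
  -- Gronwall for `L`: its derivative is the uniform distance, at most K times `L`, and `L` starts
  -- at 0.
  have hLz : ∀ t ∈ Icc 0 T, L t = 0 := by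
    intro t ht
    have h1 := norm_le_gronwallBound_of_norm_deriv_right_le (f := L) (f' := fun s => ‖y s‖)
      (δ := 0) (K := K) (ε := 0) (a := 0) (b := T)
      (fun s hs => (hL s hs).continuousWithinAt)
      (fun s hs => (hL s (Ico_subset_Icc_self hs)).mono_of_mem_nhdsWithin
        (Icc_mem_nhdsGE_of_mem hs))
      (by rw [hL0, norm_zero])
      (fun s hs => by
        have h2 := hyL s (Ico_subset_Icc_self hs)
        have h3 := hLnn s (Ico_subset_Icc_self hs)
        rw [norm_norm, Real.norm_eq_abs, abs_of_nonneg h3, add_zero]; exact h2) t ht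
    rw [gronwallBound_ε0, zero_mul] at h1
    exact norm_le_zero_iff.1 h1
  intro t ht
  have h1 : y t = 0 := by
    have := hyL t ht
    rw [hLz t ht, mul_zero] at this
    exact norm_le_zero_iff.1 this
  have h2 : (v t).posC = (u t).posC := (sub_eq_zero.1 h1).symm
  refine State.eq_of h2 ?_
  have h3 := (hC t ht).1
  have h4 : ∫ s in (0 : ℝ)..t, ‖(u s).posC - (v s).posC‖ = 0 := hLz t ht
  rw [h4, mul_zero] at h3
  have h5 := sub_eq_zero.1 (norm_le_zero_iff.1 h3)
  rw [(u t).vel_eq, (v t).vel_eq, h5, h2]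

end Uniqueness

end

section

/-! ### The linear wave equation -/

/-- `θ` is a solution of the linear wave equation `-θ_tt + θ_xx = h` on the circle, with time
derivative `A` and space derivative `B`. -/
structure IsLinSol (θ : ℝ → C(Torus, ℝ)) (A B h : ℝ → SqInt ℝ) : Prop where
  pathDeriv : ∀ t, PathDeriv θ (A t) univ t
  spDeriv : ∀ t, SpDeriv (θ t) (B t)
  continuous_time : Continuous A
  continuous_space : Continuous B
  continuous_source : Continuous h
  equation : ∀ (m : C(Torus, ℝ)) (m' : SqInt ℝ), SpDeriv m m' → ∀ t,
    HasDerivAt (fun s => inner ℝ (A s) (toL2 m)) (-inner ℝ (B t) m' - inner ℝ (h t) (toL2 m)) t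

lemma IsLinSol.add {θ₁ θ₂ : ℝ → C(Torus, ℝ)} {A₁ A₂ B₁ B₂ h₁ h₂ : ℝ → SqInt ℝ}
    (H₁ : IsLinSol θ₁ A₁ B₁ h₁) (H₂ : IsLinSol θ₂ A₂ B₂ h₂) :
    IsLinSol (fun t => θ₁ t + θ₂ t) (fun t => A₁ t + A₂ t) (fun t => B₁ t + B₂ t)
      (fun t => h₁ t + h₂ t) where
  pathDeriv t := (H₁.pathDeriv t).add (H₂.pathDeriv t)
  spDeriv t := (H₁.spDeriv t).add (H₂.spDeriv t)
  continuous_time := H₁.continuous_time.add H₂.continuous_time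
  continuous_space := H₁.continuous_space.add H₂.continuous_space
  continuous_source := H₁.continuous_source.add H₂.continuous_source
  equation m m' hm t := by
    simp only [inner_add_left]
    refine ((H₁.equation m m' hm t).fun_add (H₂.equation m m' hm t)).congr_deriv ?_
    ring

lemma hasDerivAt_inner_const {X : Type*} [NormedAddCommGroup X] [InnerProductSpace ℝ X]
    {r : ℝ → X} {r' : X} {t : ℝ} (hr : HasDerivAt r r' t) (w : X) :
    HasDerivAt (fun s => inner ℝ (r s) w) (inner ℝ r' w) t := by
  simpa using hr.inner ℝ (hasDerivAt_const t w)

/-- If `θ_t - e θ_x = K` with `e = ±1`, then `θ` solves the wave equation with source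
`-(K_t + e K_x)`. -/
lemma isLinSol_of_transport {θ : ℝ → C(Torus, ℝ)} {A B h Kt Kx : ℝ → SqInt ℝ}
    {K : ℝ → C(Torus, ℝ)} {e : ℝ} (he : e * e = 1) (hθ : ∀ t, PathDeriv θ (A t) univ t)
    (hB : ∀ t, SpDeriv (θ t) (B t)) (hA : ∀ t, A t = e • B t + toL2 (K t))
    (hKt : ∀ t, PathDeriv K (Kt t) univ t) (hKx : ∀ t, SpDeriv (K t) (Kx t))
    (hAc : Continuous A) (hBc : Continuous B) (hc : Continuous h)
    (hh : ∀ t, h t = -(Kt t + e • Kx t)) : IsLinSol θ A B h where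
  pathDeriv := hθ
  spDeriv := hB
  continuous_time := hAc
  continuous_space := hBc
  continuous_source := hc
  equation m m' hm t := by
    have h1 : HasDerivAt (fun s => inner ℝ (B s) (toL2 m)) (-inner ℝ (A t) m') t := by
      have h2 := (hasDerivAt_inner_const (hasDerivWithinAt_univ.1 (hθ t).2) m').fun_neg
      exact h2.congr_of_eventuallyEq (Eventually.of_forall fun s => (hB s).inner_eq_neg hm)
    have h3 := hasDerivAt_inner_const (hasDerivWithinAt_univ.1 (hKt t).2) (toL2 m)
    have h4 := (h1.const_mul e).fun_add h3
    refine (h4.congr_of_eventuallyEq (Eventually.of_forall fun s => ?_)).congr_deriv ?_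
    · simp only [hA, inner_add_left, inner_smul_left, conj_trivial]
    · rw [hh, hA, inner_neg_left, inner_add_left, inner_add_left, inner_smul_left, inner_smul_left,
        (hKx t).inner_eq_neg hm]
      simp only [conj_trivial]
      linear_combination (-inner ℝ (B t) m') * he

/-- A separated solution. It carries the mean of the velocity, as the end velocities of the
travelling parts are space derivatives and have mean zero. -/
lemma isLinSol_smul {ρ ρ' ρ'' : C(Torus, ℝ)} (hρ : C1Deriv ρ ρ') (hρ' : C1Deriv ρ' ρ'')
    {z z' z'' : ℝ → ℝ} (hz : ∀ t, HasDerivAt z (z' t) t) (hz' : ∀ t, HasDerivAt z' (z'' t) t)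
    (hz'' : Continuous z'') :
    IsLinSol (fun t => z t • ρ) (fun t => z' t • toL2 ρ) (fun t => z t • toL2 ρ')
      (fun t => toL2 (z t • ρ'' - z'' t • ρ)) where
  pathDeriv t := by
    have := pathDeriv_of_hasDerivAt univ ((hz t).smul_const ρ)
    rwa [map_smul] at this
  spDeriv t := hρ.spDeriv.const_smul (z t)
  continuous_time := (continuous_iff_continuousAt.2 fun t => (hz' t).continuousAt).smul
    continuous_const
  continuous_space := (continuous_iff_continuousAt.2 fun t => (hz t).continuousAt).smul
    continuous_const
  continuous_source := (toL2 (E := ℝ)).continuous.comp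
    (((continuous_iff_continuousAt.2 fun t => (hz t).continuousAt).smul continuous_const).sub
      (hz''.smul continuous_const))
  equation m m' hm t := by
    have h1 := hasDerivAt_inner_const ((hz' t).smul_const (toL2 ρ)) (toL2 m)
    refine h1.congr_deriv ?_
    have h2 := hρ'.spDeriv.inner_eq_neg hm
    simp only [map_sub, map_smul, inner_sub_left, inner_smul_left, conj_trivial]
    rw [h2]; ring

/-- The integrated formula equates continuous functions in L², hence everywhere, and can be
differentiated in the uniform norm. -/
lemma SpDeriv.c1Deriv {v v' : C(Torus, ℝ)} (h : SpDeriv v (toL2 v')) : C1Deriv v v' := by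
  have hc : Continuous fun s => shiftC s v' := continuous_shiftC continuous_id continuous_const
  have h1 : ∀ r, shiftC r v = v + ∫ s in (0 : ℝ)..r, shiftC s v' := by
    intro r
    rw [← sub_eq_iff_eq_add']
    apply toL2_injective
    rw [map_sub, h.sub_eq_integral r, ← (toL2 (E := ℝ)).intervalIntegral_comp_comm
      (hc.intervalIntegrable _ _)]
    simp only [shiftL_toL2]
  apply c1Deriv_of_hasDerivAt_shiftC
  intro t
  refine ((hc.integral_hasStrictDerivAt 0 t).hasDerivAt.const_add v).congr_of_eventuallyEq ?_
  exact Eventually.of_forall h1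

/-! ### Steering one travelling part by a localized control -/

/-- Multiplication of reals as a bilinear map. -/
def mulB : ℝ →L[ℝ] ℝ →L[ℝ] ℝ := ContinuousLinearMap.mul ℝ ℝ

@[simp] lemma mulB_apply (a b : ℝ) : mulB a b = a * b := rfl

/-- The accumulated control on the characteristics of speed `-e`, in characteristic coordinates. -/
def accum (e T : ℝ) (ρ : C(Torus, ℝ)) (t : ℝ) : C(Torus, ℝ) :=
  ∫ s in (0 : ℝ)..t, (s * (T - s)) • shiftC (-(e * s)) ρ

lemma continuous_accum_integrand (e T : ℝ) (ρ : C(Torus, ℝ)) :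
    Continuous fun s => (s * (T - s)) • shiftC (-(e * s)) ρ :=
  (by fun_prop : Continuous fun s => s * (T - s)).smul
    (continuous_shiftC (by fun_prop) continuous_const)

lemma hasDerivAt_accum (e T : ℝ) (ρ : C(Torus, ℝ)) (t : ℝ) :
    HasDerivAt (accum e T ρ) ((t * (T - t)) • shiftC (-(e * t)) ρ) t :=
  ((continuous_accum_integrand e T ρ).integral_hasStrictDerivAt 0 t).hasDerivAt

lemma continuous_accum (e T : ℝ) (ρ : C(Torus, ℝ)) : Continuous (accum e T ρ) :=
  continuous_iff_continuousAt.2 fun t => (hasDerivAt_accum e T ρ t).continuousAt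

lemma spDeriv_accum (e T : ℝ) {ρ ρ' : C(Torus, ℝ)} (hρ : C1Deriv ρ ρ') (t : ℝ) :
    SpDeriv (accum e T ρ t) (toL2 (accum e T ρ' t)) := by
  have key : ∀ (ρ V : C(Torus, ℝ)), inner ℝ (toL2 (accum e T ρ t)) (toL2 V)
      = ∫ s in (0 : ℝ)..t, inner ℝ (toL2 ((s * (T - s)) • shiftC (-(e * s)) ρ)) (toL2 V) := by
    intro ρ V
    have := (((innerSL ℝ).flip (toL2 V)).comp (toL2 (E := ℝ))).intervalIntegral_comp_comm
      ((continuous_accum_integrand e T ρ).intervalIntegrable (μ := volume) 0 t)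
    exact this.symm
  apply spDeriv_of_forall_c1
  intro V V' hV
  rw [key, key, ← intervalIntegral.integral_neg]
  refine intervalIntegral.integral_congr fun s _ => ?_
  have h1 := (hρ.spDeriv.shift (-(e * s))).const_smul (s * (T - s))
  have h2 := h1.inner_eq_neg hV.spDeriv
  rw [shiftL_toL2, ← map_smul] at h2
  linarith

lemma accum_apply (e T : ℝ) (ρ : C(Torus, ℝ)) (t : ℝ) (x : Torus) :
    accum e T ρ t x = ∫ s in (0 : ℝ)..t, (s * (T - s)) * ρ (x + ((-(e * s) : ℝ) : Torus)) := by
  have := (ContinuousMap.evalCLM ℝ (M := ℝ) x).intervalIntegral_comp_comm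
    ((continuous_accum_integrand e T ρ).intervalIntegrable (μ := volume) 0 t)
  exact this.symm

lemma accum_pos {e T : ℝ} {ρ : C(Torus, ℝ)} (hT : 0 < T) (hρ : ∀ x, 0 ≤ ρ x) {x : Torus} {s : ℝ}
    (hs : s ∈ Ioo 0 T) (hx : 0 < ρ (x + ((-(e * s) : ℝ) : Torus))) : 0 < accum e T ρ T x := by
  rw [accum_apply]
  have hc : Continuous fun s : ℝ => (s * (T - s)) * ρ (x + ((-(e * s) : ℝ) : Torus)) := by fun_prop
  refine intervalIntegral.integral_pos hT hc.continuousOn (fun r hr => ?_) ⟨s, Ioo_subset_Icc_self hs, ?_⟩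
  · exact mul_nonneg (mul_nonneg hr.1.le (by linarith [hr.2])) (hρ _)
  · exact mul_pos (mul_pos hs.1 (by linarith [hs.2])) hx

/-- The continuous part of the control of the characteristics of speed `-e`. -/
def srcC (e T : ℝ) (ρ ρ' q : C(Torus, ℝ)) (t : ℝ) : C(Torus, ℝ) :=
  -mulC mulB ((T - 2 * t) • ρ + (e * (t * (T - t))) • ρ') (shiftC (e * t) q)

/-- The coefficient of the derivative in the control of the characteristics of speed `-e`. -/
def srcD (e T : ℝ) (ρ : C(Torus, ℝ)) (t : ℝ) : C(Torus, ℝ) := -((2 * e * (t * (T - t))) • ρ)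

lemma continuous_srcC (e T : ℝ) (ρ ρ' q : C(Torus, ℝ)) : Continuous (srcC e T ρ ρ' q) := by
  have h1 : Continuous fun t : ℝ => (T - 2 * t) • ρ + (e * (t * (T - t))) • ρ' := by fun_prop
  have h2 : Continuous fun t : ℝ => shiftC (e * t) q :=
    continuous_shiftC (by fun_prop) continuous_const
  exact ((continuous_mulC mulB).comp (h1.prodMk h2)).neg

lemma continuous_srcD (e T : ℝ) (ρ : C(Torus, ℝ)) : Continuous (srcD e T ρ) := by
  unfold srcD; fun_prop

lemma continuous_mulL2 {E F G : Type*} [NormedAddCommGroup E] [NormedSpace ℝ E]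
    [NormedAddCommGroup F] [NormedSpace ℝ F] [NormedAddCommGroup G] [NormedSpace ℝ G]
    (B : E →L[ℝ] F →L[ℝ] G) {y : ℝ → C(Torus, E)} {v : ℝ → SqInt F} (hy : Continuous y)
    (hv : Continuous v) : Continuous fun s => mulL2 B (y s) (v s) :=
  ((mulL2 B).continuous.comp hy).clm_apply hv

/-- The part of the solution which moves along the characteristics of speed `-e` can be steered
from `F₀` to `F₁` by a control localized by `ρ`. -/
lemma exists_isLinSol_transport {e T : ℝ} (he : e * e = 1) {ρ ρ' : C(Torus, ℝ)}
    (hρ : C1Deriv ρ ρ') (hpos : ∀ x, 0 < accum e T ρ T x) {F₀ F₁ : C(Torus, ℝ)}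
    {F₀' F₁' : SqInt ℝ} (hF₀ : SpDeriv F₀ F₀') (hF₁ : SpDeriv F₁ F₁') :
    ∃ (q : C(Torus, ℝ)) (q' : SqInt ℝ) (θ : ℝ → C(Torus, ℝ)) (A B : ℝ → SqInt ℝ),
      IsLinSol θ A B
        (fun t => toL2 (srcC e T ρ ρ' q t) + mulL2 mulB (srcD e T ρ t) (shiftL (e * t) q')) ∧
      θ 0 = F₀ ∧ θ T = F₁ ∧ A 0 = e • F₀' ∧ A T = e • F₁' := by
  set N := accum e T ρ T with hN
  have hNd : C1Deriv N (accum e T ρ' T) := (spDeriv_accum e T hρ T).c1Deriv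
  let M : C(Torus, ℝ) := ⟨fun x => (N x)⁻¹, N.continuous.inv₀ fun x => (hpos x).ne'⟩
  let M' : C(Torus, ℝ) := ⟨fun x => -(accum e T ρ' T x) / N x ^ 2, by
    refine Continuous.div (by fun_prop) (by fun_prop) fun x => ?_
    have := hpos x
    positivity⟩
  have hM : C1Deriv M M' := fun s => (hNd s).fun_inv (hpos _).ne'
  -- The change of profile required in characteristic coordinates.
  set D := shiftC (-(e * T)) F₁ - F₀ with hD
  have hDd : SpDeriv D _ := (hF₁.shift (-(e * T))).sub hF₀
  obtain ⟨q, q', hq, hqD⟩ : ∃ (q : C(Torus, ℝ)) (q' : SqInt ℝ), SpDeriv q q' ∧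
      mulC mulB N q = D := by
    refine ⟨mulC mulB M D, _, hM.spDeriv.mulC mulB hDd, ?_⟩
    ext x
    simp only [mulC_apply, mulB_apply, M, ContinuousMap.coe_mk]
    have := (hpos x).ne'
    field_simp
  -- The weight vanishes at times 0 and T, so the end velocities are exactly those of free
  -- travelling waves.
  let σ : ℝ → ℝ := fun t => t * (T - t)
  have hσ : ∀ t, HasDerivAt σ (T - 2 * t) t := fun t => by
    have := (hasDerivAt_id t).mul ((hasDerivAt_id t).const_sub T)
    refine this.congr_deriv ?_
    simp; ring
  have hσc : Continuous σ := by fun_prop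
  let W : ℝ → C(Torus, ℝ) := fun t => F₀ + mulC mulB (accum e T ρ t) q
  let W' : ℝ → C(Torus, ℝ) := fun t => mulC mulB (σ t • shiftC (-(e * t)) ρ) q
  let Wx : ℝ → SqInt ℝ := fun t => F₀' + (mulL2 mulB (accum e T ρ t) q'
    + mulL2 mulB.flip q (toL2 (accum e T ρ' t)))
  have hconst : ∀ (w : C(Torus, ℝ)) t, PathDeriv (fun _ : ℝ => w) 0 univ t := fun w t =>
    ⟨continuousWithinAt_const, hasDerivWithinAt_const _ _ _⟩
  have hWt : ∀ t, PathDeriv W (toL2 (W' t)) univ t := by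
    intro t
    have h1 := (hconst F₀ t).add ((pathDeriv_of_hasDerivAt univ (hasDerivAt_accum e T ρ t)).mulC
      mulB (hconst q t))
    rw [zero_add, map_zero, zero_add, ← toL2_mulC_flip] at h1
    exact h1
  have hWx : ∀ t, SpDeriv (W t) (Wx t) := fun t =>
    hF₀.add ((spDeriv_accum e T hρ t).mulC mulB hq)
  have hWxc : Continuous Wx := by
    refine continuous_const.add ((continuous_mulL2 mulB (continuous_accum e T ρ)
      continuous_const).add ?_)
    exact (mulL2 mulB.flip q).continuous.comp ((toL2 (E := ℝ)).continuous.comp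
      (continuous_accum e T ρ'))
  have hW'c : Continuous fun t => toL2 (W' t) := by
    have h1 : Continuous fun t => σ t • shiftC (-(e * t)) ρ := continuous_accum_integrand e T ρ
    exact (toL2 (E := ℝ)).continuous.comp ((continuous_mulC mulB).comp
      (h1.prodMk continuous_const))
  let θ : ℝ → C(Torus, ℝ) := fun t => shiftC (e * t) (W t)
  let A : ℝ → SqInt ℝ := fun t => shiftL (e * t) (toL2 (W' t) + e • Wx t)
  let B : ℝ → SqInt ℝ := fun t => shiftL (e * t) (Wx t)
  -- K is θ_t - eθ_x. It contains the factor ρ, so the source -(K_t + eK_x) is localized too; its q'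
  -- terms from K_t and eK_x coincide, whence the 2 in `srcD`.
  let K : ℝ → C(Torus, ℝ) := fun t => mulC mulB (σ t • ρ) (shiftC (e * t) q)
  have hKW : ∀ t, shiftC (e * t) (W' t) = K t := by
    intro t
    simp only [W', K, shiftC_mulC, map_smul, shiftC_shiftC, add_neg_cancel, shiftC_zero]
  have hA : ∀ t, A t = e • B t + toL2 (K t) := by
    intro t
    simp only [A, B, map_add, map_smul, shiftL_toL2, hKW]
    abel
  have hσρ : ∀ t, PathDeriv (fun t => σ t • ρ) (toL2 ((T - 2 * t) • ρ)) univ t := fun t =>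
    pathDeriv_of_hasDerivAt univ ((hσ t).smul_const ρ)
  have hKt : ∀ t, PathDeriv K _ univ t := fun t => (hσρ t).mulC mulB (hq.pathDeriv_shift e t)
  have hKx : ∀ t, SpDeriv (K t) _ := fun t =>
    (hρ.spDeriv.const_smul (σ t)).mulC mulB (hq.shift (e * t))
  have hBd : ∀ t, SpDeriv (θ t) (B t) := fun t => (hWx t).shift (e * t)
  have hes : Continuous fun t : ℝ => e * t := by fun_prop
  have hlin : IsLinSol θ A B
      (fun t => toL2 (srcC e T ρ ρ' q t) + mulL2 mulB (srcD e T ρ t) (shiftL (e * t) q')) := by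
    refine isLinSol_of_transport he (fun t => (hWt t).shift e (hWx t)) hBd hA hKt hKx
      (continuous_shiftL hes (hW'c.add (hWxc.const_smul e)))
      (continuous_shiftL hes hWxc)
      (((toL2 (E := ℝ)).continuous.comp (continuous_srcC e T ρ ρ' q)).add
        (continuous_mulL2 mulB (continuous_srcD e T ρ) (continuous_shiftL hes continuous_const)))
      fun t => ?_
    rw [← map_smul toL2, ← toL2_mulC_flip, ← toL2_mulC_flip, srcC, srcD]
    have e1 : mulC mulB ((T - 2 * t) • ρ + (e * (t * (T - t))) • ρ') (shiftC (e * t) q)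
        = mulC mulB ((T - 2 * t) • ρ) (shiftC (e * t) q)
          + e • mulC mulB (σ t • ρ') (shiftC (e * t) q) := by
      ext x; simp [σ]; ring
    rw [e1]
    simp only [map_neg, map_add, map_smul, neg_apply,
      smul_apply, σ]
    module
  refine ⟨q, q', θ, A, B, hlin, ?_, ?_, ?_, ?_⟩
  · simp only [θ, W, mul_zero, shiftC_zero, accum, intervalIntegral.integral_same]
    ext x; simp
  · simp only [θ, W]
    rw [← hN, hqD, hD, add_sub_cancel, shiftC_shiftC, add_neg_cancel, shiftC_zero]
  · have h0 : θ 0 = F₀ := by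
      simp only [θ, W, mul_zero, shiftC_zero, accum, intervalIntegral.integral_same]
      ext x; simp
    have hB0 := hBd 0
    rw [h0] at hB0
    have hK0 : K 0 = 0 := by ext x; simp [K, σ]
    rw [hA, hK0, map_zero, add_zero, hB0.unique hF₀]
  · have h0 : θ T = F₁ := by
      simp only [θ, W]
      rw [← hN, hqD, hD, add_sub_cancel, shiftC_shiftC, add_neg_cancel, shiftC_zero]
    have hB0 := hBd T
    rw [h0] at hB0
    have hK0 : K T = 0 := by ext x; simp [K, σ]
    rw [hA, hK0, map_zero, add_zero, hB0.unique hF₁]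

end

section

/-! ### Lifts -/

/-- The standard map of degree `d`. -/
def windC (d : ℤ) : C(Torus, Plane) :=
  ⟨fun x => !₂[(fourier d x).re, (fourier d x).im], by fun_prop⟩

lemma windC_coe (d : ℤ) (r : ℝ) : windC d (r : Torus) = rot (d * r) !₂[1, 0] := by
  have h : fourier d (r : Torus) = Complex.exp ((d * r : ℝ) * Complex.I) := by
    rw [fourier_coe_apply]
    congr 1
    have : (Real.pi : ℂ) ≠ 0 := by exact_mod_cast Real.pi_ne_zero
    push_cast
    field_simp
  ext i
  fin_cases i
  · simp [windC, rot, -fourier_apply, h, Complex.exp_ofReal_mul_I_re,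
      -Complex.ofReal_mul]
  · simp [windC, rot, -fourier_apply, h, Complex.exp_ofReal_mul_I_im,
      -Complex.ofReal_mul]

lemma norm_windC (d : ℤ) (x : Torus) : ‖windC d x‖ = 1 := by
  induction x using QuotientAddGroup.induction_on with
  | H r =>
    have h := windC_coe d r
    rw [h, norm_rot, EuclideanSpace.norm_eq]
    simp

lemma rotC_rotC (y z : C(Torus, ℝ)) (g : C(Torus, Plane)) :
    rotC y (rotC z g) = rotC (y + z) g := by
  ext1 x; simp [rot_add]

lemma norm_rotC (y : C(Torus, ℝ)) {g : C(Torus, Plane)} (hg : ∀ x, ‖g x‖ = 1) (x : Torus) :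
    ‖rotC y g x‖ = 1 := by rw [rotC_apply, norm_rot, hg]

/-- Translating the standard map rotates it by a constant angle, so its space derivative comes from
the chain rule for rotations. -/
lemma shiftC_windC (d : ℤ) (s : ℝ) :
    shiftC s (windC d) = rotC (s • ((d : ℝ) • (1 : C(Torus, ℝ)))) (windC d) := by
  ext1 x
  induction x using QuotientAddGroup.induction_on with
  | H r =>
    have h := windC_coe d r
    have h' := windC_coe d (r + s)
    rw [AddCircle.coe_add] at h'
    rw [shiftC_apply, rotC_apply, h, h', ← rot_add]
    congr 1
    simp; ring

lemma shiftC_rotC_windC (d : ℤ) (s : ℝ) (y : C(Torus, ℝ)) :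
    shiftC s (rotC y (windC d)) = rotC (shiftC s y + s • ((d : ℝ) • (1 : C(Torus, ℝ)))) (windC d) := by
  rw [← rotC_rotC, ← shiftC_windC]; rfl

lemma hasDerivAt_smul_const_zero {X : Type*} [NormedAddCommGroup X] [NormedSpace ℝ X] (w : X) :
    HasDerivAt (fun s : ℝ => s • w) w 0 := by
  simpa using (hasDerivAt_id (0 : ℝ)).smul_const w

lemma SpDeriv.rotC_windC {y : C(Torus, ℝ)} {y' : SqInt ℝ} (hy : SpDeriv y y') (d : ℤ) :
    SpDeriv (rotC y (windC d))
      (mulL2 smulJ (rotC y (windC d)) (y' + (d : ℝ) • toL2 1)) := by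
  have h1 := (hy.pathDeriv.add (pathDeriv_of_hasDerivAt univ
    (hasDerivAt_smul_const_zero ((d : ℝ) • (1 : C(Torus, ℝ)))))).rotC (norm_windC d)
  simp only [shiftC_zero, zero_smul, add_zero, map_smul] at h1
  refine PathDeriv.spDeriv ?_
  simpa only [shiftC_rotC_windC] using h1

/-- A continuous lift of an H¹ map is itself H¹: recover the angle of the translated map and
subtract the part ds due to the degree. -/
lemma spDeriv_of_rotC_windC {y : C(Torus, ℝ)} {d : ℤ} {v : SqInt Plane}
    (h : SpDeriv (rotC y (windC d)) v) :
    SpDeriv y (mulL2 innerJ (rotC y (windC d)) v - (d : ℝ) • toL2 1) := by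
  have hc : PathDeriv (fun s : ℝ => s • ((d : ℝ) • (1 : C(Torus, ℝ)))) _ univ 0 :=
    pathDeriv_of_hasDerivAt univ (hasDerivAt_smul_const_zero ((d : ℝ) • (1 : C(Torus, ℝ))))
  have h1 : PathDeriv (fun s => shiftC s y + s • ((d : ℝ) • (1 : C(Torus, ℝ)))) _ univ 0 :=
    pathDeriv_of_rotC (y := fun s => shiftC s y + s • ((d : ℝ) • (1 : C(Torus, ℝ))))
      (g := windC d) (v := v)
      (ContinuousWithinAt.add (f := fun s => shiftC s y)
        (continuous_shiftC continuous_id continuous_const).continuousWithinAt hc.1)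
      (norm_windC d) (by simpa only [shiftC_rotC_windC] using h.pathDeriv)
  have h2 := h1.2.fun_sub hc.2
  simp only [shiftC_zero, zero_smul, add_zero, map_smul toL2 (d : ℝ)] at h2
  have h3 := hasDerivWithinAt_univ.1 h2
  refine h3.congr_of_eventuallyEq (Eventually.of_forall fun s => ?_)
  simp

/-- The state with position `e^{iy}` times the standard map of degree `d` and angular velocity
`a`. -/
def mkState (d : ℤ) {y : C(Torus, ℝ)} {y' : SqInt ℝ} (hy : SpDeriv y y') (a : SqInt ℝ) : State where
  pos := ⟨fun x => ⟨rotC y (windC d) x, mem_sphere_zero_iff_norm.2 (norm_rotC y (norm_windC d) x)⟩,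
    by fun_prop⟩
  posDeriv := mulL2 smulJ (rotC y (windC d)) (y' + (d : ℝ) • toL2 1)
  vel := mulL2 smulJ (rotC y (windC d)) a
  isWeakDeriv := (hy.rotC_windC d).isWeakDeriv
  tangent := by
    filter_upwards [coeFn_mulL2 smulJ (rotC y (windC d)) a] with x hx
    rw [hx]
    simp only [smulJ_apply, ContinuousMap.coe_mk, inner_smul_left, inner_J_self, mul_zero]

section mkState

variable (d : ℤ) {y : C(Torus, ℝ)} {y' : SqInt ℝ} (hy : SpDeriv y y') (a : SqInt ℝ)

lemma mkState_posC : (mkState d hy a).posC = rotC y (windC d) := rfl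

lemma mkState_angVel : (mkState d hy a).angVel = a :=
  mulL2_innerJ_smulJ (mkState d hy a).norm_posC a

lemma mkState_angStrain : (mkState d hy a).angStrain = y' + (d : ℝ) • toL2 1 :=
  mulL2_innerJ_smulJ (mkState d hy a).norm_posC _

end mkState

lemma State.eq_mkState {u : State} {d : ℤ} {y : C(Torus, ℝ)} {y' : SqInt ℝ} (hy : SpDeriv y y')
    (h : u.posC = rotC y (windC d)) : u = mkState d hy u.angVel := by
  refine State.eq_of h ?_
  conv_lhs => rw [u.vel_eq, h]
  rfl

/-! ### Wave maps from solutions of the linear equation -/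

/-- Derivatives have mean zero. Hence the constant strain d coming from the degree does not appear
in the weak equation. -/
lemma inner_one_eq_zero {m : C(Torus, ℝ)} {m' : SqInt ℝ} (hm : SpDeriv m m') :
    inner ℝ (toL2 (1 : C(Torus, ℝ))) m' = 0 := by
  have h := (spDeriv_const (1 : ℝ)).inner_eq_neg hm
  rw [inner_zero_left, zero_eq_neg] at h
  exact h

lemma inner_mulC_innerJ {p : C(Torus, Plane)} (a : SqInt ℝ) (Ψ : C(Torus, Plane)) :
    inner ℝ a (toL2 (mulC innerJ p Ψ)) = ∫ x, inner ℝ (mulL2 smulJ p a x) (Ψ x) := by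
  rw [inner_toL2_right]
  refine integral_congr_ae ?_
  filter_upwards [coeFn_mulL2 smulJ p a] with x hx
  rw [hx]
  simp [inner_smul_left, mul_comm]

lemma tangentProj_smul_J {p : Plane} (hp : ‖p‖ = 1) (c : ℝ) : tangentProj p (c • J p) = c • J p := by
  rw [tangentProj_eq hp]
  simp [inner_smul_right, hp]

lemma continuous_toL2_mulC {E F G : Type*} [NormedAddCommGroup E] [NormedSpace ℝ E]
    [NormedAddCommGroup F] [NormedSpace ℝ F] [NormedAddCommGroup G] [NormedSpace ℝ G]
    (B : E →L[ℝ] F →L[ℝ] G) {y : ℝ → C(Torus, E)} {z : ℝ → C(Torus, F)} (hy : Continuous y)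
    (hz : Continuous z) : Continuous fun s => toL2 (mulC B (y s) (z s)) :=
  continuousOn_univ.1 (ContinuousOn.toL2 (hy.continuousOn.mulC B hz.continuousOn))

section Test

variable {φ φt φx : ℝ × Torus → Plane}

/-- The restriction of a continuous function of time and space to a fixed time. -/
def sliceC (hφ : Continuous φ) (t : ℝ) : C(Torus, Plane) := ⟨fun x => φ (t, x), by fun_prop⟩

lemma continuous_sliceC (hφ : Continuous φ) : Continuous (sliceC hφ) :=
  ContinuousMap.continuous_of_continuous_uncurry _ hφ

lemma continuous_toL2_sliceC (hφ : Continuous φ) : Continuous fun t => toL2 (sliceC hφ t) :=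
  (toL2 (E := Plane)).continuous.comp (continuous_sliceC hφ)

lemma IsC1OnSpaceTime.pathDeriv (h : IsC1OnSpaceTime φ φt φx) (t : ℝ) :
    PathDeriv (sliceC h.continuous) (toL2 (sliceC h.continuous_time t)) univ t :=
  pathDeriv_of_hasDerivAt univ (hasDerivAt_of_pointwise (fun x s => h.hasDerivAt_time s x)
    (continuous_sliceC h.continuous_time) t)

lemma IsC1OnSpaceTime.c1Deriv (h : IsC1OnSpaceTime φ φt φx) (t : ℝ) :
    C1Deriv (sliceC h.continuous t) (sliceC h.continuous_space t) := h.hasDerivAt_space t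

end Test

/-- A solution of the linear wave equation gives a solution of the wave maps equation. -/
lemma IsLinSol.isSolution {θ : ℝ → C(Torus, ℝ)} {A B h : ℝ → SqInt ℝ} (H : IsLinSol θ A B h)
    {d : ℤ} {T : ℝ} {f : ℝ × Torus → Plane} {u : ℝ → State}
    (hu : ∀ t, (u t).posC = rotC (θ t) (windC d)) (hA : ∀ t, (u t).angVel = A t)
    (hf : ∀ t ∈ Icc 0 T, ∀ᵐ x, f (t, x) = mulL2 smulJ (rotC (θ t) (windC d)) (h t) x) :
    IsSolution T f (u 0) u := by
  have hB : ∀ t, (u t).angStrain = B t + (d : ℝ) • toL2 1 := fun t => by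
    rw [State.eq_mkState (H.spDeriv t) (hu t), mkState_angStrain]
  set p : ℝ → C(Torus, Plane) := fun t => rotC (θ t) (windC d) with hp
  have hn : ∀ t x, ‖p t x‖ = 1 := fun t => norm_rotC (θ t) (norm_windC d)
  have hθc : Continuous θ :=
    continuous_iff_continuousAt.2 fun t => continuousWithinAt_univ _ _ |>.1 (H.pathDeriv t).1
  have hpc : Continuous p := (continuous_rotC (windC d)).comp hθc
  have hv : ∀ t, (u t).vel = mulL2 smulJ (p t) (A t) := fun t => by rw [(u t).vel_eq, hA, hu]
  have hx : ∀ t, (u t).posDeriv = mulL2 smulJ (p t) (B t + (d : ℝ) • toL2 1) := fun t => by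
    rw [(u t).posDeriv_eq, hB, hu]
  have hpd : ∀ t, PathDeriv p (u t).vel univ t := fun t => by
    rw [hv]; exact (H.pathDeriv t).rotC (norm_windC d)
  have hsp : ∀ t, SpDeriv (p t) (u t).posDeriv := fun t => by
    have := (u t).spDeriv
    rwa [hu] at this
  have hvc : Continuous fun t => (u t).vel := by
    simp only [hv]
    exact continuous_mulL2 smulJ hpc H.continuous_time
  have hxc : Continuous fun t => (u t).posDeriv := by
    simp only [hx]
    exact continuous_mulL2 smulJ hpc (H.continuous_space.add continuous_const)
  have hL : (fun s => (u s).posL2) = fun s => toL2 (p s) := by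
    funext s
    have : (u s).posL2 = toL2 (u s).posC := rfl
    rw [this, hu]
  refine ⟨rfl, fun t _ => by rw [hL]; exact (hpd t).2.mono (subset_univ _), hxc.continuousOn, hvc.continuousOn, ?_⟩
  intro τ hτ φ φt φx hφ
  let Ψ := sliceC hφ.continuous
  let Ψt := sliceC hφ.continuous_time
  let Ψx := sliceC hφ.continuous_space
  have hΨc : Continuous Ψ := continuous_sliceC _
  -- Pairing with the frame turns the plane-valued test function into a scalar one for the linear
  -- equation; the weak identity is then the time integral of the derivative of -⟨A, m⟩.
  let m : ℝ → C(Torus, ℝ) := fun t => mulC innerJ (p t) (Ψ t)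
  let mt : ℝ → SqInt ℝ := fun t =>
    mulL2 innerJ (p t) (toL2 (Ψt t)) + mulL2 innerJ.flip (Ψ t) (u t).vel
  let mx : ℝ → SqInt ℝ := fun t =>
    mulL2 innerJ (p t) (toL2 (Ψx t)) + mulL2 innerJ.flip (Ψ t) (u t).posDeriv
  have hmt : ∀ t, PathDeriv m (mt t) univ t := fun t => (hpd t).mulC innerJ (hφ.pathDeriv t)
  have hmx : ∀ t, SpDeriv (m t) (mx t) := fun t =>
    (hsp t).mulC innerJ (hφ.c1Deriv t).spDeriv
  have hmc : Continuous fun t => toL2 (m t) := continuous_toL2_mulC innerJ hpc hΨc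
  have hmtc : Continuous mt :=
    (continuous_mulL2 innerJ hpc (continuous_toL2_sliceC hφ.continuous_time)).add
      (continuous_mulL2 innerJ.flip hΨc hvc)
  have hmxc : Continuous mx :=
    (continuous_mulL2 innerJ hpc (continuous_toL2_sliceC hφ.continuous_space)).add
      (continuous_mulL2 innerJ.flip hΨc hxc)
  let I : ℝ → ℝ := fun t =>
    inner ℝ (B t) (mx t) - inner ℝ (A t) (mt t) + inner ℝ (h t) (toL2 (m t))
  have hI : Continuous I := ((H.continuous_space.inner hmxc).sub
    (H.continuous_time.inner hmtc)).add (H.continuous_source.inner hmc)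
  have hd : ∀ t, HasDerivAt (fun s => -inner ℝ (A s) (toL2 (m s))) (I t) t := by
    intro t
    have h1 := hasDerivWithinAt_inner_of_continuous (S := univ)
      H.continuous_time.continuousWithinAt (hmt t).2 (H.equation _ _ (hmx t) t).hasDerivWithinAt
    refine (hasDerivWithinAt_univ.1 h1).fun_neg.congr_deriv ?_
    simp only [I]; ring
  have hint : ∀ t ∈ uIcc 0 τ, (∫ x : Torus,
        (inner ℝ ((u t).posDeriv x) (φx (t, x)) - inner ℝ ((u t).vel x) (φt (t, x))
          + (‖(u t).vel x‖ ^ 2 - ‖(u t).posDeriv x‖ ^ 2)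
              * inner ℝ ((u t).pos x : Plane) (φ (t, x))
          + inner ℝ (tangentProj ((u t).pos x : Plane) (f (t, x))) (φ (t, x)))) = I t := by
    intro t ht
    rw [uIcc_of_le hτ.1.le] at ht
    have hk : (fun x => inner ℝ (tangentProj ((u t).pos x : Plane) (f (t, x))) (Ψ t x))
        =ᵐ[volume] fun x => inner ℝ (h t x) (toL2 (m t) x) := by
      filter_upwards [hf t ⟨ht.1, ht.2.trans hτ.2⟩, coeFn_mulL2 smulJ (p t) (h t),
        coeFn_toL2 (m t)] with x h1 h2 h3
      rw [h1, h2, h3]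
      have e : ((u t).pos x : Plane) = p t x := DFunLike.congr_fun (hu t) x
      rw [e, smulJ_apply, tangentProj_smul_J (hn t x)]
      simp [m, inner_smul_left, mul_comm]
    have h2 := weak_integrand (u t) (Ψ t) (Ψt t) (Ψx t)
      ((L2.integrable_inner (𝕜 := ℝ) _ _).congr hk.symm)
    refine h2.trans ?_
    rw [integral_congr_ae hk, ← L2.inner_def, hA, hB, hu,
      inner_add_left, inner_smul_left]
    have h3 := inner_one_eq_zero (hmx t)
    change inner ℝ (B t) (mx t) + _ * inner ℝ (toL2 1) (mx t) - inner ℝ (A t) (mt t)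
      + inner ℝ (h t) (toL2 (m t)) = I t
    rw [h3, mul_zero, add_zero]
  rw [intervalIntegral.integral_congr hint, intervalIntegral.integral_eq_sub_of_hasDerivAt
    (fun t _ => hd t) (hI.intervalIntegrable _ _)]
  have e1 : ∀ t, inner ℝ (A t) (toL2 (m t)) = ∫ x, inner ℝ ((u t).vel x) (φ (t, x)) :=
    fun t => by rw [hv]; exact inner_mulC_innerJ (A t) (Ψ t)
  rw [← e1, ← e1]
  ring

end

section

/-! ### Steering the linear wave equation -/

lemma C1Deriv.eq_zero_of_notMem_tsupport {v v' : C(Torus, ℝ)} (h : C1Deriv v v') {x : Torus}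
    (hx : x ∉ tsupport v) : v' x = 0 := by
  induction x using QuotientAddGroup.induction_on with
  | H r =>
    have h1 : (v : Torus → ℝ) =ᶠ[𝓝 (r : Torus)] 0 := notMem_tsupport_iff_eventuallyEq.1 hx
    have h2 : (fun s : ℝ => v (s : Torus)) =ᶠ[𝓝 r] fun _ => 0 :=
      (AddCircle.continuous_mk' (2 * Real.pi)).continuousAt.eventually h1
    exact (h r).unique ((hasDerivAt_const r (0 : ℝ)).congr_of_eventuallyEq h2)

lemma notMem_tsupport_of_c1Deriv {v v' : C(Torus, ℝ)} (h : C1Deriv v v') {x : Torus}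
    (hx : x ∉ tsupport v) : x ∉ tsupport v' := fun h' =>
  hx (closure_minimal (fun y hy => by
    by_contra hn
    exact hy (h.eq_zero_of_notMem_tsupport hn)) (isClosed_tsupport v) h')

/-- A source of the linear wave equation: a continuous function, plus two square integrable
functions transported along the characteristics and modulated by continuous functions. -/
def source (C D₁ D₂ : ℝ → C(Torus, ℝ)) (w₁ w₂ : SqInt ℝ) (t : ℝ) : SqInt ℝ :=
  toL2 (C t) + mulL2 mulB (D₁ t) (shiftL (1 * t) w₁) + mulL2 mulB (D₂ t) (shiftL (-1 * t) w₂)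

/-- A cubic polynomial which vanishes at `0` and `T`. -/
lemma exists_cubic {T : ℝ} (hT : 0 < T) (μ₀ μ₁ : ℝ) : ∃ z z' z'' : ℝ → ℝ,
    (∀ t, HasDerivAt z (z' t) t) ∧ (∀ t, HasDerivAt z' (z'' t) t) ∧ Continuous z'' ∧
      z 0 = 0 ∧ z T = 0 ∧ z' 0 = μ₀ ∧ z' T = μ₁ := by
  refine ⟨fun t => μ₀ * t - ((2 * μ₀ + μ₁) / T) * t ^ 2 + ((μ₀ + μ₁) / T ^ 2) * t ^ 3,
    fun t => μ₀ - ((2 * μ₀ + μ₁) / T) * (2 * t) + ((μ₀ + μ₁) / T ^ 2) * (3 * t ^ 2),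
    fun t => - ((2 * μ₀ + μ₁) / T) * 2 + ((μ₀ + μ₁) / T ^ 2) * (6 * t), fun t => ?_, fun t => ?_,
    by fun_prop, by simp, by field_simp; ring, by simp, by field_simp; ring⟩
  · have h1 := (((hasDerivAt_id t).const_mul μ₀).sub
      ((hasDerivAt_pow 2 t).const_mul ((2 * μ₀ + μ₁) / T))).add
        ((hasDerivAt_pow 3 t).const_mul ((μ₀ + μ₁) / T ^ 2))
    exact h1.congr_deriv (by norm_num)
  · have h1 := ((hasDerivAt_const t μ₀).sub
      (((hasDerivAt_id t).const_mul 2).const_mul ((2 * μ₀ + μ₁) / T))).add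
        (((hasDerivAt_pow 2 t).const_mul 3).const_mul ((μ₀ + μ₁) / T ^ 2))
    exact h1.congr_deriv (by push_cast; ring)

/-- The localized control `ρ` reaches all the characteristics in the time `T`. -/
structure Controls (T : ℝ) (ρ ρ' ρ'' : C(Torus, ℝ)) : Prop where
  deriv : C1Deriv ρ ρ'
  deriv_deriv : C1Deriv ρ' ρ''
  mean_ne_zero : inner ℝ (toL2 ρ) (toL2 (1 : C(Torus, ℝ))) ≠ 0
  accum_left : ∀ x, 0 < accum 1 T ρ T x
  accum_right : ∀ x, 0 < accum (-1) T ρ T x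

lemma srcC_apply_eq_zero {e T : ℝ} {ρ ρ' q : C(Torus, ℝ)} {t : ℝ} {x : Torus} (h : ρ x = 0)
    (h' : ρ' x = 0) : srcC e T ρ ρ' q t x = 0 := by simp [srcC, h, h']

lemma srcD_apply_eq_zero {e T : ℝ} {ρ : C(Torus, ℝ)} {t : ℝ} {x : Torus} (h : ρ x = 0) :
    srcD e T ρ t x = 0 := by simp [srcD, h]

/-- The linear wave equation can be steered between any two states. -/
lemma Controls.exists_isLinSol {T : ℝ} {ρ ρ' ρ'' : C(Torus, ℝ)} (hT : 0 < T)
    (H : Controls T ρ ρ' ρ'') {a₀ a₁ : C(Torus, ℝ)} {a₀' a₁' : SqInt ℝ} (h₀ : SpDeriv a₀ a₀')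
    (h₁ : SpDeriv a₁ a₁') (b₀ b₁ : SqInt ℝ) :
    ∃ (C D₁ D₂ : ℝ → C(Torus, ℝ)) (w₁ w₂ : SqInt ℝ) (θ : ℝ → C(Torus, ℝ)) (A B : ℝ → SqInt ℝ),
      (Continuous C ∧ Continuous D₁ ∧ Continuous D₂) ∧
      (∀ t, ∀ x ∉ tsupport ρ, C t x = 0 ∧ D₁ t x = 0 ∧ D₂ t x = 0) ∧
      IsLinSol θ A B (source C D₁ D₂ w₁ w₂) ∧
      θ 0 = a₀ ∧ θ T = a₁ ∧ A 0 = b₀ ∧ A T = b₁ := by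
  -- Removing a multiple of ρ gives each velocity mean zero, hence a primitive.
  have hβ : ∀ b : SqInt ℝ, ∃ (μ : ℝ) (β : C(Torus, ℝ)), SpDeriv β (b - μ • toL2 ρ) := by
    intro b
    refine ⟨inner ℝ b (toL2 (1 : C(Torus, ℝ))) / inner ℝ (toL2 ρ) (toL2 (1 : C(Torus, ℝ))),
      exists_spDeriv_eq _ ?_⟩
    rw [inner_sub_left, inner_smul_left, conj_trivial, div_mul_cancel₀ _ H.mean_ne_zero, sub_self]
  obtain ⟨μ₀, β₀, hβ₀⟩ := hβ b₀
  obtain ⟨μ₁, β₁, hβ₁⟩ := hβ b₁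
  -- D'Alembert: (a + β)/2 travels with e = 1 and (a - β)/2 with e = -1. Positions add up to a,
  -- velocities to the derivative of β.
  obtain ⟨q₁, w₁, θ₁, A₁, B₁, L₁, x₁, y₁, v₁, r₁⟩ := exists_isLinSol_transport (e := 1) (by norm_num)
    H.deriv H.accum_left ((h₀.add hβ₀).const_smul (1 / 2)) ((h₁.add hβ₁).const_smul (1 / 2))
  obtain ⟨q₂, w₂, θ₂, A₂, B₂, L₂, x₂, y₂, v₂, r₂⟩ := exists_isLinSol_transport (e := -1) (by norm_num)
    H.deriv H.accum_right ((h₀.sub hβ₀).const_smul (1 / 2)) ((h₁.sub hβ₁).const_smul (1 / 2))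
  -- The cubic puts back the removed velocities μ₀ρ and μ₁ρ without changing the end positions.
  obtain ⟨z, z', z'', hz, hz', hzc, hz0, hzT, hz0', hzT'⟩ := exists_cubic hT μ₀ μ₁
  have L₃ := isLinSol_smul H.deriv H.deriv_deriv hz hz' hzc
  have hcz : Continuous z := continuous_iff_continuousAt.2 fun t => (hz t).continuousAt
  refine ⟨fun t => srcC 1 T ρ ρ' q₁ t + srcC (-1) T ρ ρ' q₂ t + (z t • ρ'' - z'' t • ρ),
    srcD 1 T ρ, srcD (-1) T ρ, w₁, w₂, fun t => θ₁ t + θ₂ t + z t • ρ,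
    fun t => A₁ t + A₂ t + z' t • toL2 ρ, fun t => B₁ t + B₂ t + z t • toL2 ρ', ⟨?_, continuous_srcD _ _ _, continuous_srcD _ _ _⟩,
    fun t x hx => ?_, ?_, ?_, ?_, ?_, ?_⟩
  rotate_left 2
  · have h := (L₁.add L₂).add L₃
    have e : source (fun t => srcC 1 T ρ ρ' q₁ t + srcC (-1) T ρ ρ' q₂ t + (z t • ρ'' - z'' t • ρ))
        (srcD 1 T ρ) (srcD (-1) T ρ) w₁ w₂ = fun t =>
        (toL2 (srcC 1 T ρ ρ' q₁ t) + mulL2 mulB (srcD 1 T ρ t) (shiftL (1 * t) w₁)) +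
        (toL2 (srcC (-1) T ρ ρ' q₂ t) + mulL2 mulB (srcD (-1) T ρ t) (shiftL (-1 * t) w₂)) +
        toL2 (z t • ρ'' - z'' t • ρ) := by
      funext t
      rw [source, map_add toL2 (_ + _), map_add toL2 (srcC _ _ _ _ _ _)]
      abel
    rw [e]
    exact h
  · simp only [x₁, x₂, hz0]; module
  · simp only [y₁, y₂, hzT]; module
  · simp only [v₁, v₂, hz0']; module
  · simp only [r₁, r₂, hzT']; module
  · exact ((continuous_srcC _ _ _ _ _).add (continuous_srcC _ _ _ _ _)).add
      ((hcz.smul continuous_const).sub (hzc.smul continuous_const))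
  · have e0 : ρ x = 0 := image_eq_zero_of_notMem_tsupport hx
    have hx' := notMem_tsupport_of_c1Deriv H.deriv hx
    have e1 : ρ' x = 0 := image_eq_zero_of_notMem_tsupport hx'
    have e2 : ρ'' x = 0 := H.deriv_deriv.eq_zero_of_notMem_tsupport hx'
    simp [srcC_apply_eq_zero, srcD_apply_eq_zero, e0, e1, e2]

/-! ### The control -/

/-- The shear (t, x) ↦ (t, x + et) preserves measure, and the continuous factor is bounded on the
compact time slab. -/
lemma memLp_transported {w : Torus → ℝ} (hw : StronglyMeasurable w) (hw' : MemLp w 2 volume)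
    (e T : ℝ) {k : ℝ → C(Torus, Plane)} (hk : Continuous k) :
    MemLp ((Icc 0 T ×ˢ (univ : Set Torus)).indicator
      fun p : ℝ × Torus => w (p.2 + ((e * p.1 : ℝ) : Torus)) • k p.1 p.2) 2 volume := by
  rw [memLp_indicator_iff_restrict (measurableSet_Icc.prod MeasurableSet.univ),
    Measure.volume_eq_prod, ← Measure.prod_restrict, Measure.restrict_univ]
  have hs : Measurable fun p : ℝ × Torus => p.2 + ((e * p.1 : ℝ) : Torus) := by
    refine Continuous.measurable ?_
    have : Continuous fun p : ℝ × Torus => ((e * p.1 : ℝ) : Torus) :=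
      (AddCircle.continuous_mk' (2 * Real.pi)).comp (by fun_prop)
    exact continuous_snd.add this
  have hmp : MeasurePreserving (fun p : ℝ × Torus => (p.1, p.2 + ((e * p.1 : ℝ) : Torus)))
      ((volume.restrict (Icc 0 T)).prod volume) ((volume.restrict (Icc 0 T)).prod volume) :=
    (MeasurePreserving.id _).skew_product (g := fun t x => x + ((e * t : ℝ) : Torus)) hs
      (Eventually.of_forall fun t => (measurePreserving_shift (e * t)).map_eq)
  have h1 : MemLp (fun p : ℝ × Torus => w (p.2 + ((e * p.1 : ℝ) : Torus))) 2
      ((volume.restrict (Icc 0 T)).prod volume) :=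
    (hw'.comp_snd (volume.restrict (Icc 0 T))).comp_measurePreserving hmp
  have hkc : Continuous fun p : ℝ × Torus => k p.1 p.2 := by fun_prop
  obtain ⟨M, hM⟩ := (isCompact_Icc (a := (0 : ℝ)) (b := T)).prod
    (isCompact_univ (X := Torus)) |>.exists_bound_of_continuousOn hkc.continuousOn
  refine MemLp.of_le_mul (c := M) h1 ?_ ?_
  · exact ((hw.comp_measurable hs).smul hkc.stronglyMeasurable).aestronglyMeasurable
  · have hae : ∀ᵐ p : ℝ × Torus ∂((volume.restrict (Icc 0 T)).prod volume), p ∈ Icc 0 T ×ˢ univ := by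
      have := ae_restrict_mem (μ := (volume : Measure (ℝ × Torus)))
        ((measurableSet_Icc (a := (0 : ℝ)) (b := T)).prod (MeasurableSet.univ (α := Torus)))
      rwa [Measure.volume_eq_prod, ← Measure.prod_restrict, Measure.restrict_univ] at this
    filter_upwards [hae] with p hp
    rw [norm_smul, mul_comm]
    exact mul_le_mul_of_nonneg_right (hM p hp) (norm_nonneg _)

/-- The control with a given angular source. -/
def control (T : ℝ) (C D₁ D₂ : ℝ → C(Torus, ℝ)) (w₁ w₂ : SqInt ℝ) (p : ℝ → C(Torus, Plane)) :
    ℝ × Torus → Plane :=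
  (Icc 0 T ×ˢ (univ : Set Torus)).indicator fun q =>
    (C q.1 q.2 + D₁ q.1 q.2 * w₁ (q.2 + ((1 * q.1 : ℝ) : Torus))
      + D₂ q.1 q.2 * w₂ (q.2 + ((-1 * q.1 : ℝ) : Torus))) • J (p q.1 q.2)

section control

variable {T : ℝ} {C D₁ D₂ : ℝ → C(Torus, ℝ)} {w₁ w₂ : SqInt ℝ} {p : ℝ → C(Torus, Plane)}

lemma continuous_mulC_comp {E F G : Type*} [NormedAddCommGroup E] [NormedSpace ℝ E]
    [NormedAddCommGroup F] [NormedSpace ℝ F] [NormedAddCommGroup G] [NormedSpace ℝ G]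
    (B : E →L[ℝ] F →L[ℝ] G) {y : ℝ → C(Torus, E)} {z : ℝ → C(Torus, F)} (hy : Continuous y)
    (hz : Continuous z) : Continuous fun s => mulC B (y s) (z s) :=
  continuousOn_univ.1 (hy.continuousOn.mulC B hz.continuousOn)

/-- The coefficients vanish at every point off K, not just almost everywhere, so the closed support
is under control whatever representatives of w₁, w₂ are taken. -/
lemma isControl_control {ω K : Set Torus} (hK : IsClosed K) (hKω : K ⊆ ω) (hC : Continuous C)
    (hD₁ : Continuous D₁) (hD₂ : Continuous D₂) (hp : Continuous p)
    (h0 : ∀ t, ∀ x ∉ K, C t x = 0 ∧ D₁ t x = 0 ∧ D₂ t x = 0) :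
    IsControl ω T (control T C D₁ D₂ w₁ w₂ p) where
  memLp := by
    have h1 := memLp_transported (w := fun _ => 1) stronglyMeasurable_const
      (memLp_const (1 : ℝ)) 0 T (continuous_mulC_comp smulJ hp hC)
    have h2 := memLp_transported (Lp.stronglyMeasurable w₁) (Lp.memLp w₁) 1 T
      (continuous_mulC_comp smulJ hp hD₁)
    have h3 := memLp_transported (Lp.stronglyMeasurable w₂) (Lp.memLp w₂) (-1) T
      (continuous_mulC_comp smulJ hp hD₂)
    have h4 := (h1.add h2).add h3
    rw [← indicator_add', ← indicator_add'] at h4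
    refine h4.ae_eq (Eventually.of_forall fun q => ?_)
    refine congrFun (congrArg _ ?_) q
    funext q
    simp only [Pi.add_apply, mulC_apply, smulJ_apply]
    module
  support_subset := by
    refine (closure_minimal ?_ (isClosed_Icc.prod hK)).trans (prod_mono_right hKω)
    intro q hq
    have hq1 := indicator_apply_ne_zero.1 hq
    refine ⟨hq1.1.1, ?_⟩
    by_contra hn
    obtain ⟨e0, e1, e2⟩ := h0 q.1 q.2 hn
    exact hq1.2 (by simp [e0, e1, e2])

lemma control_slice {t : ℝ} (ht : t ∈ Icc 0 T) :
    ∀ᵐ x, control T C D₁ D₂ w₁ w₂ p (t, x) = mulL2 smulJ (p t) (source C D₁ D₂ w₁ w₂ t) x := by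
  filter_upwards [coeFn_mulL2 smulJ (p t) (source C D₁ D₂ w₁ w₂ t),
    Lp.coeFn_add (toL2 (C t) + mulL2 mulB (D₁ t) (shiftL (1 * t) w₁))
      (mulL2 mulB (D₂ t) (shiftL (-1 * t) w₂)),
    Lp.coeFn_add (toL2 (C t)) (mulL2 mulB (D₁ t) (shiftL (1 * t) w₁)), coeFn_toL2 (C t),
    coeFn_mulL2 mulB (D₁ t) (shiftL (1 * t) w₁), coeFn_mulL2 mulB (D₂ t) (shiftL (-1 * t) w₂),
    coeFn_shiftL (1 * t) w₁, coeFn_shiftL (-1 * t) w₂] with x h1 h2 h3 h4 h5 h6 h7 h8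
  rw [h1, source, h2, Pi.add_apply, h3, Pi.add_apply, h4, h5, h6, h7, h8, control,
    indicator_of_mem (show (t, x) ∈ Icc 0 T ×ˢ univ from ⟨ht, mem_univ x⟩)]
  simp

end control

lemma IsLinSol.continuous_rotC {θ : ℝ → C(Torus, ℝ)} {A B h : ℝ → SqInt ℝ} (H : IsLinSol θ A B h)
    (g : C(Torus, Plane)) : Continuous fun t => rotC (θ t) g :=
  (WaveMaps.continuous_rotC g).comp
    (continuous_iff_continuousAt.2 fun t => continuousWithinAt_univ _ _ |>.1 (H.pathDeriv t).1)

/-- Two states with lifts of finite energy can be steered to each other. -/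
lemma Controls.steerable {ω : Set Torus} {T : ℝ} {ρ ρ' ρ'' : C(Torus, ℝ)} (hT : 0 < T)
    (H : Controls T ρ ρ' ρ'') (hρ : tsupport ρ ⊆ ω) {u₀ u₁ : State} {d : ℤ} {a₀ a₁ : C(Torus, ℝ)}
    (h₀ : u₀.posC = rotC a₀ (windC d)) (h₁ : u₁.posC = rotC a₁ (windC d)) :
    Steerable ω T u₀ u₁ := by
  have s₀ := u₀.spDeriv
  rw [h₀] at s₀
  have s₁ := u₁.spDeriv
  rw [h₁] at s₁
  obtain ⟨C, D₁, D₂, w₁, w₂, θ, A, B, ⟨hC, hD₁, hD₂⟩, h0, L, e0, e1, e2, e3⟩ :=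
    H.exists_isLinSol hT (spDeriv_of_rotC_windC s₀) (spDeriv_of_rotC_windC s₁) u₀.angVel u₁.angVel
  have hpc := L.continuous_rotC (windC d)
  have hF : ContinuousOn (fun t => mulL2 smulJ (rotC (θ t) (windC d)) (source C D₁ D₂ w₁ w₂ t))
      (Icc 0 T) := hpc.continuousOn.mulL2 smulJ L.continuous_source.continuousOn
  set f := control T C D₁ D₂ w₁ w₂ fun t => rotC (θ t) (windC d) with hf
  have hs : ∀ t ∈ Icc 0 T, ∀ᵐ x, f (t, x) = mulL2 smulJ (rotC (θ t) (windC d))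
      (source C D₁ D₂ w₁ w₂ t) x := fun t ht =>
    control_slice (p := fun t => rotC (θ t) (windC d)) ht
  set u : ℝ → State := fun t => mkState d (L.spDeriv t) (A t) with hu
  have hsol : IsSolution T f (u 0) u := L.isSolution (fun t => mkState_posC d _ _)
    (fun t => mkState_angVel d _ _) hs
  have hu0 : u 0 = u₀ := by
    have h := State.eq_mkState (u := u₀) (L.spDeriv 0) (by rw [h₀, e0])
    rw [h, ← e2]
  have huT : u T = u₁ := by
    have h := State.eq_mkState (u := u₁) (L.spDeriv T) (by rw [h₁, e1])
    rw [h, ← e3]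
  rw [hu0] at hsol
  refine ⟨f, isControl_control (isClosed_tsupport ρ) hρ hC hD₁ hD₂ hpc h0, u, hsol, huT,
    fun v hv => ?_⟩
  -- The source depends continuously on time in L²; this regularity of the chosen control yields
  -- uniqueness among all weak solutions.
  exact hsol.eqOn hv hF fun t ht => (hs t ht).mono fun x hx => hx.symm

end

section

/-! ### Homotopy classes -/

/-- The identification of the target with the unit circle of the complex plane. -/
def toCircle : C(Target, Circle) where
  toFun p := ⟨⟨(p : Plane) 0, (p : Plane) 1⟩, by
    have h := plane_norm_sq (p : Plane)
    rw [mem_sphere_zero_iff_norm.1 p.2] at h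
    rw [Submonoid.unitSphere, Submonoid.mem_mk, Subsemigroup.mem_mk, mem_sphere_zero_iff_norm,
      ← sq_eq_sq₀ (norm_nonneg _) zero_le_one, Complex.sq_norm, Complex.normSq_mk, h]
    ring⟩
  continuous_toFun := by
    refine Continuous.subtype_mk ?_ _
    have h : Continuous fun p : Target => (((p : Plane) 0 : ℝ) : ℂ) + ((p : Plane) 1 : ℝ) * Complex.I := by
      fun_prop
    refine h.congr fun p => ?_
    apply Complex.ext <;> simp

lemma coe_toCircle (p : Target) : (toCircle p : ℂ) = ⟨(p : Plane) 0, (p : Plane) 1⟩ := rfl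

lemma eq_rot_of_toCircle {p q : Target} {α : ℝ} (h : toCircle q = Circle.exp α * toCircle p) :
    (q : Plane) = rot α p := by
  have h1 : (⟨(q : Plane) 0, (q : Plane) 1⟩ : ℂ)
      = Complex.exp (α * Complex.I) * ⟨(p : Plane) 0, (p : Plane) 1⟩ := by
    have := congrArg (fun z : Circle => (z : ℂ)) h
    simpa only [Circle.coe_mul, Circle.coe_exp, coe_toCircle] using this
  have h2 := congrArg Complex.re h1
  have h3 := congrArg Complex.im h1
  simp only [Complex.mul_re, Complex.mul_im, Complex.exp_ofReal_mul_I_re,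
    Complex.exp_ofReal_mul_I_im] at h2 h3
  ext i
  fin_cases i
  · simp [rot, h2]; ring
  · simp [rot, h3]

lemma homotopic_of_eq_rot {p q : C(Torus, Target)} (y : C(Torus, ℝ))
    (h : ∀ x, (q x : Plane) = rot (y x) (p x)) : ContinuousMap.Homotopic p q := by
  refine ⟨⟨⟨fun z => ⟨rot (z.1 * y z.2) (p z.2), ?_⟩, ?_⟩, fun x => ?_, fun x => ?_⟩⟩
  · rw [mem_sphere_zero_iff_norm, norm_rot]
    exact mem_sphere_zero_iff_norm.1 (p z.2).2
  · refine Continuous.subtype_mk ?_ _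
    unfold rot
    fun_prop
  · apply Subtype.ext; simp
  · apply Subtype.ext; simp [h]

/-- The quotient of the homotopy by its initial map starts at the constant 1, so it lifts through
the exponential from the zero function; the end of the lift is the angle. -/
lemma exists_eq_rot_of_homotopic {p q : C(Torus, Target)} (h : ContinuousMap.Homotopic p q) :
    ∃ y : C(Torus, ℝ), ∀ x, (q x : Plane) = rot (y x) (p x) := by
  obtain ⟨H⟩ := h
  let K : C(unitInterval × Torus, Circle) :=
    ⟨fun z => toCircle (H z) / toCircle (p z.2), by fun_prop⟩
  have h0 : ∀ x, K (0, x) = Circle.exp ((0 : C(Torus, ℝ)) x) := fun x => by simp [K]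
  let L := Circle.isCoveringMap_exp.liftHomotopy K 0 h0
  refine ⟨⟨fun x => L (1, x), by fun_prop⟩, fun x => eq_rot_of_toCircle ?_⟩
  have h1 : Circle.exp (L (1, x)) = K (1, x) :=
    congrFun (Circle.isCoveringMap_exp.liftHomotopy_lifts K 0 h0) (1, x)
  change toCircle (q x) = Circle.exp (L (1, x)) * toCircle (p x)
  rw [h1]
  simp [K]

/-- Every map from the circle to the circle is a rotation of a standard map. -/
lemma exists_eq_rot_windC (g : C(Torus, Target)) :
    ∃ (d : ℤ) (y : C(Torus, ℝ)), ∀ x, (g x : Plane) = rot (y x) (windC d x) := by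
  let f : C(ℝ, Circle) := ⟨fun r => toCircle (g (r : Torus)), by
    have := AddCircle.continuous_mk' (2 * Real.pi)
    exact toCircle.continuous.comp (g.continuous.comp this)⟩
  obtain ⟨G, ⟨-, hG⟩, -⟩ := Circle.isCoveringMap_exp.existsUnique_continuousMap_lifts f 0
    (Complex.arg (f 0)) (Circle.exp_arg (f 0))
  have hG : ∀ r, Circle.exp (G r) = f r := fun r => congrFun hG r
  have hf : ∀ r, f (r + 2 * Real.pi) = f r := fun r => by
    have : ((r + 2 * Real.pi : ℝ) : Torus) = (r : Torus) := AddCircle.coe_add_period _ r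
    change toCircle (g ((r + 2 * Real.pi : ℝ) : Torus)) = toCircle (g (r : Torus))
    rw [this]
  obtain ⟨d, hd⟩ : ∃ d : ℤ, G (2 * Real.pi) = G 0 + d * (2 * Real.pi) := by
    have : Circle.exp (G (2 * Real.pi)) = Circle.exp (G 0) := by
      rw [hG, hG, ← hf 0, zero_add]
    exact Circle.exp_eq_exp.1 this
  -- Both sides lift the same path and agree at 0. Hence G(r) - dr is periodic and descends to the
  -- torus.
  have hper : ∀ r, G (r + 2 * Real.pi) = G r + d * (2 * Real.pi) := by
    have h1 := Circle.isCoveringMap_exp.eq_of_comp_eq (g₁ := fun r => G (r + 2 * Real.pi))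
      (g₂ := fun r => G r + d * (2 * Real.pi)) (by fun_prop) (by fun_prop) (by
        funext r
        have h2 : Circle.exp (G r + d * (2 * Real.pi)) = Circle.exp (G r) :=
          Circle.exp_eq_exp.2 ⟨d, rfl⟩
        simp only [Function.comp_apply]
        rw [h2, hG, hG, hf]) 0 (by simpa using hd)
    exact fun r => congrFun h1 r
  have hp : Function.Periodic (fun r => G r - d * r) (2 * Real.pi) := fun r => by
    simp only [hper]; ring
  let y : C(Torus, ℝ) := ⟨hp.lift, continuous_coinduced_dom.2 (by
    change Continuous fun r => G r - d * r
    fun_prop)⟩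
  refine ⟨d, y, fun x => ?_⟩
  induction x using QuotientAddGroup.induction_on with
  | H r =>
    have hw := windC_coe d r
    have hy : y (r : Torus) = G r - d * r := rfl
    let e : Target := ⟨!₂[1, 0], by rw [mem_sphere_zero_iff_norm, EuclideanSpace.norm_eq]; simp⟩
    have he : toCircle e = 1 := by
      apply Circle.ext
      rw [coe_toCircle]
      apply Complex.ext <;> simp [e]
    have h1 := eq_rot_of_toCircle (p := e) (q := g (r : Torus)) (α := G r) (by
      rw [he, mul_one, hG]; rfl)
    rw [hw, hy, ← rot_add, sub_add_cancel]
    exact h1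

lemma exists_lifts_of_homotopic {u₀ u₁ : State} (h : ContinuousMap.Homotopic u₀.pos u₁.pos) :
    ∃ (d : ℤ) (a₀ a₁ : C(Torus, ℝ)), u₀.posC = rotC a₀ (windC d) ∧ u₁.posC = rotC a₁ (windC d) := by
  obtain ⟨d, a₀, h₀⟩ := exists_eq_rot_windC u₀.pos
  obtain ⟨y, hy⟩ := exists_eq_rot_of_homotopic h
  have e₀ : u₀.posC = rotC a₀ (windC d) := by ext1 x; exact h₀ x
  refine ⟨d, a₀, y + a₀, e₀, ?_⟩
  rw [← rotC_rotC, ← e₀]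
  ext1 x
  exact hy x

end

section

/-! ### Smooth functions on the circle -/

/-- The function on the circle induced by a periodic function. -/
def periodicLift {σ : ℝ → ℝ} (hσ : Function.Periodic σ (2 * Real.pi)) (hc : Continuous σ) :
    C(Torus, ℝ) := ⟨hσ.lift, continuous_coinduced_dom.2 hc⟩

/-- Pull back from the complex plane a smooth function whose support is an open set meeting the unit
circle exactly in `O`. Two derivatives are kept because the separated term brings ρ'' into the
source. -/
lemma exists_c1Deriv_support_eq {O : Set Torus} (hO : IsOpen O) :
    ∃ ρ ρ' ρ'' : C(Torus, ℝ), C1Deriv ρ ρ' ∧ C1Deriv ρ' ρ'' ∧ (∀ x, 0 ≤ ρ x) ∧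
      Function.support ρ = O := by
  have hinj : Function.Injective fun x : Torus => (AddCircle.toCircle x : ℂ) :=
    Subtype.val_injective.comp (AddCircle.injective_toCircle Real.two_pi_pos.ne')
  have hcont : Continuous fun x : Torus => (AddCircle.toCircle x : ℂ) :=
    continuous_subtype_val.comp AddCircle.continuous_toCircle
  have hU : IsOpen ((fun x : Torus => (AddCircle.toCircle x : ℂ)) '' Oᶜ)ᶜ :=
    (hO.isClosed_compl.isCompact.image hcont).isClosed.isOpen_compl
  obtain ⟨χ, hχ, hχd, hχ0⟩ := hU.exists_contDiff_support_eq (n := 2)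
  let σ : ℝ → ℝ := fun r => χ (Complex.exp (r * Complex.I))
  have hσ : ContDiff ℝ 2 σ := by
    refine hχd.comp ?_
    exact (Complex.contDiff_exp.comp (Complex.ofRealCLM.contDiff.mul contDiff_const))
  have hσd : ContDiff ℝ 1 (deriv σ) := ContDiff.deriv' hσ
  have hσdd : Continuous (deriv (deriv σ)) := hσd.continuous_deriv le_rfl
  have hper : Function.Periodic σ (2 * Real.pi) := fun r => by
    simp only [σ]
    congr 1
    push_cast
    rw [add_mul, Complex.exp_periodic]
  have hderiv : ∀ τ : ℝ → ℝ, Function.Periodic τ (2 * Real.pi) →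
      Function.Periodic (deriv τ) (2 * Real.pi) := fun τ hτ r => by
    rw [← deriv_comp_add_const]
    congr 1
    funext s
    exact hτ s
  refine ⟨periodicLift hper hσ.continuous, periodicLift (hderiv _ hper) hσd.continuous,
    periodicLift (hderiv _ (hderiv _ hper)) hσdd, fun s => ?_, fun s => ?_, fun x => ?_, ?_⟩
  · exact (hσ.differentiable (by norm_num) s).hasDerivAt
  · exact (hσd.differentiable (by norm_num) s).hasDerivAt
  · induction x using QuotientAddGroup.induction_on with
    | H r => exact (hχ0 (mem_range_self (Complex.exp (r * Complex.I)))).1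
  · ext x
    induction x using QuotientAddGroup.induction_on with
    | H r =>
      have e : Complex.exp (r * Complex.I) = (AddCircle.toCircle (r : Torus) : ℂ) := by
        rw [AddCircle.toCircle_apply_mk, Circle.coe_exp]
        congr 2
        have := Real.pi_ne_zero
        push_cast
        field_simp
      have h1 : periodicLift hper hσ.continuous (r : Torus) = χ (AddCircle.toCircle (r : Torus)) := by
        rw [← e]; rfl
      rw [Function.mem_support]
      change periodicLift hper hσ.continuous (r : Torus) ≠ 0 ↔ _
      rw [h1, ← Function.mem_support, hχ, mem_compl_iff, hinj.mem_set_image, notMem_compl_iff]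

lemma inner_one_pos {m : C(Torus, ℝ)} (hm : ∀ x, 0 ≤ m x) {x : Torus} (hx : m x ≠ 0) :
    0 < inner ℝ (toL2 m) (toL2 (1 : C(Torus, ℝ))) := by
  rw [inner_toL2]
  simp only [ContinuousMap.one_apply, RCLike.inner_apply, conj_trivial, one_mul]
  exact m.continuous.integral_pos_of_hasCompactSupport_nonneg_nonzero
    (HasCompactSupport.of_compactSpace _) hm hx

/-! ### The critical time -/

section hittingTime

variable {ω : Set Torus}

lemma bddBelow_hitting (x : Torus) : BddBelow {α : ℝ | 0 ≤ α ∧ x + (α : Torus) ∈ ω} :=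
  ⟨0, fun _ h => h.1⟩

lemma exists_hitting (hne : ω.Nonempty) (x : Torus) :
    ∃ α ∈ {α : ℝ | 0 ≤ α ∧ x + (α : Torus) ∈ ω}, α < 2 * Real.pi := by
  obtain ⟨w, hw⟩ := hne
  have h : w - x ∈ ((↑) : ℝ → Torus) '' Ico 0 (0 + 2 * Real.pi) := by
    rw [AddCircle.coe_image_Ico_eq]; trivial
  obtain ⟨α, hα, h⟩ := h
  exact ⟨α, ⟨hα.1, by rwa [h, add_sub_cancel]⟩, by simpa using hα.2⟩

lemma hittingTime_nonneg (hne : ω.Nonempty) (x : Torus) : 0 ≤ hittingTime ω x := by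
  obtain ⟨α, hα, -⟩ := exists_hitting hne x
  exact le_csInf ⟨α, hα⟩ fun _ h => h.1

lemma hittingTime_le {x : Torus} {α : ℝ} (h : 0 ≤ α) (hx : x + (α : Torus) ∈ ω) :
    hittingTime ω x ≤ α := csInf_le (bddBelow_hitting x) ⟨h, hx⟩

lemma exists_of_hittingTime_lt (hne : ω.Nonempty) {x : Torus} {c : ℝ} (h : hittingTime ω x < c) :
    ∃ α, 0 ≤ α ∧ α < c ∧ x + (α : Torus) ∈ ω := by
  obtain ⟨α, hα, -⟩ := exists_hitting hne x
  obtain ⟨β, hβ, hc⟩ := exists_lt_of_csInf_lt ⟨α, hα⟩ h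
  exact ⟨β, hβ.1, hc, hβ.2⟩

/-- A time at which `x` lies in the open set ω also works for nearby points. On the compact torus
this makes the maximum attained. -/
lemma upperSemicontinuous_hittingTime (hω : IsOpen ω) (hne : ω.Nonempty) :
    UpperSemicontinuous (hittingTime ω) := by
  intro x c hc
  obtain ⟨α, h0, hα, hx⟩ := exists_of_hittingTime_lt hne hc
  have hcont : Continuous fun y : Torus => y + (α : Torus) := by fun_prop
  filter_upwards [hcont.continuousAt.preimage_mem_nhds (hω.mem_nhds hx)] with y hy
  exact (hittingTime_le h0 hy).trans_lt hα

lemma isGreatest_criticalTime (hω : IsOpen ω) (hne : ω.Nonempty) :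
    IsGreatest (range (hittingTime ω)) (criticalTime ω) := by
  obtain ⟨x, -, hx⟩ := UpperSemicontinuousOn.exists_isMaxOn univ_nonempty isCompact_univ
    ((upperSemicontinuous_hittingTime hω hne).upperSemicontinuousOn univ)
  have h : IsGreatest (range (hittingTime ω)) (hittingTime ω x) :=
    ⟨mem_range_self x, by rintro _ ⟨y, rfl⟩; exact hx (mem_univ y)⟩
  rwa [criticalTime, iSup, h.csSup_eq]

lemma criticalTime_le (hω : IsOpen ω) (hne : ω.Nonempty) : criticalTime ω ≤ 2 * Real.pi := by
  obtain ⟨x, hx⟩ := (isGreatest_criticalTime hω hne).1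
  obtain ⟨α, hα, h⟩ := exists_hitting hne x
  rw [← hx]
  exact (hittingTime_le hα.1 hα.2).trans h.le

lemma criticalTime_nonneg (hω : IsOpen ω) (hne : ω.Nonempty) : 0 ≤ criticalTime ω := by
  obtain ⟨x, hx⟩ := (isGreatest_criticalTime hω hne).1
  rw [← hx]
  exact hittingTime_nonneg hne x

lemma continuous_add_coe (x : Torus) (e : ℝ) : Continuous fun s : ℝ => x + ((e * s : ℝ) : Torus) := by
  have : Continuous fun s : ℝ => ((e * s : ℝ) : Torus) :=
    (AddCircle.continuous_mk' (2 * Real.pi)).comp (by fun_prop)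
  exact continuous_const.add this

lemma exists_hitting_forward (hω : IsOpen ω) (hne : ω.Nonempty) {T : ℝ} (hT : criticalTime ω < T)
    (x : Torus) : ∃ s ∈ Ioo 0 T, x + ((1 * s : ℝ) : Torus) ∈ ω := by
  have h1 : hittingTime ω x ≤ criticalTime ω :=
    (isGreatest_criticalTime hω hne).2 (mem_range_self x)
  obtain ⟨α, h0, hα, hx⟩ := exists_of_hittingTime_lt hne (h1.trans_lt hT)
  -- The time is pushed slightly past α to be strictly positive, since the weight s(T - s) vanishes
  -- at 0.
  have hU : ∀ᶠ s in 𝓝[>] α, x + ((1 * s : ℝ) : Torus) ∈ ω :=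
    nhdsWithin_le_nhds ((continuous_add_coe x 1).continuousAt.preimage_mem_nhds
      (hω.mem_nhds (by rwa [one_mul])))
  obtain ⟨s, hs, hsα, hsT⟩ := (hU.and (Ioo_mem_nhdsGT hα)).exists
  exact ⟨s, ⟨h0.trans_lt hsα, hsT⟩, hs⟩

/-- The backward path from x over a time T is the forward path from x - T, reversed. -/
lemma exists_hitting_backward (hω : IsOpen ω) (hne : ω.Nonempty) {T : ℝ} (hT : criticalTime ω < T)
    (x : Torus) : ∃ s ∈ Ioo 0 T, x + ((-1 * s : ℝ) : Torus) ∈ ω := by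
  obtain ⟨s, hs, hx⟩ := exists_hitting_forward hω hne hT (x - (T : Torus))
  refine ⟨T - s, ⟨by linarith [hs.2], by linarith [hs.1]⟩, ?_⟩
  convert hx using 1
  have : (-1 * (T - s) : ℝ) = 1 * s - T := by ring
  rw [this, AddCircle.coe_sub]
  abel

/-- By compactness of the torus finitely many compact pieces of ω suffice. This leaves room for the
closed support of ρ inside ω. -/
lemma exists_isCompact_hitting (hω : IsOpen ω) {T e : ℝ}
    (h : ∀ x : Torus, ∃ s ∈ Ioo 0 T, x + ((e * s : ℝ) : Torus) ∈ ω) :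
    ∃ K ⊆ ω, IsCompact K ∧ ∀ x : Torus, ∃ s ∈ Ioo 0 T, x + ((e * s : ℝ) : Torus) ∈ K := by
  choose s hs hsω using h
  have hL : ∀ x, ∃ L : Set Torus, IsCompact L ∧ L ⊆ ω ∧ x + ((e * s x : ℝ) : Torus) ∈ interior L :=
    fun x => by
      obtain ⟨L, h1, h2, h3⟩ := exists_compact_subset hω (hsω x)
      exact ⟨L, h1, h3, h2⟩
  choose L hLc hLω hLi using hL
  obtain ⟨t, ht⟩ := CompactSpace.elim_nhds_subcover
    (fun x => (fun y : Torus => y + ((e * s x : ℝ) : Torus)) ⁻¹' interior (L x)) fun x =>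
      (by fun_prop : Continuous fun y : Torus => y + ((e * s x : ℝ) : Torus)).continuousAt
        |>.preimage_mem_nhds (isOpen_interior.mem_nhds (hLi x))
  refine ⟨⋃ x ∈ t, L x, iUnion₂_subset fun x _ => hLω x, t.isCompact_biUnion fun x _ => hLc x,
    fun y => ?_⟩
  have hy : y ∈ ⋃ x ∈ t, (fun y : Torus => y + ((e * s x : ℝ) : Torus)) ⁻¹' interior (L x) := by
    rw [ht]; trivial
  obtain ⟨x, hx, hyx⟩ := mem_iUnion₂.1 hy
  exact ⟨s x, hs x, mem_iUnion₂.2 ⟨x, hx, interior_subset hyx⟩⟩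

/-- After the critical time there are localized functions which reach all the characteristics. -/
lemma exists_controls (hω : IsOpen ω) (hne : ω.Nonempty) {T : ℝ} (hT : criticalTime ω < T) :
    ∃ ρ ρ' ρ'' : C(Torus, ℝ), Controls T ρ ρ' ρ'' ∧ tsupport ρ ⊆ ω := by
  have hT0 : 0 < T := (criticalTime_nonneg hω hne).trans_lt hT
  -- In `accum` with speed e the point x is followed to x - es, so e = 1 requires backward hitting
  -- and e = -1 forward hitting.
  obtain ⟨K₁, hK₁ω, hK₁, h₁⟩ := exists_isCompact_hitting hω (exists_hitting_backward hω hne hT)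
  obtain ⟨K₂, hK₂ω, hK₂, h₂⟩ := exists_isCompact_hitting hω (exists_hitting_forward hω hne hT)
  obtain ⟨O, hO, hKO, hOω, -⟩ := exists_open_between_and_isCompact_closure (hK₁.union hK₂) hω
    (union_subset hK₁ω hK₂ω)
  obtain ⟨ρ, ρ', ρ'', hρ, hρ', h0, hs⟩ := exists_c1Deriv_support_eq hO
  have hpos : ∀ x ∈ K₁ ∪ K₂, 0 < ρ x := fun x hx => by
    have : x ∈ Function.support ρ := by rw [hs]; exact hKO hx
    exact (h0 x).lt_of_ne' this
  refine ⟨ρ, ρ', ρ'', ⟨hρ, hρ', ?_, fun x => ?_, fun x => ?_⟩, ?_⟩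
  · obtain ⟨s, -, hx⟩ := h₁ 0
    exact (inner_one_pos h0 (hpos _ (Or.inl hx)).ne').ne'
  · obtain ⟨s, hs, hx⟩ := h₁ x
    refine accum_pos hT0 h0 hs (hpos _ (Or.inl ?_))
    rwa [← neg_mul]
  · obtain ⟨s, hs, hx⟩ := h₂ x
    refine accum_pos hT0 h0 hs (hpos _ (Or.inr ?_))
    rwa [← neg_mul, neg_neg]
  · rw [tsupport, hs]; exact hOω

end hittingTime

end

section

/-! ### Optimality of the critical time -/

lemma inner_one_shiftC (s : ℝ) (m : C(Torus, ℝ)) :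
    inner ℝ (toL2 (1 : C(Torus, ℝ))) (toL2 (shiftC s m)) = inner ℝ (toL2 (1 : C(Torus, ℝ))) (toL2 m) := by
  have h : shiftL s (toL2 (1 : C(Torus, ℝ))) = toL2 1 := shiftL_toL2 s 1
  rw [← shiftL_toL2, ← h, (shiftL (E := ℝ) s).inner_map_map, h]

/-- From a point x with maximal hitting time, the arc (x, x + T₀ - T) moves forward for a time T
without meeting ω. The invariant velocity minus strain, averaged over this arc, is thus conserved.
-/
lemma exists_not_reachable {ω : Set Torus} (hω : IsOpen ω) (hne : ω.Nonempty) {T : ℝ} (hT : 0 < T)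
    (hTω : T < criticalTime ω) (d : ℤ) :
    ∃ u₀ u₁ : State, u₀.posC = windC d ∧ u₁.posC = windC d ∧
      ∀ (f : ℝ × Torus → Plane) (u : ℝ → State),
        IsControl ω T f → IsSolution T f u₀ u → u T ≠ u₁ := by
  obtain ⟨x, hx⟩ := (isGreatest_criticalTime hω hne).1
  have hxω : ∀ α : ℝ, 0 ≤ α → α < criticalTime ω → x + (α : Torus) ∉ ω := fun α h0 hα h =>
    (hittingTime_le h0 h).not_gt (by rwa [hx])
  have hO : IsOpen ((fun y => x + y) '' (((↑) : ℝ → Torus) '' Ioo 0 (criticalTime ω - T))) :=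
    (Homeomorph.addLeft x).isOpenMap _ (QuotientAddGroup.isOpenMap_coe _ isOpen_Ioo)
  obtain ⟨m, m', -, hm, -, h0, hs⟩ := exists_c1Deriv_support_eq hO
  obtain ⟨α, hα⟩ : (Ioo 0 (criticalTime ω - T)).Nonempty := nonempty_Ioo.2 (by linarith)
  have hpos : 0 < inner ℝ (toL2 m) (toL2 (1 : C(Torus, ℝ))) := by
    refine inner_one_pos h0 (x := x + (α : Torus)) ?_
    rw [← Function.mem_support, hs]
    exact ⟨_, ⟨α, hα, rfl⟩, rfl⟩
  rw [real_inner_comm] at hpos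
  have hrot : rotC (ContinuousMap.const Torus 0) (windC d) = windC d := by ext1 y; simp
  -- Equal positions, but angular velocities 0 and 1: the strain d is common, so the invariants
  -- differ by the constant 1.
  refine ⟨mkState d (spDeriv_const 0) 0, mkState d (spDeriv_const 0) (toL2 1), hrot, hrot,
    fun f u hf hu huT => ?_⟩
  -- The weight at time t lives on the arc advanced by t, where the control vanishes at every time
  -- s; the localized control is therefore zero.
  have hvan : ∀ t ∈ Icc 0 T, ∀ s y, shiftC (-1 * t) m y • f (s, y) = 0 := by
    intro t ht s y
    by_contra hn
    obtain ⟨h1, h2⟩ := smul_ne_zero_iff.1 hn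
    have h3 : y ∈ ω := (hf.support_subset (subset_tsupport f h2)).2
    have h4 : y + ((-1 * t : ℝ) : Torus) ∈ Function.support m := h1
    rw [hs] at h4
    obtain ⟨_, ⟨β, hβ, rfl⟩, hy⟩ := h4
    have h5 : y = x + ((β + t : ℝ) : Torus) := by
      have h6 : x + (β : Torus) = y + ((-1 * t : ℝ) : Torus) := hy
      rw [neg_one_mul, AddCircle.coe_neg, ← sub_eq_add_neg, eq_sub_iff_add_eq] at h6
      rw [AddCircle.coe_add, ← h6, add_assoc]
    rw [h5] at h3
    exact hxω _ (by linarith [hβ.1, ht.1]) (by linarith [hβ.2, ht.2]) h3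
  let r : ℝ → ℝ := fun s =>
    inner ℝ ((u s).angVel + (-1 : ℝ) • (u s).angStrain) (toL2 (shiftC (-1 * s) m))
  have hd : ∀ t ∈ Icc 0 T, HasDerivWithinAt r 0 (Icc 0 T) t := fun t ht => by
    have h := hu.hasDerivWithinAt_invariant hm (e := -1) (by norm_num) ht (F := fun _ => 0)
      continuousOn_const fun s _ => by
        filter_upwards [Lp.coeFn_zero Plane 2 (volume : Measure Torus)] with y hy
        rw [hy, hvan t ht s y]; rfl
    simpa only [inner_zero_left, neg_zero] using h
  have hconst : r T = r 0 := constant_of_derivWithin_zero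
    (fun t ht => (hd t ht).differentiableWithinAt)
    (fun t ht => (hd t (Ico_subset_Icc_self ht)).derivWithin (uniqueDiffOn_Icc hT t
      (Ico_subset_Icc_self ht))) T (right_mem_Icc.2 hT.le)
  simp only [r, huT, hu.initial, mkState_angVel, mkState_angStrain, inner_add_left, inner_smul_left,
    inner_zero_left, inner_one_shiftC, conj_trivial] at hconst
  linarith

lemma homotopic_of_posC {u : State} {d : ℤ} (hu : u.posC = windC d) {g : C(Torus, Target)}
    {y : C(Torus, ℝ)} (hg : ∀ x, (g x : Plane) = rot (y x) (windC d x)) :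
    ContinuousMap.Homotopic u.pos g := by
  refine homotopic_of_eq_rot y fun x => ?_
  rw [hg, ← hu]
  rfl

lemma globallyExactlyControllableInTime {ω : Set Torus} (hω : IsOpen ω) (hne : ω.Nonempty) {T : ℝ}
    (hT : criticalTime ω < T) : GloballyExactlyControllableInTime ω T := by
  intro u₀ u₁ h
  obtain ⟨ρ, ρ', ρ'', H, hρ⟩ := exists_controls hω hne hT
  obtain ⟨d, a₀, a₁, h₀, h₁⟩ := exists_lifts_of_homotopic h
  exact H.steerable ((criticalTime_nonneg hω hne).trans_lt hT) hρ h₀ h₁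

end

end WaveMaps

end

theorem mainTheorem3 (ω : Set WaveMaps.Torus) (hω : IsOpen ω) (hne : ω.Nonempty) :
    WaveMaps.GloballyExactlyControllable ω ∧
    IsGreatest (Set.range (WaveMaps.hittingTime ω)) (WaveMaps.criticalTime ω) ∧
    WaveMaps.criticalTime ω ≤ 2 * Real.pi ∧
    (∀ T : ℝ, WaveMaps.criticalTime ω < T → WaveMaps.GloballyExactlyControllableInTime ω T) ∧
    (∀ T : ℝ, 0 < T → T < WaveMaps.criticalTime ω →
      ∀ g : C(WaveMaps.Torus, WaveMaps.Target), ∃ u₀ u₁ : WaveMaps.State,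
        ContinuousMap.Homotopic u₀.pos g ∧ ContinuousMap.Homotopic u₁.pos g ∧
        ∀ (f : ℝ × WaveMaps.Torus → WaveMaps.Plane) (u : ℝ → WaveMaps.State),
          WaveMaps.IsControl ω T f → WaveMaps.IsSolution T f u₀ u → u T ≠ u₁) := by
  refine ⟨fun u₀ u₁ h => ⟨WaveMaps.criticalTime ω + 1, ?_, ?_⟩,
    WaveMaps.isGreatest_criticalTime hω hne, WaveMaps.criticalTime_le hω hne,
    fun T hT => WaveMaps.globallyExactlyControllableInTime hω hne hT, fun T hT hTω g => ?_⟩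
  · linarith [WaveMaps.criticalTime_nonneg hω hne]
  · exact WaveMaps.globallyExactlyControllableInTime hω hne (lt_add_one _) u₀ u₁ h
  · obtain ⟨d, y, hy⟩ := WaveMaps.exists_eq_rot_windC g
    obtain ⟨u₀, u₁, h₀, h₁, h⟩ := WaveMaps.exists_not_reachable hω hne hT hTω d
    exact ⟨u₀, u₁, WaveMaps.homotopic_of_posC h₀ hy, WaveMaps.homotopic_of_posC h₁ hy, h⟩
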